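/- Let $\Phi$ be a smooth field of Cayley forms on an open set $U\subset\mathbb R^8$ (a coordinate domain of an 8-manifold): at each point $\Phi$ lies in the $\mathrm{GL}(8,\mathbb R)$-orbit of the standard Cayley form, with the sign for which $\Phi_{ijpq}\Phi_{ab}{}^{pq}=6g_{ia}g_{jb}-6g_{ib}g_{ja}-4\Phi_{ijab}$, where $g$ is the metric determined by $\Phi$. Indices are moved with $g$, $v_\Phi=\frac1{14}\Phi\wedge\Phi$ is the volume form, with components $\epsilon_{i_1\dots i_8}$, and $[\cdots]$ denotes antisymmetrisation of weight one, not acting on indices between vertical bars. Put $$J_3(\gamma)_{ijk}=\tfrac32\Phi_{[ij}{}^{pq}\gamma_{k]pq},\quad J_4(\sigma)_{ijkl}=3\Phi_{[ij}{}^{pq}\sigma_{kl]pq},\quad K(h)_{ijkl}=4h_{[i|p|}\Phi^p{}_{jkl]},\quad J_2(\beta)_{ij}=\tfrac12\Phi_{ij}{}^{pq}\beta_{pq},$$ let $\Lambda^2_7$ be the image of the projector $\pi_7=\frac14(\mathbb I-J_2)$ on 2-forms and let $\Lambda^4_{27}=\{\sigma\in\Lambda^4: J_4(\sigma)=2\sigma\}$.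 The operator $J_3$ satisfies $J_3^2=6\,\mathbb I-5J_3$, so $J_3^{-1}=\frac16(J_3+5\,\mathbb I)$, and the torsion 3-form of $\Phi$ is $$T=\tfrac52J_3^{-1}(\star d\Phi),\qquad (\star d\Phi)_{mnr}=\tfrac1{5!}\,\epsilon_{mnr}{}^{aijkl}\,\partial_a\Phi_{ijkl}.$$ For a 3-form $C$ set $(C\wedge_\Phi C)_{abcd}=C_{[ab}{}^pC_{cd]p}$, and for $\lambda\in\mathbb R$ consider the action $$S[\Phi,C]=\int \Phi\wedge(dC-6\,C\wedge_\Phi C)+\tfrac{\lambda}{6}\,v_\Phi$$ subject to the constraint that $\Phi$ is a Cayley form. The Euler–Lagrange equations in $\Phi$ say that $S[\cdot,C]$, at fixed $C$, is stationary at $\Phi$ under all smooth compactly supported variations of $\Phi$ through Cayley forms. Let $$(TT)_{ab}=\Phi^{ijkl}T_{ija}T_{klb}-\tfrac17g_{ab}\Phi^{ijkl}T_{ij}{}^pT_{klp}.$$ Then the Euler–Lagrange equations in $\Phi$, taken at $C=T$, are equivalent to each of the following. 1. At every point of $U$ there is a symmetric tracefree $\Psi\in\Lambda^2_7\otimes_S\Lambda^2_7$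 with $$\partial_{[a}T_{bcd]}-\tfrac32T_{[ab}{}^pT_{cd]p}-\tfrac18(TT)_{[a|e|}\Phi^e{}_{bcd]}+\tfrac{\lambda}{168}\Phi_{abcd}=\Psi_{[ab}{}^{pq}\Phi_{|pq|cd]}.$$ 2. At every point of $U$, $$dT-6\,T\wedge_\Phi T-\tfrac18K(TT)+\tfrac{\lambda}{42}\Phi\in\Lambda^4_{27}.$$ -/

import Mathlib

open scoped ContDiff

noncomputable section

namespace Spin7

/-- The coordinate space `ℝ⁸`. -/
abbrev Space : Type := Fin 8 → ℝ

/-- Alternating `k`-forms on `ℝ⁸`; a differential `k`-form is a function `Space → Form k`. -/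
abbrev Form (k : ℕ) : Type := Space [⋀^Fin k]→L[ℝ] ℝ

/-- Arrays of components `t_{i₁ … iₖ}` of covariant `k`-tensors on `ℝ⁸`. -/
abbrev Tensor (k : ℕ) : Type := (Fin k → Fin 8) → ℝ

/-! ### Linear algebra of forms and their components -/

/-- The coordinate vector `∂_i`. -/
def basisVec (i : Fin 8) : Space := Pi.single i 1

/-- The components `α_{i₁ … iₖ} = α(∂_{i₁}, …, ∂_{iₖ})`. -/
def comp {k : ℕ} (α : Form k) : Tensor k := fun I => α (fun j => basisVec (I j))

/-- `dx^{i₁} ∧ … ∧ dx^{iₖ}`, which maps `(v₁, …, vₖ)` to `det (v_a^{i_b})`. -/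
def dx {k : ℕ} (I : Fin k → Fin 8) : Form k :=
  ContinuousMultilinearMap.alternatization
    ((ContinuousMultilinearMap.mkPiAlgebra ℝ (Fin k) ℝ).compContinuousLinearMap
      (fun j => ContinuousLinearMap.proj (R := ℝ) (φ := fun _ : Fin 8 => ℝ) (I j)))

/-- The form `(1/k!) t_{i₁ … iₖ} dx^{i₁} ∧ … ∧ dx^{iₖ}`. -/
def formOf {k : ℕ} (t : Tensor k) : Form k := (1 / (k.factorial : ℝ)) • ∑ I, t I • dx I

/-- Total antisymmetrisation `t_{[i₁ … iₖ]}` with unit weight. -/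
def alt {k : ℕ} (t : Tensor k) : Tensor k := fun I =>
  (1 / (k.factorial : ℝ)) *
    ∑ σ : Equiv.Perm (Fin k), ((Equiv.Perm.sign σ : ℤ) : ℝ) * t (fun j => I (σ j))

/-- The coefficient of `dx⁰ ∧ … ∧ dx⁷` in `α ∧ β`, for 4-forms with components `α`, `β`. -/
def topWedge (α β : Tensor 4) : ℝ :=
  (1 / ((Nat.factorial 4 : ℝ) * (Nat.factorial 4 : ℝ))) *
    ∑ σ : Equiv.Perm (Fin 8), ((Equiv.Perm.sign σ : ℤ) : ℝ) *
      α (fun j => σ (Fin.castAdd 4 j)) * β (fun j => σ (Fin.natAdd 4 j))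

/-! ### Cayley forms, their metric and volume form -/

/-- The model Cayley form. Its overall sign is the one for which
`Φ_{ijpq} Φ_{abpq} = 6 δ_{ia} δ_{jb} - 6 δ_{ib} δ_{ja} - 4 Φ_{ijab}`. -/
def modelCayley : Form 4 :=
  - (dx ![0, 1, 2, 3] + dx ![0, 1, 4, 5] + dx ![0, 1, 6, 7] + dx ![0, 2, 4, 6]
    - dx ![0, 2, 5, 7] - dx ![0, 3, 4, 7] - dx ![0, 3, 5, 6] - dx ![1, 2, 4, 7]
    - dx ![1, 2, 5, 6] - dx ![1, 3, 4, 6] + dx ![1, 3, 5, 7] + dx ![2, 3, 4, 5]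
    + dx ![2, 3, 6, 7] + dx ![4, 5, 6, 7])

/-- A Cayley form: an element of the `GL(8, ℝ)`-orbit of the model. -/
def IsCayley (φ : Form 4) : Prop :=
  ∃ A : Space ≃L[ℝ] Space, φ = modelCayley.compContinuousLinearMap (A : Space →L[ℝ] Space)

/-- `g` is the Gram matrix of the inner product `A^* ⟨·,·⟩` for some linear isomorphism `A` with
`φ = A^* modelCayley`. As the stabiliser of the model lies in `SO(8)`, a Cayley form has exactly
one such matrix. -/
def IsMetricOf (φ : Form 4) (g : Matrix (Fin 8) (Fin 8) ℝ) : Prop :=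
  ∃ A : Space ≃L[ℝ] Space,
    φ = modelCayley.compContinuousLinearMap (A : Space →L[ℝ] Space) ∧
    ∀ i j, g i j = ∑ k, A (basisVec i) k * A (basisVec j) k

/-- The metric `g_{ij}` determined by a Cayley form. -/
def metric (φ : Form 4) : Matrix (Fin 8) (Fin 8) ℝ := Classical.epsilon (IsMetricOf φ)

/-- The inverse metric `g^{ij}`. -/
def invMetric (φ : Form 4) : Matrix (Fin 8) (Fin 8) ℝ := (metric φ)⁻¹

/-- The coefficient of the volume form `v_Φ = (1/14) Φ ∧ Φ`. -/
def vol (φ : Form 4) : ℝ := (1 / 14) * topWedge (comp φ) (comp φ)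

/-- The components `ε_{i₁ … i₈}` of the volume form `v_Φ`. -/
def eps (φ : Form 4) : Tensor 8 := fun I =>
  vol φ * Matrix.det (Matrix.of fun i j : Fin 8 => if I i = j then (1 : ℝ) else 0)

/-! ### Index gymnastics and the operators `J₃`, `J₄`, `K`, `π₇` -/

/-- `Φ^a_{bcd}`. -/
def phi13 (φ : Form 4) (a b c d : Fin 8) : ℝ :=
  ∑ r, invMetric φ a r * comp φ ![r, b, c, d]

/-- `Φ_{ij}^{pq}`. -/
def phi22 (φ : Form 4) (i j p q : Fin 8) : ℝ :=
  ∑ r, ∑ s, comp φ ![i, j, r, s] * invMetric φ r p * invMetric φ s q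

/-- `Φ^{ijkl}`. -/
def phiUp (φ : Form 4) (i j k l : Fin 8) : ℝ :=
  ∑ r, ∑ s, invMetric φ i r * invMetric φ j s * phi22 φ r s k l

/-- `J₃(γ)_{ijk} = (3/2) Φ_{[ij}^{pq} γ_{k]pq}`. -/
def J3 (φ : Form 4) (γ : Tensor 3) : Tensor 3 :=
  (3 / 2 : ℝ) • alt (fun I => ∑ p, ∑ q, phi22 φ (I 0) (I 1) p q * γ ![I 2, p, q])

/-- `J₄(σ)_{ijkl} = 3 Φ_{[ij}^{pq} σ_{kl]pq}`. -/
def J4 (φ : Form 4) (σ : Tensor 4) : Tensor 4 :=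
  (3 : ℝ) • alt (fun I => ∑ p, ∑ q, phi22 φ (I 0) (I 1) p q * σ ![I 2, I 3, p, q])

/-- The components of an element of `Λ⁴₂₇`, the eigenspace of `J₄` on 4-forms for the
eigenvalue `2`. -/
def InLambda27 (φ : Form 4) (σ : Tensor 4) : Prop :=
  alt σ = σ ∧ J4 φ σ = (2 : ℝ) • σ

/-- `K(h)_{ijkl} = 4 h_{[i|p|} Φ^p_{jkl]}`. -/
def K (φ : Form 4) (h : Matrix (Fin 8) (Fin 8) ℝ) : Tensor 4 :=
  (4 : ℝ) • alt (fun I => ∑ p, h (I 0) p * phi13 φ p (I 1) (I 2) (I 3))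

/-- The projector `π₇ = (1/4)(1 - J₂)` of 2-forms onto `Λ²₇`, with
`J₂(β)_{ij} = (1/2) Φ_{ij}^{pq} β_{pq}`. -/
def proj7 (φ : Form 4) (β : Fin 8 → Fin 8 → ℝ) (i j : Fin 8) : ℝ :=
  (1 / 4) * (β i j - (1 / 2) * ∑ p, ∑ q, phi22 φ i j p q * β p q)

/-- `Ψ_{abcd}` is a symmetric tracefree matrix in `Λ²₇ ⊗_S Λ²₇`. -/
structure IsSymTracefree7 (φ : Form 4) (Ψ : Tensor 4) : Prop where
  antisymm_left : ∀ a b c d, Ψ ![b, a, c, d] = - Ψ ![a, b, c, d]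
  antisymm_right : ∀ a b c d, Ψ ![a, b, d, c] = - Ψ ![a, b, c, d]
  symm : ∀ a b c d, Ψ ![c, d, a, b] = Ψ ![a, b, c, d]
  tracefree : ∑ a, ∑ b, ∑ c, ∑ d, invMetric φ a c * invMetric φ b d * Ψ ![a, b, c, d] = 0
  proj_left : ∀ a b c d, proj7 φ (fun i j => Ψ ![i, j, c, d]) a b = Ψ ![a, b, c, d]
  proj_right : ∀ a b c d, proj7 φ (fun i j => Ψ ![a, b, i, j]) c d = Ψ ![a, b, c, d]

/-- `(ΨΦ)_{abcd} = Ψ_{[ab}^{pq} Φ_{|pq|cd]}`. -/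
def psiPhi (φ : Form 4) (Ψ : Tensor 4) : Tensor 4 :=
  alt (fun I => ∑ p, ∑ q, ∑ r, ∑ s, Ψ ![I 0, I 1, r, s] * invMetric φ r p * invMetric φ s q *
    comp φ ![p, q, I 2, I 3])

/-- `(γ ∧_Φ γ)_{abcd} = γ_{[ab}^p γ_{cd]p}`. -/
def wedgePhi (φ : Form 4) (γ : Form 3) : Tensor 4 :=
  alt (fun I => ∑ p, ∑ q,
    invMetric φ p q * comp γ ![I 0, I 1, p] * comp γ ![I 2, I 3, q])

/-- `(γγ)_{ab} = Φ^{ijkl} γ_{ija} γ_{klb} - (1/7) g_{ab} Φ^{ijkl} γ_{ij}^p γ_{klp}`. -/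
def quadMatrix (φ : Form 4) (γ : Form 3) : Matrix (Fin 8) (Fin 8) ℝ := Matrix.of fun a b =>
  (∑ i, ∑ j, ∑ k, ∑ l, phiUp φ i j k l * comp γ ![i, j, a] * comp γ ![k, l, b])
    - (1 / 7) * metric φ a b *
      ∑ i, ∑ j, ∑ k, ∑ l, ∑ p, ∑ q,
        phiUp φ i j k l * invMetric φ p q * comp γ ![i, j, p] * comp γ ![k, l, q]

/-! ### The torsion 3-form -/

/-- The partial derivatives `∂_{i₀} α_{i₁ … iₖ}` at `x`. -/
def partialDeriv {k : ℕ} (α : Space → Form k) (x : Space) : Tensor (k + 1) := fun I =>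
  fderiv ℝ (fun y => comp (α y) (Fin.tail I)) x (basisVec (I 0))

/-- `(⋆dΦ)_{mnr} = (1/5!) ε_{mnr}^{aijkl} ∂_a Φ_{ijkl}`. -/
def starD (Φ : Space → Form 4) (x : Space) : Tensor 3 := fun I =>
  (1 / (Nat.factorial 5 : ℝ)) * ∑ L : Fin 5 → Fin 8, ∑ M : Fin 5 → Fin 8,
    eps (Φ x) (Fin.append I L) * (∏ j, invMetric (Φ x) (L j) (M j)) * partialDeriv Φ x M

/-- The torsion 3-form `T = (5/2) J₃⁻¹(⋆dΦ)`. As `J₃² = 6 - 5 J₃`, one has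
`J₃⁻¹ = (1/6)(J₃ + 5)`. -/
def torsion (Φ : Space → Form 4) (x : Space) : Form 3 :=
  formOf ((5 / 2 : ℝ) • (1 / 6 : ℝ) • (J3 (Φ x) (starD Φ x) + (5 : ℝ) • starD Φ x))

/-! ### The action and its Euler–Lagrange equations in `Φ` -/

/-- The coefficient of `Φ ∧ (dC - 6 C ∧_Φ C) + (lam/6) v_Φ` at `x`. -/
def lagrangian (lam : ℝ) (Φ : Space → Form 4) (C : Space → Form 3) (x : Space) : ℝ :=
  topWedge (comp (Φ x)) (comp (extDeriv C x) - (6 : ℝ) • wedgePhi (Φ x) (C x))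
    + lam / 6 * vol (Φ x)

/-- The action of `(Φ, C)` over a region `R`. -/
def action (lam : ℝ) (R : Set Space) (Φ : Space → Form 4) (C : Space → Form 3) : ℝ :=
  ∫ x in R, lagrangian lam Φ C x

/-- A smooth one-parameter family of fields of Cayley forms on `U` through `Φ` that is fixed
outside the compact set `R`. -/
structure IsVariation (U R : Set Space) (Φ : Space → Form 4) (V : ℝ → Space → Form 4) : Prop where
  smooth : ContDiffOn ℝ ∞ (fun z : ℝ × Space => V z.1 z.2) (Set.univ ×ˢ U)
  cayley : ∀ s, ∀ x ∈ U, IsCayley (V s x)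
  initial : ∀ x ∈ U, V 0 x = Φ x
  support : ∀ s, ∀ x ∈ U \ R, V s x = Φ x

/-- The Euler–Lagrange equations in `Φ` (at fixed `C`): the action is stationary under all
compactly supported variations of `Φ` through Cayley forms. -/
def EulerLagrangePhi (lam : ℝ) (U : Set Space) (Φ : Space → Form 4) (C : Space → Form 3) : Prop :=
  ∀ R : Set Space, IsCompact R → R ⊆ U → ∀ V : ℝ → Space → Form 4, IsVariation U R Φ V →
    HasDerivAt (fun s => action lam R (V s) C) 0 0

/-- `∂_{[a} T_{bcd]} - (3/2) T_{[ab}^p T_{cd]p} - (1/8) (TT)_{[a|e|} Φ^e_{bcd]}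
+ (lam/168) Φ_{abcd}`. -/
def indexExpr (lam : ℝ) (Φ : Space → Form 4) (T : Space → Form 3) (x : Space) : Tensor 4 :=
  alt (partialDeriv T x) - (3 / 2 : ℝ) • wedgePhi (Φ x) (T x)
    - (1 / 8 : ℝ) • alt (fun I => ∑ e, quadMatrix (Φ x) (T x) (I 0) e *
        phi13 (Φ x) e (I 1) (I 2) (I 3))
    + (lam / 168) • comp (Φ x)

/-- The components of `dT - 6 T ∧_Φ T - (1/8) K(TT) + (lam/42) Φ`. -/
def formExpr (lam : ℝ) (Φ : Space → Form 4) (T : Space → Form 3) (x : Space) : Tensor 4 :=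
  comp (extDeriv T x) - (6 : ℝ) • wedgePhi (Φ x) (T x)
    - (1 / 8 : ℝ) • K (Φ x) (quadMatrix (Φ x) (T x)) + (lam / 42) • comp (Φ x)

end Spin7

end

noncomputable section

namespace Spin7

/-! ### Sums over multi-indices -/

/-! At fixed C the Lagrangian contains no derivative of Φ, so stationarity is a pointwise condition,
and the question is which velocities Φ may have. Cayley forms make up one GL(8) orbit, so the
velocities are the infinitesimal pullbacks `act X Φ`, under which the inverse metric G moves by -(XG
+ GXᵀ). The identity `topWedge_act` shifts X from Φ to dC - 6 C ∧_Φ C, and the first variation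
becomes vol/24 times the pairing of X with the matrix `gradient`. If N_i^b = E_{ipqr} Φ^{bpqr} is
the contraction of E = dC - 6 C ∧_Φ C - K(CC)/8 + (lam/42) Φ, then the gradient is tr(N)·1 - 4N. It
vanishes exactly when N does (`IsMetricFrame.firstVariation_act`,
`IsMetricFrame.gradient_eq_zero_iff`, `eulerLagrangePhi_iff`).

It remains to recognise the 4-forms with zero contraction, and everything here rests on the single
contraction identity `mc_contract`. Inserting the contraction of a 4-form τ into Φ and
antisymmetrising gives 6τ - 3 J₄τ (`IsMetricFrame.alt_insert_contract`). Hence zero contraction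
gives J₄τ = 2τ; conversely J₄τ = 2τ makes the norm of the contraction vanish
(`IsMetricFrame.inLambda27_iff`). A 4-form τ with zero contraction comes from Ψ = -π₇τ, whose pair
symmetry is the first Bianchi argument of Riemannian geometry
(`IsMetricFrame.exists_symTracefree7`). In the other direction the Ricci contraction of Ψ satisfies
36 Ric = -28 Ric, hence vanishes, and with it the contraction of ΨΦ
(`IsSymTracefree7.ricci_eq_zero`, `IsSymTracefree7.contract_psiPhi`).

Two points need care. The metric is defined by choice; `IsFrame.sqrt_detMinors` recovers its inverse
from Φ by an explicit formula, which gives both independence of the frame and smoothness. And a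
variation is a smooth curve of forms, not of frames; that its velocity is still an infinitesimal
pullback follows by differentiating the double contraction identity (`exists_velocity`). The torsion
enters only as a smooth 3-form. -/

lemma sum_fin4 {β : Type*} [AddCommMonoid β] (F : (Fin 4 → Fin 8) → β) :
    ∑ I, F I = ∑ a, ∑ b, ∑ c, ∑ d, F ![a, b, c, d] := by
  have h : ∀ (n : ℕ) (F : (Fin (n + 1) → Fin 8) → β),
      ∑ I, F I = ∑ a, ∑ J : Fin n → Fin 8, F (Matrix.vecCons a J) := by
    intro n F
    rw [← Fintype.sum_prod_type']
    exact (Fintype.sum_equiv (Fin.consEquiv (fun _ : Fin (n + 1) => Fin 8)) _ _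
      (fun _ => rfl)).symm
  rw [h]
  refine Finset.sum_congr rfl fun a _ => ?_
  rw [h]
  refine Finset.sum_congr rfl fun b _ => ?_
  rw [h]
  refine Finset.sum_congr rfl fun c _ => ?_
  rw [h]
  refine Finset.sum_congr rfl fun d _ => ?_
  rw [Fintype.sum_unique]
  congr

lemma vec4_eta {α : Type*} (I : Fin 4 → α) : ![I 0, I 1, I 2, I 3] = I := by
  ext i; fin_cases i <;> rfl

/-! ### Antisymmetrisation -/

lemma alt_add {k : ℕ} (s t : Tensor k) : alt (s + t) = alt s + alt t := by
  ext I; simp [alt, mul_add, Finset.sum_add_distrib]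

lemma alt_smul {k : ℕ} (c : ℝ) (t : Tensor k) : alt (c • t) = c • alt t := by
  ext I
  simp only [alt, Pi.smul_apply, smul_eq_mul, Finset.mul_sum]
  exact Finset.sum_congr rfl fun σ _ => by ring

lemma alt_neg {k : ℕ} (t : Tensor k) : alt (-t) = - alt t := by
  ext I; simp [alt]

lemma alt_sub {k : ℕ} (s t : Tensor k) : alt (s - t) = alt s - alt t := by
  rw [sub_eq_add_neg, alt_add, alt_neg, sub_eq_add_neg]

/-- Antisymmetry of an array of components under permutations of the indices. -/
def IsAlt {k : ℕ} (t : Tensor k) : Prop :=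
  ∀ (σ : Equiv.Perm (Fin k)) (I : Fin k → Fin 8),
    t (fun j => I (σ j)) = ((Equiv.Perm.sign σ : ℤ) : ℝ) * t I

lemma sign_mul_self {k : ℕ} (σ : Equiv.Perm (Fin k)) :
    ((Equiv.Perm.sign σ : ℤ) : ℝ) * ((Equiv.Perm.sign σ : ℤ) : ℝ) = 1 := by
  rcases Int.units_eq_one_or (Equiv.Perm.sign σ) with h | h <;> simp [h]

lemma IsAlt.alt_eq {k : ℕ} {t : Tensor k} (h : IsAlt t) : alt t = t := by
  ext I
  simp only [alt, h _ I, ← mul_assoc, sign_mul_self]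
  simp [Fintype.card_perm, ← mul_assoc,
    inv_mul_cancel₀ (show (k.factorial : ℝ) ≠ 0 by positivity)]

lemma isAlt_alt {k : ℕ} (t : Tensor k) : IsAlt (alt t) := by
  intro σ I
  simp only [alt]
  rw [mul_left_comm]
  congr 1
  rw [Finset.mul_sum]
  refine Fintype.sum_equiv (Equiv.mulLeft σ) _ _ fun τ => ?_
  simp only [Equiv.coe_mulLeft, Equiv.Perm.coe_mul, Function.comp_apply, Equiv.Perm.sign_mul,
    Units.val_mul, Int.cast_mul]
  rw [← mul_assoc, ← mul_assoc, sign_mul_self, one_mul]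

lemma alt_comp_perm {k : ℕ} (t : Tensor k) (τ : Equiv.Perm (Fin k)) :
    alt (fun I => t (fun j => I (τ j))) = ((Equiv.Perm.sign τ : ℤ) : ℝ) • alt t := by
  ext I
  simp only [alt, Pi.smul_apply, smul_eq_mul]
  rw [mul_left_comm]
  congr 1
  rw [Finset.mul_sum]
  refine Fintype.sum_equiv (Equiv.mulRight τ) _ _ fun σ => ?_
  simp only [Equiv.coe_mulRight, Equiv.Perm.coe_mul, Function.comp_apply, Equiv.Perm.sign_mul,
    Units.val_mul, Int.cast_mul]
  linear_combination (-(((Equiv.Perm.sign σ : ℤ) : ℝ) * t fun j => I (σ (τ j)))) *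
    sign_mul_self τ

lemma isAlt_iff_alt_eq {k : ℕ} {t : Tensor k} : IsAlt t ↔ alt t = t :=
  ⟨IsAlt.alt_eq, fun h => h ▸ isAlt_alt t⟩

lemma IsAlt.add {k : ℕ} {s t : Tensor k} (hs : IsAlt s) (ht : IsAlt t) : IsAlt (s + t) := by
  rw [isAlt_iff_alt_eq] at *; rw [alt_add, hs, ht]

lemma IsAlt.sub {k : ℕ} {s t : Tensor k} (hs : IsAlt s) (ht : IsAlt t) : IsAlt (s - t) := by
  rw [isAlt_iff_alt_eq] at *; rw [alt_sub, hs, ht]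

lemma IsAlt.smul {k : ℕ} {t : Tensor k} (ht : IsAlt t) (c : ℝ) : IsAlt (c • t) := by
  rw [isAlt_iff_alt_eq] at *; rw [alt_smul, ht]

lemma IsAlt.swap01 {t : Tensor 4} (h : IsAlt t) (a b c d : Fin 8) :
    t ![b, a, c, d] = - t ![a, b, c, d] := by
  have := h (Equiv.swap 0 1) ![a, b, c, d]
  rw [Equiv.Perm.sign_swap (by decide)] at this
  simp only [Units.val_neg, Units.val_one, Int.cast_neg, Int.cast_one, neg_one_mul] at this
  rw [← this]; congr 1; ext j; fin_cases j <;> rfl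

lemma IsAlt.swap12 {t : Tensor 4} (h : IsAlt t) (a b c d : Fin 8) :
    t ![a, c, b, d] = - t ![a, b, c, d] := by
  have := h (Equiv.swap 1 2) ![a, b, c, d]
  rw [Equiv.Perm.sign_swap (by decide)] at this
  simp only [Units.val_neg, Units.val_one, Int.cast_neg, Int.cast_one, neg_one_mul] at this
  rw [← this]; congr 1; ext j; fin_cases j <;> rfl

lemma IsAlt.swap23 {t : Tensor 4} (h : IsAlt t) (a b c d : Fin 8) :
    t ![a, b, d, c] = - t ![a, b, c, d] := by
  have := h (Equiv.swap 2 3) ![a, b, c, d]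
  rw [Equiv.Perm.sign_swap (by decide)] at this
  simp only [Units.val_neg, Units.val_one, Int.cast_neg, Int.cast_one, neg_one_mul] at this
  rw [← this]; congr 1; ext j; fin_cases j <;> rfl

lemma sum_perm_fin_succ {β : Type*} [AddCommMonoid β] {n : ℕ}
    (F : Equiv.Perm (Fin (n + 1)) → β) :
    ∑ σ, F σ = ∑ p : Fin (n + 1), ∑ τ : Equiv.Perm (Fin n),
      F (Equiv.Perm.decomposeFin.symm (p, τ)) := by
  rw [← Fintype.sum_prod_type']
  exact (Fintype.sum_equiv Equiv.Perm.decomposeFin.symm _ _ fun _ => rfl).symm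

/-- The signed sum of the components of `t` over the permutations of the indices. -/
def altSum (k : ℕ) (t : Tensor k) (I : Fin k → Fin 8) : ℝ :=
  ∑ σ : Equiv.Perm (Fin k), ((Equiv.Perm.sign σ : ℤ) : ℝ) * t (fun j => I (σ j))

/-- A permutation is determined by the image p of 0 and a permutation of the remaining indices; the
transposition of 0 and p contributes the sign, which is -1 unless p = 0. Iterating gives the
explicit 24 terms of `alt_four`, on which linear arithmetic can act. -/
lemma altSum_succ {k : ℕ} (t : Tensor (k + 1)) (I : Fin (k + 1) → Fin 8) :
    altSum (k + 1) t I = ∑ p : Fin (k + 1), (if p = 0 then 1 else -1) *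
      altSum k (fun J => t (Matrix.vecCons (I p) J))
        (fun j => I (Equiv.swap 0 p (Fin.succ j))) := by
  simp only [altSum, sum_perm_fin_succ]
  refine Finset.sum_congr rfl fun p _ => ?_
  rw [Finset.mul_sum]
  refine Finset.sum_congr rfl fun τ _ => ?_
  rw [Equiv.Perm.decomposeFin.symm_sign, ← mul_assoc]
  congr 1
  · split_ifs <;> simp
  · congr 1
    ext j
    refine Fin.cases ?_ (fun j => ?_) j
    · simp
    · simp [Equiv.Perm.decomposeFin_symm_apply_succ]

lemma altSum_one (t : Tensor 1) (a : Fin 8) : altSum 1 t ![a] = t ![a] := by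
  simp only [altSum, Fintype.sum_unique]
  have : (fun j => ![a] ((default : Equiv.Perm (Fin 1)) j)) = ![a] := by
    ext j; fin_cases j; rfl
  rw [this]
  simp

lemma altSum_two (t : Tensor 2) (a b : Fin 8) :
    altSum 2 t ![a, b] = t ![a, b] - t ![b, a] := by
  have h0 : (fun j => ![a, b] (Equiv.swap 0 0 (Fin.succ j))) = ![b] := by
    ext j; fin_cases j; rfl
  have h1 : (fun j => ![a, b] (Equiv.swap 0 1 (Fin.succ j))) = ![a] := by
    ext j; fin_cases j; rfl
  rw [altSum_succ, Fin.sum_univ_two, h0, h1]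
  simp [altSum_one]
  ring

lemma altSum_three (t : Tensor 3) (a b c : Fin 8) :
    altSum 3 t ![a, b, c] = t ![a, b, c] - t ![a, c, b] - t ![b, a, c] + t ![b, c, a]
      - t ![c, b, a] + t ![c, a, b] := by
  have h0 : (fun j => ![a, b, c] (Equiv.swap 0 0 (Fin.succ j))) = ![b, c] := by
    ext j; fin_cases j <;> rfl
  have h1 : (fun j => ![a, b, c] (Equiv.swap 0 1 (Fin.succ j))) = ![a, c] := by
    ext j; fin_cases j <;> rfl
  have h2 : (fun j => ![a, b, c] (Equiv.swap 0 2 (Fin.succ j))) = ![b, a] := by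
    ext j; fin_cases j <;> rfl
  rw [altSum_succ, Fin.sum_univ_three, h0, h1, h2]
  simp [altSum_two]
  ring

lemma altSum_four (t : Tensor 4) (a b c d : Fin 8) : altSum 4 t ![a, b, c, d] =
    t ![a, b, c, d] - t ![a, b, d, c] - t ![a, c, b, d] + t ![a, c, d, b] + t ![a, d, b, c]
      - t ![a, d, c, b]
      - t ![b, a, c, d] + t ![b, a, d, c] + t ![b, c, a, d] - t ![b, c, d, a] - t ![b, d, a, c]
      + t ![b, d, c, a]
      + t ![c, a, b, d] - t ![c, a, d, b] - t ![c, b, a, d] + t ![c, b, d, a] + t ![c, d, a, b]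
      - t ![c, d, b, a]
      - t ![d, a, b, c] + t ![d, a, c, b] + t ![d, b, a, c] - t ![d, b, c, a] - t ![d, c, a, b]
      + t ![d, c, b, a] := by
  have h0 : (fun j => ![a, b, c, d] (Equiv.swap 0 0 (Fin.succ j))) = ![b, c, d] := by
    ext j; fin_cases j <;> rfl
  have h1 : (fun j => ![a, b, c, d] (Equiv.swap 0 1 (Fin.succ j))) = ![a, c, d] := by
    ext j; fin_cases j <;> rfl
  have h2 : (fun j => ![a, b, c, d] (Equiv.swap 0 2 (Fin.succ j))) = ![b, a, d] := by
    ext j; fin_cases j <;> rfl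
  have h3 : (fun j => ![a, b, c, d] (Equiv.swap 0 3 (Fin.succ j))) = ![b, c, a] := by
    ext j; fin_cases j <;> rfl
  rw [altSum_succ, Fin.sum_univ_four, h0, h1, h2, h3]
  simp [altSum_three]
  ring

lemma alt_four (t : Tensor 4) (a b c d : Fin 8) : alt t ![a, b, c, d] = (1 / 24) *
    (t ![a, b, c, d] - t ![a, b, d, c] - t ![a, c, b, d] + t ![a, c, d, b] + t ![a, d, b, c]
      - t ![a, d, c, b]
      - t ![b, a, c, d] + t ![b, a, d, c] + t ![b, c, a, d] - t ![b, c, d, a] - t ![b, d, a, c]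
      + t ![b, d, c, a]
      + t ![c, a, b, d] - t ![c, a, d, b] - t ![c, b, a, d] + t ![c, b, d, a] + t ![c, d, a, b]
      - t ![c, d, b, a]
      - t ![d, a, b, c] + t ![d, a, c, b] + t ![d, b, a, c] - t ![d, b, c, a] - t ![d, c, a, b]
      + t ![d, c, b, a]) := by
  rw [← altSum_four]
  simp only [alt, altSum]
  norm_num [Nat.factorial]

/-! ### Forms and their components -/

lemma dx_apply {k : ℕ} (I : Fin k → Fin 8) (v : Fin k → Space) :
    dx I v = ∑ σ : Equiv.Perm (Fin k), ((Equiv.Perm.sign σ : ℤ) : ℝ) * ∏ j, v (σ j) (I j) := by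
  simp [dx, ContinuousMultilinearMap.alternatization_apply_apply, Units.smul_def]

lemma comp_dx {k : ℕ} (I J : Fin k → Fin 8) :
    comp (dx I) J = ∑ σ : Equiv.Perm (Fin k), ((Equiv.Perm.sign σ : ℤ) : ℝ) *
      if I = fun j => J (σ j) then 1 else 0 := by
  rw [comp, dx_apply]
  refine Finset.sum_congr rfl fun σ _ => ?_
  congr 1
  simp only [basisVec, Pi.single_apply]
  rw [Finset.prod_ite_zero]
  simp [funext_iff]

lemma comp_smul {k : ℕ} (c : ℝ) (α : Form k) : comp (c • α) = c • comp α := rfl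

lemma comp_formOf {k : ℕ} (t : Tensor k) : comp (formOf t) = alt t := by
  ext J
  have : comp (formOf t) J = (1 / (k.factorial : ℝ)) * ∑ I, t I * comp (dx I) J := by
    simp [comp, formOf]
  rw [this]
  simp only [alt, comp_dx, Finset.mul_sum]
  rw [Finset.sum_comm]
  refine Finset.sum_congr rfl fun σ _ => ?_
  rw [Finset.sum_eq_single (fun j => J (σ j))]
  · simp only [if_true]; ring
  · intro I _ h; simp [h]
  · simp

lemma isAlt_comp {k : ℕ} (α : Form k) : IsAlt (comp α) := by
  intro σ I
  have := α.toAlternatingMap.map_perm (fun j => basisVec (I j)) σ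
  simp only [Units.smul_def, zsmul_eq_mul] at this
  exact this

lemma apply_eq_sum_comp {k : ℕ} (α : Form k) (v : Fin k → Space) :
    α v = ∑ I : Fin k → Fin 8, (∏ j, v j (I j)) * comp α I := by
  have h : v = fun j => ∑ i, v j i • basisVec i := by
    ext j i
    simp [basisVec, Pi.single_apply]
  conv_lhs => rw [h]
  have := α.toMultilinearMap.map_sum (fun (j : Fin k) (i : Fin 8) => v j i • basisVec i)
  refine this.trans (Finset.sum_congr rfl fun I _ => ?_)
  exact α.toMultilinearMap.map_smul_univ (fun j => v j (I j)) (fun j => basisVec (I j))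

lemma comp_injective {k : ℕ} : Function.Injective (comp : Form k → Tensor k) := by
  intro α β h
  ext v
  rw [apply_eq_sum_comp, apply_eq_sum_comp, h]

/-- The pullback of covariant tensors by the linear map with matrix `E`. -/
def pull {k : ℕ} (E : Matrix (Fin 8) (Fin 8) ℝ) (t : Tensor k) : Tensor k := fun I =>
  ∑ J : Fin k → Fin 8, (∏ j, E (J j) (I j)) * t J

lemma comp_compContinuousLinearMap {k : ℕ} (α : Form k) (E : Space →L[ℝ] Space) :
    comp (α.compContinuousLinearMap E) =
      pull (Matrix.of fun a i => E (basisVec i) a) (comp α) := by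
  ext I
  exact apply_eq_sum_comp α _

lemma pull_pull {k : ℕ} (E F : Matrix (Fin 8) (Fin 8) ℝ) (t : Tensor k) :
    pull E (pull F t) = pull (F * E) t := by
  ext I
  simp only [pull, Finset.mul_sum]
  rw [Finset.sum_comm]
  refine Finset.sum_congr rfl fun J _ => ?_
  simp only [Matrix.mul_apply, Finset.prod_univ_sum, Finset.sum_mul, Fintype.piFinset_univ]
  refine Finset.sum_congr rfl fun K _ => ?_
  rw [Finset.prod_mul_distrib]
  ring

lemma pull_one {k : ℕ} (t : Tensor k) : pull 1 t = t := by
  ext I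
  rw [pull, Finset.sum_eq_single I]
  · simp
  · intro J _ h
    obtain ⟨j, hj⟩ := Function.ne_iff.1 h
    rw [Finset.prod_eq_zero (Finset.mem_univ j) (by simp [hj]), zero_mul]
  · simp

lemma IsAlt.pull {k : ℕ} {t : Tensor k} (h : IsAlt t) (E : Matrix (Fin 8) (Fin 8) ℝ) :
    IsAlt (pull E t) := by
  intro σ I
  simp only [Spin7.pull, Finset.mul_sum]
  refine Fintype.sum_bijective (fun J : Fin k → Fin 8 => fun j => J (σ.symm j))
    (Equiv.arrowCongr σ (Equiv.refl (Fin 8))).bijective _ _ fun J => ?_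
  have h1 : t (fun j => J (σ.symm j)) = ((Equiv.Perm.sign σ : ℤ) : ℝ) * t J := by
    rw [h σ.symm J, Equiv.Perm.sign_symm]
  rw [h1, ← Equiv.prod_comp σ (fun j => E (J (σ.symm j)) (I j))]
  simp only [Equiv.symm_apply_apply]
  linear_combination (-(∏ j, E (J j) (I (σ j))) * t J) * sign_mul_self σ


/-! ### The model Cayley form -/

/-- The `2 × 2` minors of the identity matrix. -/
def minorTwo (k l c d : Fin 8) : ℤ :=
  (if k = c then if l = d then 1 else 0 else 0) - (if k = d then if l = c then 1 else 0 else 0)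

/-- The `3 × 3` minors of the identity matrix. -/
def minorThree (j k l b c d : Fin 8) : ℤ :=
  (if j = b then minorTwo k l c d else 0) - (if j = c then minorTwo k l b d else 0)
    + (if j = d then minorTwo k l b c else 0)

/-- The components of `dx^i ∧ dx^j ∧ dx^k ∧ dx^l` as integers. -/
def dxZ (i j k l a b c d : Fin 8) : ℤ :=
  (if i = a then minorThree j k l b c d else 0) - (if i = b then minorThree j k l a c d else 0)
    + (if i = c then minorThree j k l a b d else 0) - (if i = d then minorThree j k l a b c else 0)

/-- The components of the model Cayley form as integers. -/
def modelZ (a b c d : Fin 8) : ℤ :=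
  - (dxZ 0 1 2 3 a b c d + dxZ 0 1 4 5 a b c d + dxZ 0 1 6 7 a b c d + dxZ 0 2 4 6 a b c d
    - dxZ 0 2 5 7 a b c d - dxZ 0 3 4 7 a b c d - dxZ 0 3 5 6 a b c d - dxZ 1 2 4 7 a b c d
    - dxZ 1 2 5 6 a b c d - dxZ 1 3 4 6 a b c d + dxZ 1 3 5 7 a b c d + dxZ 2 3 4 5 a b c d
    + dxZ 2 3 6 7 a b c d + dxZ 4 5 6 7 a b c d)

/-- The nested conditionals of `dxZ` are the Laplace expansion of a 4 × 4 determinant of Kronecker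
deltas. Over the integers they can be evaluated by the kernel. -/
lemma comp_dx_eq_dxZ (i j k l a b c d : Fin 8) :
    comp (dx ![i, j, k, l]) ![a, b, c, d] = (dxZ i j k l a b c d : ℝ) := by
  have h : comp (dx ![i, j, k, l]) ![a, b, c, d] =
      altSum 4 (fun J => if ![i, j, k, l] = J then 1 else 0) ![a, b, c, d] := comp_dx _ _
  have h2 : ∀ a b c d : Fin 8, (if ![i, j, k, l] = ![a, b, c, d] then (1 : ℝ) else 0) =
      (if i = a then 1 else 0) * (if j = b then 1 else 0) * (if k = c then 1 else 0) *
        (if l = d then 1 else 0) := by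
    intro a b c d
    have : ![i, j, k, l] = ![a, b, c, d] ↔ i = a ∧ j = b ∧ k = c ∧ l = d := by
      simp
    rw [if_congr this rfl rfl]
    split_ifs <;> simp_all
  have h3 : ∀ (p : Prop) [Decidable p] (x : ℝ), (if p then x else 0) =
      (if p then 1 else 0) * x := fun p _ x => by split_ifs <;> simp
  rw [h, altSum_four]
  simp only [h2, dxZ, minorThree, minorTwo]
  push_cast
  simp only [h3 _ (_ - _), h3 _ (_ + _), h3 _ (ite _ _ _)]
  ring

/-- The components of the model Cayley form. -/
def mc (a b c d : Fin 8) : ℝ := comp modelCayley ![a, b, c, d]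

lemma mc_eq_modelZ (a b c d : Fin 8) : mc a b c d = (modelZ a b c d : ℝ) := by
  have h : ∀ α β : Form 4, ∀ I, comp (α - β) I = comp α I - comp β I := fun _ _ _ => rfl
  have h' : ∀ α β : Form 4, ∀ I, comp (α + β) I = comp α I + comp β I := fun _ _ _ => rfl
  have h'' : ∀ α : Form 4, ∀ I, comp (-α) I = - comp α I := fun _ _ => rfl
  simp only [mc, modelCayley, h, h', h'', comp_dx_eq_dxZ, modelZ]
  push_cast
  ring

/-- The parity of the number of inversions of `(a, b, c, d)`. -/
def inversionParity (a b c d : ℕ) : Bool :=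
  (Nat.blt a b ^^ Nat.blt a c) ^^ (Nat.blt a d ^^ Nat.blt b c) ^^ (Nat.blt b d ^^ Nat.blt c d)

/-- The components of the model Cayley form, read off from the set of indices and the parity of
the permutation that sorts them. The sets `S` of indices with components `-1` and `1` are listed
in binary by the numbers `∑_S 2 ^ ∑_{i ∈ S} 2 ^ i`. -/
def tableZ (a b c d : Fin 8) : ℤ :=
  let m := 2 ^ a.val + 2 ^ b.val + 2 ^ c.val + 2 ^ d.val
  bif Nat.testBit 1766847064804145555106821016274327440208568733154690126060655711868715008 m then (bif inversionParity a b c d then 1 else -1)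
  else bif Nat.testBit 46780897623823247067084098768901645919373500612608 m then (bif inversionParity a b c d then -1 else 1)
  else 0

set_option maxRecDepth 100000 in
-- A repeated index makes the sum of powers of two have fewer than four binary digits, so the table
-- returns 0. For distinct indices there are six pairs, an even number, so ascents and inversions
-- have the same parity. The case a < b is all that the contraction check needs.
lemma modelZ_eq_tableZ : ∀ a b c d : Fin 8, a < b →
    modelZ a b c d = tableZ a b c d := by
  decide +kernel

/-- Multiplication that evaluates the second factor only if the first one is not zero. -/
def mulLazy (x y : ℤ) : ℤ := if x = 0 then 0 else x * y

lemma mulLazy_eq (x y : ℤ) : mulLazy x y = x * y := by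
  unfold mulLazy; split_ifs with h <;> simp [h]

set_option maxRecDepth 100000 in
-- This is the only fact about the model, besides self-duality, that is verified by enumeration.
-- Ordered triples suffice because both sides are antisymmetric in i, j, k and in a, b, c.
lemma tableZ_contract : ∀ i j k : Fin 8, i < j → j < k → ∀ a b c : Fin 8, a < b → b < c →
    mulLazy (tableZ i j k 0) (tableZ a b c 0) + mulLazy (tableZ i j k 1) (tableZ a b c 1)
    + mulLazy (tableZ i j k 2) (tableZ a b c 2) + mulLazy (tableZ i j k 3) (tableZ a b c 3)
    + mulLazy (tableZ i j k 4) (tableZ a b c 4) + mulLazy (tableZ i j k 5) (tableZ a b c 5)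
    + mulLazy (tableZ i j k 6) (tableZ a b c 6) + mulLazy (tableZ i j k 7) (tableZ a b c 7) =
    minorThree i j k a b c
    - (if i = a then tableZ j k b c else 0) - (if i = b then tableZ j k c a else 0) - (if i = c then tableZ j k a b else 0)
    + (if j = a then tableZ i k b c else 0) + (if j = b then tableZ i k c a else 0)
    + (if j = c then tableZ i k a b else 0)
    - (if k = a then tableZ i j b c else 0) - (if k = b then tableZ i j c a else 0) - (if k = c then tableZ i j a b else 0) := by
  decide +kernel


lemma mc_swap01 (a b c d : Fin 8) : mc b a c d = - mc a b c d := (isAlt_comp _).swap01 a b c d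

lemma mc_swap12 (a b c d : Fin 8) : mc a c b d = - mc a b c d := (isAlt_comp _).swap12 a b c d

lemma mc_swap23 (a b c d : Fin 8) : mc a b d c = - mc a b c d := (isAlt_comp _).swap23 a b c d

lemma eq_zero_of_antisymm {f : Fin 8 → Fin 8 → Fin 8 → ℝ} (h01 : ∀ i j k, f j i k = - f i j k)
    (h12 : ∀ i j k, f i k j = - f i j k) (h : ∀ i j k, i < j → j < k → f i j k = 0) :
    ∀ i j k, f i j k = 0 := by
  have e01 : ∀ i k, f i i k = 0 := fun i k => by linarith [h01 i i k]
  have e12 : ∀ i j, f i j j = 0 := fun i j => by linarith [h12 i j j]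
  have key : ∀ i j k, j < k → f i j k = 0 := by
    intro i j k hjk
    rcases lt_trichotomy i j with hij | rfl | hij
    · exact h _ _ _ hij hjk
    · exact e01 _ _
    · rw [h01 j i k, neg_eq_zero]
      rcases lt_trichotomy i k with hik | rfl | hik
      · exact h _ _ _ hij hik
      · exact e12 _ _
      · rw [h12 j k i, h _ _ _ hjk hik, neg_zero]
  intro i j k
  rcases lt_trichotomy j k with hjk | rfl | hjk
  · exact key _ _ _ hjk
  · exact e12 _ _
  · rw [h12 i k j, key _ _ _ hjk, neg_zero]

/-- The Kronecker delta. -/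
def delta (i j : Fin 8) : ℝ := if i = j then 1 else 0

/-- The right-hand side of the contraction identity for the model Cayley form. -/
def contractRhs (i j k a b c : Fin 8) : ℝ :=
    delta i a * (delta j b * delta k c - delta j c * delta k b)
    - delta i b * (delta j a * delta k c - delta j c * delta k a)
    + delta i c * (delta j a * delta k b - delta j b * delta k a)
    - delta i a * mc j k b c - delta i b * mc j k c a - delta i c * mc j k a b
    - delta j a * mc k i b c - delta j b * mc k i c a - delta j c * mc k i a b
    - delta k a * mc i j b c - delta k b * mc i j c a - delta k c * mc i j a b

lemma contractRhs_swap (i j k a b c : Fin 8) :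
    contractRhs j i k a b c = - contractRhs i j k a b c ∧
    contractRhs i k j a b c = - contractRhs i j k a b c ∧
    contractRhs i j k b a c = - contractRhs i j k a b c ∧
    contractRhs i j k a c b = - contractRhs i j k a b c := by
  have S1 := mc_swap01
  have S3 := mc_swap23
  simp only [contractRhs]
  refine ⟨?_, ?_, ?_, ?_⟩
  · rw [S1 k i b c, S1 k i c a, S1 k i a b, S1 j k b c, S1 j k c a, S1 j k a b,
      S1 i j b c, S1 i j c a, S1 i j a b]
    ring
  · rw [S1 k i b c, S1 k i c a, S1 k i a b, S1 j k b c, S1 j k c a, S1 j k a b,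
      S1 i j b c, S1 i j c a, S1 i j a b]
    ring
  · rw [S3 j k c a, S3 j k b c, S3 j k a b, S3 k i c a, S3 k i b c, S3 k i a b,
      S3 i j c a, S3 i j b c, S3 i j a b]
    ring
  · rw [S3 j k c a, S3 j k b c, S3 j k a b, S3 k i c a, S3 k i b c, S3 k i a b,
      S3 i j c a, S3 i j b c, S3 i j a b]
    ring

lemma mc_contract_of_lt {i j k a b c : Fin 8} (hij : i < j) (hjk : j < k) (hab : a < b)
    (hbc : b < c) : ∑ p, mc i j k p * mc a b c p = contractRhs i j k a b c := by
  have D : ∀ (i a : Fin 8) (x : ℤ), ((if i = a then x else 0 : ℤ) : ℝ) = delta i a * (x : ℝ) := by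
    intro i a x; simp only [delta]; split_ifs <;> simp
  have h := congrArg (Int.cast : ℤ → ℝ) (tableZ_contract i j k hij hjk a b c hab hbc)
  simp only [mulLazy_eq, minorThree, minorTwo, Int.cast_add, Int.cast_sub, Int.cast_mul, D,
    Int.cast_one, ← modelZ_eq_tableZ _ _ _ _ hij, ← modelZ_eq_tableZ _ _ _ _ hjk,
    ← modelZ_eq_tableZ _ _ _ _ (hij.trans hjk), ← modelZ_eq_tableZ _ _ _ _ hab,
    ← mc_eq_modelZ] at h
  -- The identity is written cyclically in i, j, k, whereas the table was only evaluated on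
  -- increasing first indices; hence the exchange of k and i.
  rw [Fin.sum_univ_eight, h, contractRhs, mc_swap01 i k b c, mc_swap01 i k c a,
    mc_swap01 i k a b]
  ring

/-- The single contraction of the model Cayley form with itself. -/
lemma mc_contract (i j k a b c : Fin 8) :
    ∑ p, mc i j k p * mc a b c p = contractRhs i j k a b c := by
  rw [← sub_eq_zero]
  refine eq_zero_of_antisymm
    (f := fun i j k => ∑ p, mc i j k p * mc a b c p - contractRhs i j k a b c) ?_ ?_ ?_ i j k
  · intro i j k
    simp only [fun p => mc_swap01 i j k p, Finset.sum_neg_distrib, neg_mul,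
      (contractRhs_swap i j k a b c).1]
    ring
  · intro i j k
    simp only [fun p => mc_swap12 i j k p, Finset.sum_neg_distrib, neg_mul,
      (contractRhs_swap i j k a b c).2.1]
    ring
  · intro i j k hij hjk
    refine eq_zero_of_antisymm
      (f := fun a b c => ∑ p, mc i j k p * mc a b c p - contractRhs i j k a b c) ?_ ?_ ?_ a b c
    · intro a b c
      simp only [fun p => mc_swap01 a b c p, Finset.sum_neg_distrib, mul_neg,
        (contractRhs_swap i j k a b c).2.2.1]
      ring
    · intro a b c
      simp only [fun p => mc_swap12 a b c p, Finset.sum_neg_distrib, mul_neg,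
        (contractRhs_swap i j k a b c).2.2.2]
      ring
    · intro a b c hab hbc
      rw [mc_contract_of_lt hij hjk hab hbc, sub_self]

/-! ### The model Cayley form on vectors -/

/-- The value of the model Cayley form on four vectors. -/
def m4 (u v w z : Space) : ℝ := modelCayley ![u, v, w, z]

lemma m4_basisVec (a b c d : Fin 8) :
    m4 (basisVec a) (basisVec b) (basisVec c) (basisVec d) = mc a b c d := by
  exact congrArg modelCayley (funext fun j => by fin_cases j <;> rfl)

lemma m4_swap01 (u v w z : Space) : m4 v u w z = - m4 u v w z := by
  have := modelCayley.toAlternatingMap.map_swap ![u, v, w, z] (i := 0) (j := 1) (by decide)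
  refine Eq.trans ?_ this
  exact congrArg modelCayley (funext fun j => by fin_cases j <;> rfl)

lemma m4_swap12 (u v w z : Space) : m4 u w v z = - m4 u v w z := by
  have := modelCayley.toAlternatingMap.map_swap ![u, v, w, z] (i := 1) (j := 2) (by decide)
  refine Eq.trans ?_ this
  exact congrArg modelCayley (funext fun j => by fin_cases j <;> rfl)

lemma m4_swap23 (u v w z : Space) : m4 u v z w = - m4 u v w z := by
  have := modelCayley.toAlternatingMap.map_swap ![u, v, w, z] (i := 2) (j := 3) (by decide)
  refine Eq.trans ?_ this
  exact congrArg modelCayley (funext fun j => by fin_cases j <;> rfl)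

lemma m4_pair_swap (u v w z : Space) : m4 w z u v = m4 u v w z := by
  rw [m4_swap12 w u z v, m4_swap01 u w z v, m4_swap23 u w v z, m4_swap12 u v w z]
  ring

lemma m4_lin0 (v w z : Space) : IsLinearMap ℝ (fun u => m4 u v w z) where
  map_add x y := modelCayley.toMultilinearMap.cons_add ![v, w, z] x y
  map_smul c x := modelCayley.toMultilinearMap.cons_smul ![v, w, z] c x

lemma m4_lin1 (u w z : Space) : IsLinearMap ℝ (fun v => m4 u v w z) where
  map_add x y := by
    simp only [fun v => m4_swap01 v u w z, (m4_lin0 u w z).map_add]; ring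
  map_smul c x := by
    simp only [fun v => m4_swap01 v u w z, (m4_lin0 u w z).map_smul]; simp

lemma m4_lin2 (u v z : Space) : IsLinearMap ℝ (fun w => m4 u v w z) where
  map_add x y := by
    simp only [fun w => m4_swap12 u w v z, (m4_lin1 u v z).map_add]; ring
  map_smul c x := by
    simp only [fun w => m4_swap12 u w v z, (m4_lin1 u v z).map_smul]; simp

lemma m4_lin3 (u v w : Space) : IsLinearMap ℝ (fun z => m4 u v w z) where
  map_add x y := by
    simp only [fun z => m4_swap23 u v z w, (m4_lin2 u v w).map_add]; ring
  map_smul c x := by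
    simp only [fun z => m4_swap23 u v z w, (m4_lin2 u v w).map_smul]; simp

lemma IsLinearMap.map_sum_smul {f : Space → ℝ} (hf : IsLinearMap ℝ f) {ι : Type*} [Fintype ι]
    (c : ι → ℝ) (x : ι → Space) : f (∑ i, c i • x i) = ∑ i, c i * f (x i) := by
  refine (map_sum (hf.mk' f) (fun i => c i • x i) Finset.univ).trans ?_
  exact Finset.sum_congr rfl fun i _ => hf.map_smul (c i) (x i)

lemma eq_sum_basisVec (u : Space) : u = ∑ i, u i • basisVec i := by
  ext j; simp [basisVec, Pi.single_apply]

lemma IsLinearMap.ext_basisVec {f g : Space → ℝ} (hf : IsLinearMap ℝ f) (hg : IsLinearMap ℝ g)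
    (h : ∀ i, f (basisVec i) = g (basisVec i)) (u : Space) : f u = g u := by
  rw [eq_sum_basisVec u, IsLinearMap.map_sum_smul hf, IsLinearMap.map_sum_smul hg]
  simp only [h]

/-- The resolution of the identity by a pair of dual bases, for bilinear functions. -/
lemma sum_dual_bilin {F : Space → Space → ℝ} (hf : ∀ v, IsLinearMap ℝ (fun u => F u v))
    (hg : ∀ u, IsLinearMap ℝ (F u)) {A B : Matrix (Fin 8) (Fin 8) ℝ} (hAB : A * B = 1) :
    ∑ b, F (B b) (A.transpose b) = ∑ d, F (basisVec d) (basisVec d) := by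
  have h : ∀ b, F (B b) (A.transpose b) =
      ∑ d, ∑ e, (A e b * B b d) * F (basisVec d) (basisVec e) := by
    intro b
    conv_lhs => rw [eq_sum_basisVec (B b), IsLinearMap.map_sum_smul (hf _)]
    refine Finset.sum_congr rfl fun d _ => ?_
    conv_lhs => rw [eq_sum_basisVec (A.transpose b), IsLinearMap.map_sum_smul (hg _),
      Finset.mul_sum]
    refine Finset.sum_congr rfl fun e _ => ?_
    simp only [Matrix.transpose_apply]; ring
  simp only [h]
  rw [Finset.sum_comm]
  refine Finset.sum_congr rfl fun d _ => ?_
  rw [Finset.sum_comm]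
  simp only [← Finset.sum_mul, ← Matrix.mul_apply, hAB, Matrix.one_apply]
  simp

/-- The resolution of the identity by a pair of dual bases. -/
lemma sum_dual {f g : Space → ℝ} (hf : IsLinearMap ℝ f) (hg : IsLinearMap ℝ g)
    {A B : Matrix (Fin 8) (Fin 8) ℝ} (hAB : A * B = 1) :
    ∑ b, f (B b) * g (A.transpose b) = ∑ d, f (basisVec d) * g (basisVec d) := by
  refine sum_dual_bilin (F := fun u v => f u * g v) (fun v => ⟨fun x y => ?_, fun c x => ?_⟩)
    (fun u => ⟨fun x y => ?_, fun c x => ?_⟩) hAB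
  · simp only [hf.map_add, add_mul]
  · simp only [hf.map_smul, smul_eq_mul, mul_assoc]
  · simp only [hg.map_add, mul_add]
  · simp only [hg.map_smul, smul_eq_mul, mul_left_comm]

/-- The right-hand side of the contraction identity on vectors. -/
def contractVec (u v w x y z : Space) : ℝ :=
    (u ⬝ᵥ x) * ((v ⬝ᵥ y) * (w ⬝ᵥ z) - (v ⬝ᵥ z) * (w ⬝ᵥ y))
    - (u ⬝ᵥ y) * ((v ⬝ᵥ x) * (w ⬝ᵥ z) - (v ⬝ᵥ z) * (w ⬝ᵥ x))
    + (u ⬝ᵥ z) * ((v ⬝ᵥ x) * (w ⬝ᵥ y) - (v ⬝ᵥ y) * (w ⬝ᵥ x))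
    - (u ⬝ᵥ x) * m4 v w y z - (u ⬝ᵥ y) * m4 v w z x - (u ⬝ᵥ z) * m4 v w x y
    - (v ⬝ᵥ x) * m4 w u y z - (v ⬝ᵥ y) * m4 w u z x - (v ⬝ᵥ z) * m4 w u x y
    - (w ⬝ᵥ x) * m4 u v y z - (w ⬝ᵥ y) * m4 u v z x - (w ⬝ᵥ z) * m4 u v x y

lemma basisVec_dotProduct (i j : Fin 8) : basisVec i ⬝ᵥ basisVec j = delta i j := by
  simp [basisVec, delta, Pi.single_apply, eq_comm]

/-- The single contraction of the model Cayley form with itself, on vectors. -/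
lemma m4_contract (u v w x y z : Space) :
    ∑ d, m4 u v w (basisVec d) * m4 x y z (basisVec d) = contractVec u v w x y z := by
  have A0 : ∀ p q v w z, m4 (p + q) v w z = m4 p v w z + m4 q v w z :=
    fun p q v w z => (m4_lin0 v w z).map_add p q
  have A1 : ∀ p q u w z, m4 u (p + q) w z = m4 u p w z + m4 u q w z :=
    fun p q u w z => (m4_lin1 u w z).map_add p q
  have A2 : ∀ p q u v z, m4 u v (p + q) z = m4 u v p z + m4 u v q z :=
    fun p q u v z => (m4_lin2 u v z).map_add p q
  have A3 : ∀ p q u v w, m4 u v w (p + q) = m4 u v w p + m4 u v w q :=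
    fun p q u v w => (m4_lin3 u v w).map_add p q
  have B0 : ∀ (c : ℝ) p v w z, m4 (c • p) v w z = c * m4 p v w z :=
    fun c p v w z => (m4_lin0 v w z).map_smul c p
  have B1 : ∀ (c : ℝ) p u w z, m4 u (c • p) w z = c * m4 u p w z :=
    fun c p u w z => (m4_lin1 u w z).map_smul c p
  have B2 : ∀ (c : ℝ) p u v z, m4 u v (c • p) z = c * m4 u v p z :=
    fun c p u v z => (m4_lin2 u v z).map_smul c p
  have B3 : ∀ (c : ℝ) p u v w, m4 u v w (c • p) = c * m4 u v w p :=
    fun c p u v w => (m4_lin3 u v w).map_smul c p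
  revert u v w x y z
  have L : ∀ f : Space → ℝ, (∀ p q, f (p + q) = f p + f q) → (∀ (c : ℝ) p, f (c • p) = c * f p) →
      IsLinearMap ℝ f := fun f h1 h2 => ⟨h1, h2⟩
  suffices h : ∀ i j k a b c, ∑ d, m4 (basisVec i) (basisVec j) (basisVec k) (basisVec d) *
      m4 (basisVec a) (basisVec b) (basisVec c) (basisVec d) = contractVec (basisVec i)
        (basisVec j) (basisVec k) (basisVec a) (basisVec b) (basisVec c) by
    intro u v w x y z
    -- The six arguments are replaced by basis vectors one at a time. Each replacement leaves four
    -- linearity goals and, fifth, the goal for basis vectors, which is treated next.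
    refine IsLinearMap.ext_basisVec (f := fun u => ∑ d, m4 u v w (basisVec d) *
      m4 x y z (basisVec d))
      (g := fun u => contractVec u v w x y z)
      (L _ ?_ ?_) (L _ ?_ ?_) (fun i => ?_) u
    pick_goal 5
    refine IsLinearMap.ext_basisVec (f := fun v => ∑ d, m4 (basisVec i) v w (basisVec d) *
      m4 x y z (basisVec d))
      (g := fun v => contractVec (basisVec i) v w x y z)
      (L _ ?_ ?_) (L _ ?_ ?_) (fun j => ?_) v
    pick_goal 5
    refine IsLinearMap.ext_basisVec (f := fun w => ∑ d, m4 (basisVec i) (basisVec j) w (basisVec d) *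
      m4 x y z (basisVec d))
      (g := fun w => contractVec (basisVec i) (basisVec j) w x y z)
      (L _ ?_ ?_) (L _ ?_ ?_) (fun k => ?_) w
    pick_goal 5
    refine IsLinearMap.ext_basisVec (f := fun x => ∑ d, m4 (basisVec i) (basisVec j) (basisVec k) (basisVec d) *
      m4 x y z (basisVec d))
      (g := fun x => contractVec (basisVec i) (basisVec j) (basisVec k) x y z)
      (L _ ?_ ?_) (L _ ?_ ?_) (fun a => ?_) x
    pick_goal 5
    refine IsLinearMap.ext_basisVec (f := fun y => ∑ d, m4 (basisVec i) (basisVec j) (basisVec k) (basisVec d) *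
      m4 (basisVec a) y z (basisVec d))
      (g := fun y => contractVec (basisVec i) (basisVec j) (basisVec k) (basisVec a) y z)
      (L _ ?_ ?_) (L _ ?_ ?_) (fun b => ?_) y
    pick_goal 5
    refine IsLinearMap.ext_basisVec (f := fun z => ∑ d, m4 (basisVec i) (basisVec j) (basisVec k) (basisVec d) *
      m4 (basisVec a) (basisVec b) z (basisVec d))
      (g := fun z => contractVec (basisVec i) (basisVec j) (basisVec k) (basisVec a) (basisVec b) z)
      (L _ ?_ ?_) (L _ ?_ ?_) (fun c => h i j k a b c) z
    all_goals
      intros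
      simp only [contractVec, A0, A1, A2, A3, B0, B1, B2, B3, add_dotProduct, dotProduct_add,
        smul_dotProduct, dotProduct_smul, smul_eq_mul, add_mul, mul_add, mul_assoc, mul_left_comm,
        Finset.sum_add_distrib, Finset.mul_sum]
      try ring
  intro i j k a b c
  simp only [contractVec, basisVec_dotProduct, m4_basisVec]
  exact mc_contract i j k a b c

lemma m4_self02 (u v w : Space) : m4 u v u w = 0 := by
  have h1 := m4_swap01 u v u w
  have h2 := m4_swap12 v u u w
  linarith

lemma m4_self03 (u v w : Space) : m4 u v w u = 0 := by
  rw [m4_swap23 u v u w, m4_self02, neg_zero]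

lemma m4_self12 (u v w : Space) : m4 u v v w = 0 := by
  have h2 := m4_swap12 u v v w
  linarith

lemma m4_self13 (u v w : Space) : m4 u v w v = 0 := by
  rw [m4_swap23 u v v w, m4_self12, neg_zero]

lemma sum_dotProduct_basisVec {f : Space → ℝ} (hf : IsLinearMap ℝ f) (u : Space) :
    ∑ c, (u ⬝ᵥ basisVec c) * f (basisVec c) = f u := by
  conv_rhs => rw [eq_sum_basisVec u, IsLinearMap.map_sum_smul hf]
  simp [basisVec]

lemma isLinearMap_dotProduct (y : Space) : IsLinearMap ℝ (fun u => u ⬝ᵥ y) :=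
  ⟨fun a b => add_dotProduct a b y, fun c a => smul_dotProduct c a y⟩

/-- The double contraction of the model Cayley form with itself, on vectors. -/
lemma m4_contract_two (u v x y : Space) :
    ∑ c, ∑ d, m4 u v (basisVec c) (basisVec d) * m4 x y (basisVec c) (basisVec d) =
      6 * ((u ⬝ᵥ x) * (v ⬝ᵥ y) - (u ⬝ᵥ y) * (v ⬝ᵥ x)) - 4 * m4 u v x y := by
  simp only [m4_contract, contractVec, m4_self02, m4_self03, m4_self12, m4_self13,
    fun c => dotProduct_comm (basisVec c) x, fun c => dotProduct_comm (basisVec c) y]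
  have e1 : ∀ c, basisVec c ⬝ᵥ basisVec c = 1 := fun c => by simp [basisVec_dotProduct, delta]
  have d1 : ∀ u v : Space, ∑ c, (u ⬝ᵥ basisVec c) * (v ⬝ᵥ basisVec c) = u ⬝ᵥ v := fun u v => by
    rw [← sum_dotProduct_basisVec (isLinearMap_dotProduct v) u]
    simp only [dotProduct_comm v]
  have t1 := sum_dotProduct_basisVec (m4_lin1 v x y) u
  have t2 := sum_dotProduct_basisVec (m4_lin0 u x y) v
  have t3 := sum_dotProduct_basisVec (m4_lin3 u v y) x
  have t4 := sum_dotProduct_basisVec (m4_lin2 u v x) y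
  have s1 := m4_swap01 u v x y
  have s2 := m4_swap23 u v x y
  have q1 := d1 v y
  have q2 := d1 u y
  have q3 := d1 v x
  have q4 := d1 u x
  -- Expanding makes each sum over c a trace or a resolution of the identity. The product terms then
  -- count 8 - 1 - 1 = 6 times, and the terms in Φ add up to -8 + 4 = -4.
  have r : ∀ c, (u ⬝ᵥ x) * ((v ⬝ᵥ y) * (basisVec c ⬝ᵥ basisVec c) -
      (v ⬝ᵥ basisVec c) * (y ⬝ᵥ basisVec c)) -
      (u ⬝ᵥ y) * ((v ⬝ᵥ x) * (basisVec c ⬝ᵥ basisVec c) -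
      (v ⬝ᵥ basisVec c) * (x ⬝ᵥ basisVec c)) +
      (u ⬝ᵥ basisVec c) * ((v ⬝ᵥ x) * (y ⬝ᵥ basisVec c) - (v ⬝ᵥ y) * (x ⬝ᵥ basisVec c)) -
      (u ⬝ᵥ x) * 0 - (u ⬝ᵥ y) * 0 - (u ⬝ᵥ basisVec c) * m4 v (basisVec c) x y -
      (v ⬝ᵥ x) * 0 - (v ⬝ᵥ y) * 0 - (v ⬝ᵥ basisVec c) * m4 (basisVec c) u x y -
      (x ⬝ᵥ basisVec c) * m4 u v y (basisVec c) - (y ⬝ᵥ basisVec c) * m4 u v (basisVec c) x -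
      (basisVec c ⬝ᵥ basisVec c) * m4 u v x y =
      (u ⬝ᵥ x) * (v ⬝ᵥ y) - (u ⬝ᵥ y) * (v ⬝ᵥ x) - m4 u v x y
      - (u ⬝ᵥ x) * ((v ⬝ᵥ basisVec c) * (y ⬝ᵥ basisVec c))
      + (u ⬝ᵥ y) * ((v ⬝ᵥ basisVec c) * (x ⬝ᵥ basisVec c))
      + (v ⬝ᵥ x) * ((u ⬝ᵥ basisVec c) * (y ⬝ᵥ basisVec c))
      - (v ⬝ᵥ y) * ((u ⬝ᵥ basisVec c) * (x ⬝ᵥ basisVec c))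
      - (u ⬝ᵥ basisVec c) * m4 v (basisVec c) x y - (v ⬝ᵥ basisVec c) * m4 (basisVec c) u x y
      - (x ⬝ᵥ basisVec c) * m4 u v y (basisVec c)
      - (y ⬝ᵥ basisVec c) * m4 u v (basisVec c) x := by
    intro c; rw [e1]; ring
  simp only [r]
  simp only [Finset.sum_sub_distrib, Finset.sum_add_distrib, ← Finset.mul_sum, q1, q2, q3, q4,
    t1, t2, t3, t4, s1, s2, Finset.sum_const, Finset.card_univ, Fintype.card_fin]
  simp only [nsmul_eq_mul]
  push_cast
  ring


/-! ### Infinitesimal linear changes of coordinates -/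

/-- The infinitesimal pullback of covariant tensors by `1 + s X`. -/
def act {k : ℕ} (X : Matrix (Fin 8) (Fin 8) ℝ) (t : Tensor k) : Tensor k := fun I =>
  ∑ m, ∑ p, X p (I m) * t (Function.update I m p)

/-- In the product rule all factors but one are entries of E 0 = 1, so only the index arrays J that
differ from I in at most that one slot survive. -/
lemma hasDerivAt_pull {k : ℕ} {E : ℝ → Matrix (Fin 8) (Fin 8) ℝ} {X : Matrix (Fin 8) (Fin 8) ℝ}
    (hE : ∀ i j, HasDerivAt (fun s => E s i j) (X i j) 0) (h0 : E 0 = 1) (t : Tensor k)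
    (I : Fin k → Fin 8) : HasDerivAt (fun s => pull (E s) t I) (act X t I) 0 := by
  have h1 : HasDerivAt (fun s => pull (E s) t I) (∑ J : Fin k → Fin 8,
      (∑ m, (∏ j ∈ Finset.univ.erase m, E 0 (J j) (I j)) • X (J m) (I m)) * t J) 0 :=
    HasDerivAt.fun_sum fun J _ =>
      (HasDerivAt.fun_finsetProd fun m _ => hE (J m) (I m)).mul_const _
  convert h1 using 1
  simp only [Finset.sum_mul, act]
  conv_rhs => rw [Finset.sum_comm]
  refine Finset.sum_congr rfl fun m _ => ?_
  refine Finset.sum_of_injOn (s := Finset.univ) (t := Finset.univ)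
    (fun p => Function.update I m p) (fun p _ q _ h => by simpa using congrFun h m)
    (fun _ _ => by simp) ?_ ?_
  · intro J _ hJ
    have : ∃ j, j ≠ m ∧ J j ≠ I j := by
      by_contra! h
      refine hJ ⟨J m, by simp, ?_⟩
      ext j
      by_cases hj : j = m
      · subst hj; simp
      · simp [hj, h j hj]
    obtain ⟨j, hjm, hj⟩ := this
    rw [Finset.prod_eq_zero (Finset.mem_erase.2 ⟨hjm, Finset.mem_univ j⟩) (by simp [h0, hj])]
    simp
  · intro p _
    rw [Finset.prod_eq_one]
    · simp
    · intro j hj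
      simp [h0, Finset.ne_of_mem_erase hj]

lemma hasDerivAt_one_add_smul (X : Matrix (Fin 8) (Fin 8) ℝ) (i j : Fin 8) :
    HasDerivAt (fun s : ℝ => (1 + s • X) i j) (X i j) 0 := by
  simp only [Matrix.add_apply, Matrix.smul_apply, smul_eq_mul]
  simpa using ((hasDerivAt_id (0 : ℝ)).mul_const (X i j)).const_add ((1 : Matrix _ _ ℝ) i j)

/-- Pullback by 1 + sX preserves antisymmetry for every s; differentiate at s = 0. -/
lemma IsAlt.act {k : ℕ} {t : Tensor k} (h : IsAlt t) (X : Matrix (Fin 8) (Fin 8) ℝ) :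
    IsAlt (act X t) := by
  intro σ I
  have h1 := hasDerivAt_pull (hasDerivAt_one_add_smul X) (by simp) t (fun j => I (σ j))
  simp only [h.pull _ σ I] at h1
  exact h1.unique ((hasDerivAt_pull (hasDerivAt_one_add_smul X) (by simp) t I).const_mul _)

lemma act_four (X : Matrix (Fin 8) (Fin 8) ℝ) (t : Tensor 4) (a b c d : Fin 8) :
    act X t ![a, b, c, d] = ∑ p, X p a * t ![p, b, c, d] + ∑ p, X p b * t ![a, p, c, d]
      + ∑ p, X p c * t ![a, b, p, d] + ∑ p, X p d * t ![a, b, c, p] := by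
  have h0 : ∀ p, Function.update ![a, b, c, d] 0 p = ![p, b, c, d] := fun p => by
    ext j; fin_cases j <;> rfl
  have h1 : ∀ p, Function.update ![a, b, c, d] 1 p = ![a, p, c, d] := fun p => by
    ext j; fin_cases j <;> rfl
  have h2 : ∀ p, Function.update ![a, b, c, d] 2 p = ![a, b, p, d] := fun p => by
    ext j; fin_cases j <;> rfl
  have h3 : ∀ p, Function.update ![a, b, c, d] 3 p = ![a, b, c, p] := fun p => by
    ext j; fin_cases j <;> rfl
  simp only [act, Fin.sum_univ_four, h0, h1, h2, h3]
  rfl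

/-! ### The wedge product of two 4-forms -/

lemma topWedge_add_left (α α' β : Tensor 4) :
    topWedge (α + α') β = topWedge α β + topWedge α' β := by
  simp only [topWedge, Pi.add_apply, mul_add, add_mul, Finset.sum_add_distrib]

lemma topWedge_smul_left (c : ℝ) (α β : Tensor 4) : topWedge (c • α) β = c * topWedge α β := by
  simp only [topWedge, Pi.smul_apply, smul_eq_mul, Finset.mul_sum]
  exact Finset.sum_congr rfl fun σ _ => by ring

lemma topWedge_smul_right (c : ℝ) (α β : Tensor 4) : topWedge α (c • β) = c * topWedge α β := by
  simp only [topWedge, Pi.smul_apply, smul_eq_mul, Finset.mul_sum]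
  exact Finset.sum_congr rfl fun σ _ => by ring

/-- A repeated row kills the determinant, so only permutations contribute, each with its sign. -/
lemma sum_det_submatrix (E : Matrix (Fin 8) (Fin 8) ℝ) (F : (Fin 8 → Fin 8) → ℝ) :
    ∑ L : Fin 8 → Fin 8, (E.submatrix L id).det * F L =
      E.det * ∑ σ : Equiv.Perm (Fin 8), ((Equiv.Perm.sign σ : ℤ) : ℝ) * F σ := by
  rw [Finset.mul_sum]
  symm
  refine Finset.sum_of_injOn (fun σ : Equiv.Perm (Fin 8) => (σ : Fin 8 → Fin 8))
    (fun σ _ τ _ h => Equiv.coe_fn_injective h) (fun _ _ => by simp) ?_ ?_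
  · intro L _ hL
    have hinj : ¬ Function.Injective L := fun h =>
      hL ⟨Equiv.ofBijective L (Finite.injective_iff_bijective.1 h), by simp, rfl⟩
    rw [Function.not_injective_iff] at hinj
    obtain ⟨i, j, hij, hne⟩ := hinj
    rw [Matrix.det_zero_of_row_eq hne (by ext m; simp [hij]), zero_mul]
  · intro σ _
    rw [Matrix.det_permute]
    ring

/-- This is the determinant law for top forms. After expanding both pullbacks and joining their
summation indices into one array L, the signed sum over permutations is the determinant of the rows
of E selected by L. -/
lemma topWedge_pull (E : Matrix (Fin 8) (Fin 8) ℝ) (α β : Tensor 4) :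
    topWedge (pull E α) (pull E β) = E.det * topWedge α β := by
  simp only [topWedge]
  rw [mul_left_comm]
  congr 1
  have h := sum_det_submatrix E
    (fun L => α (fun j => L (Fin.castAdd 4 j)) * β (fun j => L (Fin.natAdd 4 j)))
  simp only [← mul_assoc] at h
  rw [← h]
  simp only [← Matrix.det_transpose (E.submatrix _ id), Matrix.det_apply', Finset.sum_mul]
  rw [Finset.sum_comm]
  refine Finset.sum_congr rfl fun σ _ => ?_
  simp only [pull, mul_assoc]
  rw [Finset.sum_mul_sum, ← Fintype.sum_prod_type', Finset.mul_sum]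
  refine Fintype.sum_equiv (Fin.appendEquiv 4 4) _ _ fun P => ?_
  obtain ⟨J, K⟩ := P
  have : ∏ i : Fin 8, (E.submatrix (Fin.append J K) id).transpose (σ i) i =
    (∏ i, E (J i) (σ (Fin.castAdd 4 i))) * ∏ i, E (K i) (σ (Fin.natAdd 4 i)) := by
    rw [Fin.prod_univ_add (a := 4) (b := 4)]
    simp [-Fin.natAdd_eq_addNat]
  have hJ : (fun j => Fin.append J K (Fin.castAdd 4 j)) = J := funext (Fin.append_left J K)
  have hK : (fun j => Fin.append J K (Fin.natAdd 4 j)) = K := funext (Fin.append_right J K)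
  change _ = _ * ((∏ i : Fin 8, (E.submatrix (Fin.append J K) id).transpose (σ i) i) *
    (α (fun j => Fin.append J K (Fin.castAdd 4 j)) *
      β (fun j => Fin.append J K (Fin.natAdd 4 j))))
  rw [this, hJ, hK]
  ring

/-- The infinitesimal form of `topWedge_pull`: differentiate along 1 + sX. It serves as an
integration by parts, moving X from one factor to the other at the cost of a trace. -/
lemma topWedge_act (X : Matrix (Fin 8) (Fin 8) ℝ) (α β : Tensor 4) :
    topWedge (act X α) β + topWedge α (act X β) = X.trace * topWedge α β := by
  have hp : ∀ (t : Tensor 4) I, HasDerivAt (fun s : ℝ => pull (1 + s • X) t I) (act X t I) 0 :=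
    hasDerivAt_pull (hasDerivAt_one_add_smul X) (by simp)
  have h1 : HasDerivAt (fun s : ℝ => topWedge (pull (1 + s • X) α) (pull (1 + s • X) β))
      (topWedge (act X α) β + topWedge α (act X β)) 0 := by
    have := HasDerivAt.const_mul (1 / ((Nat.factorial 4 : ℝ) * (Nat.factorial 4 : ℝ)))
      (HasDerivAt.fun_sum fun (σ : Equiv.Perm (Fin 8)) (_ : σ ∈ Finset.univ) =>
        (((hp α (fun j => σ (Fin.castAdd 4 j))).const_mul ((Equiv.Perm.sign σ : ℤ) : ℝ)).mul
          (hp β (fun j => σ (Fin.natAdd 4 j)))))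
    refine this.congr_deriv ?_
    simp only [zero_smul, add_zero, pull_one, topWedge, ← mul_add, ← Finset.sum_add_distrib]
  have h2 : HasDerivAt (fun s : ℝ => (1 + s • X).det * topWedge α β)
      (X.trace * topWedge α β) 0 := by
    refine HasDerivAt.mul_const ?_ _
    -- det(1 + sX) = 1 + tr(X) s + q(s) s² with q a polynomial.
    have h3 := ((((hasDerivAt_id (0 : ℝ)).const_mul X.trace).const_add 1).add
      ((((1 + (Polynomial.X : Polynomial ℝ) • X.map Polynomial.C).det.divX.divX).hasDerivAt 0).mul
        ((hasDerivAt_id (0 : ℝ)).pow 2)))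
    simp only [id] at h3
    refine (h3.congr_deriv (by simp)).congr_of_eventuallyEq (Filter.Eventually.of_forall fun s => ?_)
    exact Matrix.det_one_add_smul s X
  simp only [topWedge_pull] at h1
  exact h1.unique h2

/-- Permutations of the two blocks of four indices. -/
def blockPerm (P : Equiv.Perm (Fin 4) × Equiv.Perm (Fin 4)) : Equiv.Perm (Fin 8) :=
  (finSumFinEquiv (m := 4) (n := 4)).permCongr (P.1.sumCongr P.2)

lemma blockPerm_castAdd (P : Equiv.Perm (Fin 4) × Equiv.Perm (Fin 4)) (j : Fin 4) :
    blockPerm P (Fin.castAdd 4 j) = Fin.castAdd 4 (P.1 j) := by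
  exact congrArg (fun x => finSumFinEquiv (P.1.sumCongr P.2 x))
    (finSumFinEquiv_symm_apply_castAdd j)

lemma blockPerm_natAdd (P : Equiv.Perm (Fin 4) × Equiv.Perm (Fin 4)) (j : Fin 4) :
    blockPerm P (Fin.natAdd 4 j) = Fin.natAdd 4 (P.2 j) := by
  exact congrArg (fun x => finSumFinEquiv (P.1.sumCongr P.2 x))
    (finSumFinEquiv_symm_apply_natAdd j)

lemma sign_blockPerm (P : Equiv.Perm (Fin 4) × Equiv.Perm (Fin 4)) :
    Equiv.Perm.sign (blockPerm P) = Equiv.Perm.sign P.1 * Equiv.Perm.sign P.2 := by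
  rw [blockPerm, Equiv.Perm.sign_permCongr, Equiv.Perm.sign_sumCongr]

/-- Only ρ followed on the right by permutations within the two blocks contributes. The 4!·4! such
terms are equal, and their number cancels the normalisation of `topWedge`. -/
lemma topWedge_dx (ρ : Equiv.Perm (Fin 8)) {β : Tensor 4} (hβ : IsAlt β) :
    topWedge (comp (dx (fun j => ρ (Fin.castAdd 4 j)))) β =
      ((Equiv.Perm.sign ρ : ℤ) : ℝ) * β (fun j => ρ (Fin.natAdd 4 j)) := by
  have hα := isAlt_comp (dx (fun j => ρ (Fin.castAdd 4 j)))
  have hK : Function.Injective (fun j : Fin 4 => ρ (Fin.castAdd 4 j)) :=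
    ρ.injective.comp (Fin.castAdd_injective 4 4)
  have h1 : comp (dx (fun j => ρ (Fin.castAdd 4 j))) (fun j => ρ (Fin.castAdd 4 j)) = 1 := by
    rw [comp_dx, Finset.sum_eq_single 1]
    · simp
    · intro σ _ hσ
      rw [if_neg, mul_zero]
      intro h
      exact hσ (Equiv.ext fun j => (hK (congrFun h j)).symm)
    · simp
  have h2 : ∑ σ : Equiv.Perm (Fin 8), ((Equiv.Perm.sign σ : ℤ) : ℝ) *
      comp (dx (fun j => ρ (Fin.castAdd 4 j))) (fun j => σ (Fin.castAdd 4 j)) *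
      β (fun j => σ (Fin.natAdd 4 j)) =
      ∑ P : Equiv.Perm (Fin 4) × Equiv.Perm (Fin 4), ((Equiv.Perm.sign ρ : ℤ) : ℝ) *
        β (fun j => ρ (Fin.natAdd 4 j)) := by
    symm
    refine Finset.sum_of_injOn (s := Finset.univ) (t := Finset.univ) (fun P => ρ * blockPerm P)
      ?_ (fun _ _ => by simp) ?_ ?_
    · intro P _ Q _ h
      have h' := (finSumFinEquiv (m := 4) (n := 4)).permCongr.injective (mul_left_cancel h)
      exact Equiv.Perm.sumCongrHom_injective h'
    · intro σ _ hσ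
      rw [comp_dx, Finset.sum_eq_zero, mul_zero, zero_mul]
      intro τ _
      rw [if_neg, mul_zero]
      intro h
      apply hσ
      -- A nonzero component forces σ to send the first block to the image of that block under ρ, so
      -- ρ⁻¹σ preserves the blocks.
      have hm : Set.MapsTo ((finSumFinEquiv (m := 4) (n := 4)).symm.permCongr (ρ⁻¹ * σ))
          (Set.range Sum.inl) (Set.range Sum.inl) := by
        rintro _ ⟨j, rfl⟩
        refine ⟨τ.symm j, ?_⟩
        have := congrFun h (τ.symm j)
        simp only [Equiv.apply_symm_apply] at this
        change _ = (finSumFinEquiv (m := 4) (n := 4)).symm (ρ.symm (σ (Fin.castAdd 4 j)))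
        rw [← this, Equiv.symm_apply_apply]
        exact (finSumFinEquiv_symm_apply_castAdd _).symm
      obtain ⟨P, hP⟩ := Equiv.Perm.mem_sumCongrHom_range_of_perm_mapsTo_inl hm
      refine ⟨P, by simp, ?_⟩
      have : blockPerm P = ρ⁻¹ * σ := by
        change (finSumFinEquiv (m := 4) (n := 4)).permCongr (Equiv.Perm.sumCongrHom _ _ P) = _
        rw [hP]
        ext j
        simp [Equiv.permCongr_apply]
      simp only [this, mul_inv_cancel_left]
    · intro P _
      have e1 := hα P.1 (fun j => ρ (Fin.castAdd 4 j))
      have e2 := hβ P.2 (fun j => ρ (Fin.natAdd 4 j))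
      simp only [Equiv.Perm.mul_apply, blockPerm_castAdd, blockPerm_natAdd, e1, e2, h1,
        Equiv.Perm.sign_mul, sign_blockPerm, Units.val_mul, Int.cast_mul]
      linear_combination (-((Equiv.Perm.sign ρ : ℤ) : ℝ) * β (fun j => ρ (Fin.natAdd 4 j)) *
        (((Equiv.Perm.sign P.2 : ℤ) : ℝ) * ((Equiv.Perm.sign P.2 : ℤ) : ℝ))) * sign_mul_self P.1
        - (((Equiv.Perm.sign ρ : ℤ) : ℝ) * β (fun j => ρ (Fin.natAdd 4 j))) * sign_mul_self P.2
  rw [topWedge, h2, Finset.sum_const, Finset.card_univ, Fintype.card_prod, Fintype.card_perm,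
    Fintype.card_fin]
  norm_num [Nat.factorial]
  ring

lemma sum_comp_dx_mul (K : Fin 4 → Fin 8) {β : Tensor 4} (hβ : IsAlt β) :
    ∑ J, comp (dx K) J * β J = 24 * β K := by
  simp only [comp_dx, Finset.sum_mul]
  rw [Finset.sum_comm]
  have : ∀ σ : Equiv.Perm (Fin 4), ∑ J : Fin 4 → Fin 8, ((Equiv.Perm.sign σ : ℤ) : ℝ) *
      (if K = fun j => J (σ j) then 1 else 0) * β J = β K := by
    intro σ
    rw [Finset.sum_eq_single (fun j => K (σ.symm j))]
    · rw [hβ σ.symm K]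
      simp only [Equiv.symm_apply_apply, if_true, mul_one, Equiv.Perm.sign_symm, ← mul_assoc,
        sign_mul_self, one_mul]
    · intro J _ hJ
      rw [if_neg, mul_zero, zero_mul]
      rintro rfl
      exact hJ (by ext j; simp)
    · simp
  simp only [this, Finset.sum_const, Finset.card_univ, Fintype.card_perm, Fintype.card_fin]
  norm_num [Nat.factorial]

/-- For an even arrangement of the eight indices, wedging with the first four is pairing with the
last four. The inverse is given explicitly so that the sign can be decided. -/
lemma topWedge_dx_of_perm (f g : Fin 8 → Fin 8) (h : ∀ i, g (f i) = i) (h' : ∀ i, f (g i) = i)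
    (hs : Equiv.Perm.sign (⟨f, g, h, h'⟩ : Equiv.Perm (Fin 8)) = 1) {β : Tensor 4}
    (hβ : IsAlt β) :
    topWedge (comp (dx ![f 0, f 1, f 2, f 3])) β =
      (1 / 24) * ∑ J, comp (dx ![f 4, f 5, f 6, f 7]) J * β J := by
  have := topWedge_dx ⟨f, g, h, h'⟩ hβ
  rw [hs] at this
  rw [sum_comp_dx_mul _ hβ]
  have e1 : ![f 0, f 1, f 2, f 3] = fun j => f (Fin.castAdd 4 j) := by
    ext j; fin_cases j <;> rfl
  have e2 : ![f 4, f 5, f 6, f 7] = fun j => f (Fin.natAdd 4 j) := by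
    ext j; fin_cases j <;> rfl
  rw [e1, e2]
  refine this.trans ?_
  simp only [Units.val_one, Int.cast_one, one_mul, one_div, Equiv.coe_fn_mk]
  ring

/-- The model Cayley form is self-dual. -/
lemma topWedge_model {β : Tensor 4} (hβ : IsAlt β) :
    topWedge (comp modelCayley) β = (1 / 24) * ∑ J, comp modelCayley J * β J := by
  have hn : ∀ α : Form 4, topWedge (comp (-α)) β = - topWedge (comp α) β := fun α => by
    rw [← neg_one_smul ℝ α, comp_smul, topWedge_smul_left, neg_one_mul]
  have ha : ∀ α α' : Form 4, topWedge (comp (α + α')) β =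
    topWedge (comp α) β + topWedge (comp α') β := fun α α' => topWedge_add_left _ _ _
  have hs : ∀ α α' : Form 4, topWedge (comp (α - α')) β =
    topWedge (comp α) β - topWedge (comp α') β := fun α α' => by
      rw [sub_eq_add_neg, ha, hn, sub_eq_add_neg]
  have sn : ∀ α : Form 4, ∑ J, comp (-α) J * β J = - ∑ J, comp α J * β J := fun α => by
    simp only [← Finset.sum_neg_distrib, ← neg_mul]; rfl
  have sa : ∀ α α' : Form 4, ∑ J, comp (α + α') J * β J =
    ∑ J, comp α J * β J + ∑ J, comp α' J * β J := fun α α' => by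
      simp only [← Finset.sum_add_distrib, ← add_mul]; rfl
  have ss : ∀ α α' : Form 4, ∑ J, comp (α - α') J * β J =
    ∑ J, comp α J * β J - ∑ J, comp α' J * β J := fun α α' => by
      simp only [← Finset.sum_sub_distrib, ← sub_mul]; rfl
  have h0 := topWedge_dx_of_perm ![0, 1, 2, 3, 4, 5, 6, 7]
    ![0, 1, 2, 3, 4, 5, 6, 7] (by decide) (by decide) (by decide +kernel) hβ
  change topWedge (comp (dx ![0, 1, 2, 3])) β =
    (1 / 24) * ∑ J, comp (dx ![4, 5, 6, 7]) J * β J at h0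
  have h1 := topWedge_dx_of_perm ![0, 1, 4, 5, 2, 3, 6, 7]
    ![0, 1, 4, 5, 2, 3, 6, 7] (by decide) (by decide) (by decide +kernel) hβ
  change topWedge (comp (dx ![0, 1, 4, 5])) β =
    (1 / 24) * ∑ J, comp (dx ![2, 3, 6, 7]) J * β J at h1
  have h2 := topWedge_dx_of_perm ![0, 1, 6, 7, 2, 3, 4, 5]
    ![0, 1, 4, 5, 6, 7, 2, 3] (by decide) (by decide) (by decide +kernel) hβ
  change topWedge (comp (dx ![0, 1, 6, 7])) β =
    (1 / 24) * ∑ J, comp (dx ![2, 3, 4, 5]) J * β J at h2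
  have h3 := topWedge_dx_of_perm ![0, 2, 4, 6, 1, 3, 5, 7]
    ![0, 4, 1, 5, 2, 6, 3, 7] (by decide) (by decide) (by decide +kernel) hβ
  change topWedge (comp (dx ![0, 2, 4, 6])) β =
    (1 / 24) * ∑ J, comp (dx ![1, 3, 5, 7]) J * β J at h3
  have h4 := topWedge_dx_of_perm ![0, 2, 5, 7, 1, 3, 4, 6]
    ![0, 4, 1, 5, 6, 2, 7, 3] (by decide) (by decide) (by decide +kernel) hβ
  change topWedge (comp (dx ![0, 2, 5, 7])) β =
    (1 / 24) * ∑ J, comp (dx ![1, 3, 4, 6]) J * β J at h4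
  have h5 := topWedge_dx_of_perm ![0, 3, 4, 7, 1, 2, 5, 6]
    ![0, 4, 5, 1, 2, 6, 7, 3] (by decide) (by decide) (by decide +kernel) hβ
  change topWedge (comp (dx ![0, 3, 4, 7])) β =
    (1 / 24) * ∑ J, comp (dx ![1, 2, 5, 6]) J * β J at h5
  have h6 := topWedge_dx_of_perm ![0, 3, 5, 6, 1, 2, 4, 7]
    ![0, 4, 5, 1, 6, 2, 3, 7] (by decide) (by decide) (by decide +kernel) hβ
  change topWedge (comp (dx ![0, 3, 5, 6])) β =
    (1 / 24) * ∑ J, comp (dx ![1, 2, 4, 7]) J * β J at h6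
  have h7 := topWedge_dx_of_perm ![4, 5, 6, 7, 0, 1, 2, 3]
    ![4, 5, 6, 7, 0, 1, 2, 3] (by decide) (by decide) (by decide +kernel) hβ
  change topWedge (comp (dx ![4, 5, 6, 7])) β =
    (1 / 24) * ∑ J, comp (dx ![0, 1, 2, 3]) J * β J at h7
  have h8 := topWedge_dx_of_perm ![2, 3, 6, 7, 0, 1, 4, 5]
    ![4, 5, 0, 1, 6, 7, 2, 3] (by decide) (by decide) (by decide +kernel) hβ
  change topWedge (comp (dx ![2, 3, 6, 7])) β =
    (1 / 24) * ∑ J, comp (dx ![0, 1, 4, 5]) J * β J at h8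
  have h9 := topWedge_dx_of_perm ![2, 3, 4, 5, 0, 1, 6, 7]
    ![4, 5, 0, 1, 2, 3, 6, 7] (by decide) (by decide) (by decide +kernel) hβ
  change topWedge (comp (dx ![2, 3, 4, 5])) β =
    (1 / 24) * ∑ J, comp (dx ![0, 1, 6, 7]) J * β J at h9
  have h10 := topWedge_dx_of_perm ![1, 3, 5, 7, 0, 2, 4, 6]
    ![4, 0, 5, 1, 6, 2, 7, 3] (by decide) (by decide) (by decide +kernel) hβ
  change topWedge (comp (dx ![1, 3, 5, 7])) β =
    (1 / 24) * ∑ J, comp (dx ![0, 2, 4, 6]) J * β J at h10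
  have h11 := topWedge_dx_of_perm ![1, 3, 4, 6, 0, 2, 5, 7]
    ![4, 0, 5, 1, 2, 6, 3, 7] (by decide) (by decide) (by decide +kernel) hβ
  change topWedge (comp (dx ![1, 3, 4, 6])) β =
    (1 / 24) * ∑ J, comp (dx ![0, 2, 5, 7]) J * β J at h11
  have h12 := topWedge_dx_of_perm ![1, 2, 5, 6, 0, 3, 4, 7]
    ![4, 0, 1, 5, 6, 2, 3, 7] (by decide) (by decide) (by decide +kernel) hβ
  change topWedge (comp (dx ![1, 2, 5, 6])) β =
    (1 / 24) * ∑ J, comp (dx ![0, 3, 4, 7]) J * β J at h12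
  have h13 := topWedge_dx_of_perm ![1, 2, 4, 7, 0, 3, 5, 6]
    ![4, 0, 1, 5, 2, 6, 7, 3] (by decide) (by decide) (by decide +kernel) hβ
  change topWedge (comp (dx ![1, 2, 4, 7])) β =
    (1 / 24) * ∑ J, comp (dx ![0, 3, 5, 6]) J * β J at h13
  -- The fourteen index sets form complementary pairs with equal coefficients, and all fourteen
  -- arrangements above are even, so the two sides agree up to order.
  simp only [modelCayley, hn, ha, hs, sn, sa, ss, h0, h1, h2, h3, h4, h5, h6, h7, h8, h9, h10, h11, h12, h13]
  ring


/-! ### Frames -/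

/-- `A` is the matrix of a linear isomorphism with `φ = A^* modelCayley`, and `B` is its
inverse. -/
structure IsFrame (φ : Form 4) (A B : Matrix (Fin 8) (Fin 8) ℝ) : Prop where
  mul_eq_one : A * B = 1
  comp_eq : comp φ = pull A (comp modelCayley)

/-- A frame that is orthonormal for the metric of `φ`. -/
structure IsMetricFrame (φ : Form 4) (A B : Matrix (Fin 8) (Fin 8) ℝ) : Prop
    extends IsFrame φ A B where
  metric_eq : metric φ = A.transpose * A

/-- The matrix of a linear isomorphism. -/
def matrixOf (A : Space →L[ℝ] Space) : Matrix (Fin 8) (Fin 8) ℝ :=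
  Matrix.of fun a i => A (basisVec i) a

lemma matrixOf_comp (A B : Space →L[ℝ] Space) :
    matrixOf (A.comp B) = matrixOf A * matrixOf B := by
  ext a i
  simp only [matrixOf, Matrix.of_apply, ContinuousLinearMap.comp_apply, Matrix.mul_apply]
  conv_lhs => rw [eq_sum_basisVec (B (basisVec i)), map_sum]
  simp [mul_comm]

lemma matrixOf_id : matrixOf (ContinuousLinearMap.id ℝ Space) = 1 := by
  ext a i
  simp [matrixOf, basisVec, Matrix.one_apply, Pi.single_apply]

lemma isFrame_of_eq {φ : Form 4} {A : Space ≃L[ℝ] Space}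
    (h : φ = modelCayley.compContinuousLinearMap (A : Space →L[ℝ] Space)) :
    IsFrame φ (matrixOf A) (matrixOf A.symm) where
  mul_eq_one := by
    rw [← matrixOf_comp, ContinuousLinearEquiv.coe_comp_coe_symm, matrixOf_id]
  comp_eq := by rw [h, comp_compContinuousLinearMap]; rfl

/-- The metric is a choice among Gram matrices, so at this stage only the frame behind the chosen
one is known to be compatible; `IsFrame.isMetricFrame` later removes the restriction. -/
lemma IsCayley.exists_metricFrame {φ : Form 4} (h : IsCayley φ) :
    ∃ A B, IsMetricFrame φ A B := by
  have h1 : ∃ g, IsMetricOf φ g := by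
    obtain ⟨A, hA⟩ := h
    exact ⟨Matrix.of fun i j => ∑ k, A (basisVec i) k * A (basisVec j) k, A, hA, fun _ _ => rfl⟩
  obtain ⟨A, hA, hg⟩ := Classical.epsilon_spec h1
  refine ⟨matrixOf A, matrixOf A.symm, isFrame_of_eq hA, ?_⟩
  ext i j
  exact hg i j

/-- The Kronecker delta of the components of dual bases. -/
lemma delta_comm (i j : Fin 8) : delta i j = delta j i := by simp [delta, eq_comm]

lemma sum_delta_mul (i : Fin 8) (f : Fin 8 → ℝ) : ∑ j, delta i j * f j = f i := by
  simp [delta]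

lemma sum_delta_mul' (i : Fin 8) (f : Fin 8 → ℝ) : ∑ j, delta j i * f j = f i := by
  simp [delta]

namespace IsFrame

variable {φ : Form 4} {A B : Matrix (Fin 8) (Fin 8) ℝ}

lemma mul_eq_one' (h : IsFrame φ A B) : B * A = 1 := mul_eq_one_comm.1 h.mul_eq_one

lemma lower (h : IsFrame φ A B) (i j k l : Fin 8) :
    comp φ ![i, j, k, l] = m4 (A.transpose i) (A.transpose j) (A.transpose k) (A.transpose l) := by
  rw [h.comp_eq, m4, apply_eq_sum_comp]
  simp only [pull, Fin.prod_univ_four]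
  rfl

lemma dot_row_col (h : IsFrame φ A B) (p i : Fin 8) : B p ⬝ᵥ A.transpose i = delta p i := by
  have := congrFun (congrFun h.mul_eq_one' p) i
  rw [Matrix.mul_apply', Matrix.one_apply] at this
  exact this

lemma dot_col_row (h : IsFrame φ A B) (p i : Fin 8) : A.transpose i ⬝ᵥ B p = delta i p := by
  rw [dotProduct_comm, h.dot_row_col, delta_comm]

/-- The resolution of the identity by the coordinate vectors and the dual frame. -/
lemma sum_dual (h : IsFrame φ A B) {f g : Space → ℝ} (hf : IsLinearMap ℝ f)
    (hg : IsLinearMap ℝ g) :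
    ∑ b, f (B b) * g (A.transpose b) = ∑ d, f (basisVec d) * g (basisVec d) :=
  Spin7.sum_dual hf hg h.mul_eq_one

/-- The double contraction of the model Cayley form with itself, in a frame. -/
lemma sum_m4_mul_m4 (h : IsFrame φ A B) (u v x y : Space) :
    ∑ p, ∑ q, m4 u v (B p) (B q) * m4 x y (A.transpose p) (A.transpose q) =
      6 * ((u ⬝ᵥ x) * (v ⬝ᵥ y) - (u ⬝ᵥ y) * (v ⬝ᵥ x)) - 4 * m4 u v x y := by
  rw [← m4_contract_two]
  have e1 : ∀ p, ∑ q, m4 u v (B p) (B q) * m4 x y (A.transpose p) (A.transpose q) =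
      ∑ d, m4 u v (B p) (basisVec d) * m4 x y (A.transpose p) (basisVec d) := fun p =>
    h.sum_dual (m4_lin3 _ _ _) (m4_lin3 _ _ _)
  simp only [e1]
  rw [Finset.sum_comm]
  have e2 : ∀ d, ∑ p, m4 u v (B p) (basisVec d) * m4 x y (A.transpose p) (basisVec d) =
      ∑ c, m4 u v (basisVec c) (basisVec d) * m4 x y (basisVec c) (basisVec d) := fun d =>
    h.sum_dual (m4_lin2 _ _ _) (m4_lin2 _ _ _)
  simp only [e2]
  rw [Finset.sum_comm]

/-- Writing β as the pullback by A of its pullback by B makes both factors pullbacks by A. The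
determinant law and self-duality of the model apply, and B is then moved to the other factor as its
transpose. -/
lemma topWedge_eq (h : IsFrame φ A B) {β : Tensor 4} (hβ : IsAlt β) :
    topWedge (comp φ) β = A.det * ((1 / 24) *
      ∑ I, pull B.transpose (comp modelCayley) I * β I) := by
  have h1 : β = pull A (pull B β) := by rw [pull_pull, h.mul_eq_one', pull_one]
  conv_lhs => rw [h1, h.comp_eq, topWedge_pull, topWedge_model (hβ.pull B)]
  congr 2
  simp only [pull, Finset.mul_sum, Finset.sum_mul]
  rw [Finset.sum_comm]
  refine Finset.sum_congr rfl fun J _ => Finset.sum_congr rfl fun I _ => ?_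
  simp only [Matrix.transpose_apply]
  ring

lemma vol_eq (h : IsFrame φ A B) : vol φ = A.det := by
  have h0 : topWedge (comp modelCayley) (comp modelCayley) = 14 := by
    rw [topWedge_model (isAlt_comp _), sum_fin4]
    -- Each ordered pair a ≠ b contributes 6, and 6 · 56 / 24 = 14.
    have e : ∀ a b, ∑ c, ∑ d, mc a b c d * mc a b c d = 6 * (1 - delta a b) := by
      intro a b
      have := m4_contract_two (basisVec a) (basisVec b) (basisVec a) (basisVec b)
      simp only [m4_basisVec, basisVec_dotProduct] at this
      rw [this, ← m4_basisVec, m4_self02]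
      by_cases hab : a = b
      · simp [delta, hab]
      · simp [delta, hab, Ne.symm hab]
    change (1 / 24) * ∑ a, ∑ b, ∑ c, ∑ d, mc a b c d * mc a b c d = 14
    simp only [e]
    simp [delta, ← Finset.mul_sum]
    norm_num
  rw [vol, h.comp_eq, topWedge_pull, h0]
  ring

lemma vol_ne_zero (h : IsFrame φ A B) : vol φ ≠ 0 := by
  rw [h.vol_eq]
  exact fun h0 => by simpa [h0] using congrArg Matrix.det h.mul_eq_one

end IsFrame

/-! ### Recovering the inverse metric from the form -/

/-- The components `Φ^{ijkl}` of the dual of a Cayley form, without reference to the metric. -/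
def dualTensor (φ : Form 4) : Tensor 4 := fun K => topWedge (comp φ) (comp (dx K)) / vol φ

/-- The `2 × 2` minors of the inverse metric of a Cayley form, without reference to the metric. -/
def minorInv (φ : Form 4) (i a j b : Fin 8) : ℝ :=
  (1 / 24) * (28 * dualTensor φ ![i, a, j, b] - ∑ r, ∑ s, ∑ p, ∑ q,
    dualTensor φ ![i, a, p, q] * dualTensor φ ![j, b, r, s] * comp φ ![p, q, r, s])

/-- The determinant of the matrix of cofactors of the inverse metric of a Cayley form in the
indices `x`, `y`, `z`. -/
def detMinors (φ : Form 4) (x y z : Fin 8) : ℝ :=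
  minorInv φ y z y z * (minorInv φ x z x z * minorInv φ x y x y - minorInv φ x z x y ^ 2)
  - minorInv φ y z x z * (minorInv φ y z x z * minorInv φ x y x y
    - minorInv φ x z x y * minorInv φ y z x y)
  + minorInv φ y z x y * (minorInv φ y z x z * minorInv φ x z x y
    - minorInv φ x z x z * minorInv φ y z x y)

/-- The diagonal components of the inverse metric of a Cayley form. -/
def invDiag (φ : Form 4) (x y z : Fin 8) : ℝ :=
  (minorInv φ x z x z * minorInv φ x y x y - minorInv φ x z x y ^ 2) / √(detMinors φ x y z)

/-- The off-diagonal components of the inverse metric of a Cayley form. -/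
def invOffDiag (φ : Form 4) (x y z : Fin 8) : ℝ :=
  (minorInv φ y z x z * minorInv φ x y x y - minorInv φ x z x y * minorInv φ y z x y)
    / √(detMinors φ x y z)

namespace IsFrame

variable {φ : Form 4} {A B : Matrix (Fin 8) (Fin 8) ℝ}

/-- By self-duality, wedging with dx^{ijkl} and dividing by the volume reads off one component of
the dual form. -/
lemma dualTensor_eq (h : IsFrame φ A B) (i j k l : Fin 8) :
    dualTensor φ ![i, j, k, l] = m4 (B i) (B j) (B k) (B l) := by
  have hup : IsAlt (pull B.transpose (comp modelCayley)) := (isAlt_comp _).pull _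
  have h1 := h.topWedge_eq (isAlt_comp (dx ![i, j, k, l]))
  simp only [fun I => mul_comm (pull B.transpose (comp modelCayley) I)] at h1
  rw [sum_comp_dx_mul _ hup] at h1
  rw [dualTensor, h1, ← h.vol_eq, mul_div_cancel_left₀ _ h.vol_ne_zero]
  trans pull B.transpose (comp modelCayley) ![i, j, k, l]
  · ring
  · rw [m4, apply_eq_sum_comp]
    simp only [pull, Fin.prod_univ_four]
    rfl

/-- Apply the double contraction identity twice to the triple product. The delta terms give 12 Φ,
and the term -4 Φ contracted once more gives 16 Φ - 24 (minor). The total 28 Φ - 24 (minor) explains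
the constants of `minorInv`. -/
lemma minorInv_eq (h : IsFrame φ A B) (i a j b : Fin 8) :
    minorInv φ i a j b = (B i ⬝ᵥ B j) * (B a ⬝ᵥ B b) - (B i ⬝ᵥ B b) * (B a ⬝ᵥ B j) := by
  simp only [minorInv, h.dualTensor_eq, h.lower]
  have e : ∀ r s, ∑ p, ∑ q, m4 (B i) (B a) (B p) (B q) * m4 (B j) (B b) (B r) (B s) *
      m4 (A.transpose p) (A.transpose q) (A.transpose r) (A.transpose s) =
      6 * (delta i r * (delta a s * m4 (B j) (B b) (B r) (B s))) -
      6 * (delta a r * (delta i s * m4 (B j) (B b) (B r) (B s))) -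
      4 * (m4 (B j) (B b) (B r) (B s) * m4 (B i) (B a) (A.transpose r) (A.transpose s)) := by
    intro r s
    have := h.sum_m4_mul_m4 (B i) (B a) (A.transpose r) (A.transpose s)
    simp only [h.dot_row_col] at this
    trans m4 (B j) (B b) (B r) (B s) * ∑ p, ∑ q, m4 (B i) (B a) (B p) (B q) *
      m4 (A.transpose r) (A.transpose s) (A.transpose p) (A.transpose q)
    · simp only [Finset.mul_sum]
      refine Finset.sum_congr rfl fun p _ => Finset.sum_congr rfl fun q _ => ?_
      rw [m4_pair_swap (A.transpose p)]
      ring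
    · rw [this]; ring
  simp only [e, Finset.sum_sub_distrib, ← Finset.mul_sum, sum_delta_mul, h.sum_m4_mul_m4]
  rw [m4_swap23 (B j) (B b) (B i) (B a), m4_pair_swap (B i) (B a) (B j) (B b),
    dotProduct_comm (B b) (B i), dotProduct_comm (B j) (B i), dotProduct_comm (B b) (B a),
    dotProduct_comm (B j) (B a)]
  ring

/-- B is invertible, so B Bᵀ is positive definite, and so is its principal submatrix on three
distinct indices. -/
lemma det_gram_pos (h : IsFrame φ A B) {x y z : Fin 8} (hxy : x ≠ y) (hxz : x ≠ z)
    (hyz : y ≠ z) : 0 < (B x ⬝ᵥ B x) * ((B y ⬝ᵥ B y) * (B z ⬝ᵥ B z) - (B y ⬝ᵥ B z) ^ 2)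
      - (B x ⬝ᵥ B y) * ((B x ⬝ᵥ B y) * (B z ⬝ᵥ B z) - (B x ⬝ᵥ B z) * (B y ⬝ᵥ B z))
      + (B x ⬝ᵥ B z) * ((B x ⬝ᵥ B y) * (B y ⬝ᵥ B z) - (B x ⬝ᵥ B z) * (B y ⬝ᵥ B y)) := by
  have h1 : (B * B.transpose).PosDef := by
    have h2 := Matrix.PosDef.one.mul_mul_conjTranspose_same (n := Fin 8) (R := ℝ) (B := B)
      (fun u v huv => by
        have := congrArg (fun w => Matrix.vecMul w A) huv
        simpa [Matrix.vecMul_vecMul, h.mul_eq_one'] using this)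
    simpa [Matrix.conjTranspose_eq_transpose_of_trivial] using h2
  have h2 := (h1.submatrix (e := ![x, y, z]) (by
    intro i j hij
    fin_cases i <;> fin_cases j <;> simp_all)).det_pos
  have e : ∀ i j, (B * B.transpose) i j = B i ⬝ᵥ B j := fun i j => Matrix.mul_apply'
  rw [Matrix.det_fin_three] at h2
  simp only [Matrix.submatrix_apply, e] at h2
  refine h2.trans_eq ?_
  simp [dotProduct_comm (B y) (B x), dotProduct_comm (B z) (B x), dotProduct_comm (B z) (B y)]
  ring

/-- For a symmetric 3 × 3 matrix of determinant D, the cofactor matrix has determinant D², and its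
own cofactors are D times the original entries. Minors alone leave a sign open; here D > 0, so √(D²)
= D and division returns the entries of the inverse metric. -/
lemma sqrt_detMinors (h : IsFrame φ A B) {x y z : Fin 8} (hxy : x ≠ y) (hxz : x ≠ z)
    (hyz : y ≠ z) : 0 < detMinors φ x y z ∧ invDiag φ x y z = B x ⬝ᵥ B x ∧
      invOffDiag φ x y z = B x ⬝ᵥ B y := by
  have hpos := h.det_gram_pos hxy hxz hyz
  set D := (B x ⬝ᵥ B x) * ((B y ⬝ᵥ B y) * (B z ⬝ᵥ B z) - (B y ⬝ᵥ B z) ^ 2)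
      - (B x ⬝ᵥ B y) * ((B x ⬝ᵥ B y) * (B z ⬝ᵥ B z) - (B x ⬝ᵥ B z) * (B y ⬝ᵥ B z))
      + (B x ⬝ᵥ B z) * ((B x ⬝ᵥ B y) * (B y ⬝ᵥ B z) - (B x ⬝ᵥ B z) * (B y ⬝ᵥ B y)) with hD
  have hsq : detMinors φ x y z = D ^ 2 := by
    simp only [detMinors, h.minorInv_eq, dotProduct_comm (B y) (B x),
      dotProduct_comm (B z) (B x), dotProduct_comm (B z) (B y), hD]
    ring
  refine ⟨by rw [hsq]; positivity, ?_, ?_⟩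
  · rw [invDiag, hsq, Real.sqrt_sq hpos.le, div_eq_iff hpos.ne']
    simp only [h.minorInv_eq, dotProduct_comm (B y) (B x),
      dotProduct_comm (B z) (B x), dotProduct_comm (B z) (B y), hD]
    ring
  · rw [invOffDiag, hsq, Real.sqrt_sq hpos.le, div_eq_iff hpos.ne']
    simp only [h.minorInv_eq, dotProduct_comm (B y) (B x),
      dotProduct_comm (B z) (B x), dotProduct_comm (B z) (B y), hD]
    ring

end IsFrame

/-! ### Raising indices and contraction identities in a metric frame -/

namespace IsMetricFrame

variable {φ : Form 4} {A B : Matrix (Fin 8) (Fin 8) ℝ}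

lemma invMetric_eq (h : IsMetricFrame φ A B) : invMetric φ = B * B.transpose := by
  rw [invMetric, h.metric_eq]
  apply Matrix.inv_eq_right_inv
  rw [Matrix.mul_assoc, ← Matrix.mul_assoc A, h.mul_eq_one, Matrix.one_mul,
    ← Matrix.transpose_mul, h.mul_eq_one', Matrix.transpose_one]

lemma dot_row_row (h : IsMetricFrame φ A B) (p q : Fin 8) : B p ⬝ᵥ B q = invMetric φ p q := by
  rw [h.invMetric_eq, Matrix.mul_apply']; rfl

lemma dot_col_col (h : IsMetricFrame φ A B) (i j : Fin 8) :
    A.transpose i ⬝ᵥ A.transpose j = metric φ i j := by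
  rw [h.metric_eq, Matrix.mul_apply']; rfl

lemma invMetric_comm (h : IsMetricFrame φ A B) (p q : Fin 8) :
    invMetric φ p q = invMetric φ q p := by
  rw [← h.dot_row_row, ← h.dot_row_row, dotProduct_comm]

lemma metric_comm (h : IsMetricFrame φ A B) (p q : Fin 8) : metric φ p q = metric φ q p := by
  rw [← h.dot_col_col, ← h.dot_col_col, dotProduct_comm]

lemma metric_mul_inv (h : IsMetricFrame φ A B) : metric φ * invMetric φ = 1 := by
  rw [h.invMetric_eq, h.metric_eq, Matrix.mul_assoc, ← Matrix.mul_assoc A, h.mul_eq_one,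
    Matrix.one_mul, ← Matrix.transpose_mul, h.mul_eq_one', Matrix.transpose_one]

lemma inv_mul_metric (h : IsMetricFrame φ A B) : invMetric φ * metric φ = 1 :=
  mul_eq_one_comm.1 h.metric_mul_inv

/-- Since B = G Aᵀ, raising an index replaces a column of A by a row of B. Every mixed component of
Φ thereby becomes a value of `m4` on such vectors. -/
lemma raise (h : IsMetricFrame φ A B) {f : Space → ℝ} (hf : IsLinearMap ℝ f) (p : Fin 8) :
    ∑ r, invMetric φ p r * f (A.transpose r) = f (B p) := by
  refine (IsLinearMap.map_sum_smul hf (fun r => invMetric φ p r) (fun r => A.transpose r)).symm.trans ?_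
  congr 1
  have : B = invMetric φ * A.transpose := by
    rw [h.invMetric_eq, Matrix.mul_assoc, ← Matrix.transpose_mul, h.mul_eq_one,
      Matrix.transpose_one, Matrix.mul_one]
  conv_rhs => rw [this]
  ext a
  simp [Matrix.mul_apply]

lemma lowerIndex (h : IsMetricFrame φ A B) {f : Space → ℝ} (hf : IsLinearMap ℝ f) (p : Fin 8) :
    ∑ r, metric φ p r * f (B r) = f (A.transpose p) := by
  refine (IsLinearMap.map_sum_smul hf (fun r => metric φ p r) (fun r => B r)).symm.trans ?_
  congr 1
  have : A.transpose = metric φ * B := by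
    rw [h.metric_eq, Matrix.mul_assoc, h.mul_eq_one, Matrix.mul_one]
  conv_rhs => rw [this]
  ext a
  simp [Matrix.mul_apply]

lemma phi22_eq (h : IsMetricFrame φ A B) (i j p q : Fin 8) :
    phi22 φ i j p q = m4 (A.transpose i) (A.transpose j) (B p) (B q) := by
  simp only [phi22, h.lower]
  rw [← h.raise (m4_lin2 _ _ _) p]
  refine Finset.sum_congr rfl fun r _ => ?_
  rw [← h.raise (m4_lin3 _ _ _) q, Finset.mul_sum]
  refine Finset.sum_congr rfl fun s _ => ?_
  rw [h.invMetric_comm r p, h.invMetric_comm s q]; ring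

lemma phiUp_eq (h : IsMetricFrame φ A B) (i j k l : Fin 8) :
    phiUp φ i j k l = m4 (B i) (B j) (B k) (B l) := by
  simp only [phiUp, h.phi22_eq]
  rw [← h.raise (m4_lin0 _ _ _) i]
  refine Finset.sum_congr rfl fun r _ => ?_
  rw [← h.raise (m4_lin1 _ _ _) j, Finset.mul_sum]
  refine Finset.sum_congr rfl fun s _ => ?_
  ring

/-- The single contraction `Φ^{pqrb} Φ_{jklb}`. -/
lemma sum_phiUp_mul_lower (h : IsMetricFrame φ A B) (p q r j k l : Fin 8) :
    ∑ b, phiUp φ p q r b * comp φ ![j, k, l, b] =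
      delta p j * (delta q k * delta r l - delta q l * delta r k)
      - delta p k * (delta q j * delta r l - delta q l * delta r j)
      + delta p l * (delta q j * delta r k - delta q k * delta r j)
      - delta p j * phi22 φ k l q r - delta p k * phi22 φ l j q r - delta p l * phi22 φ j k q r
      - delta q j * phi22 φ k l r p - delta q k * phi22 φ l j r p - delta q l * phi22 φ j k r p
      - delta r j * phi22 φ k l p q - delta r k * phi22 φ l j p q
      - delta r l * phi22 φ j k p q := by
  simp only [h.phiUp_eq, h.lower]
  rw [h.sum_dual (m4_lin3 _ _ _) (m4_lin3 _ _ _), m4_contract]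
  simp only [contractVec, h.dot_row_col, h.phi22_eq,
    fun k l q r => m4_pair_swap (A.transpose k) (A.transpose l) (B q) (B r)]

/-- The double contraction `Φ_{ij}^{pq} Φ_{pq}^{ab}`. -/
lemma sum_phi22_mul_phi22 (h : IsMetricFrame φ A B) (i j a b : Fin 8) :
    ∑ p, ∑ q, phi22 φ i j p q * phi22 φ p q a b =
      6 * (delta i a * delta j b - delta i b * delta j a) - 4 * phi22 φ i j a b := by
  simp only [h.phi22_eq, fun p q => m4_pair_swap (B a) (B b) (A.transpose p) (A.transpose q)]
  rw [h.sum_m4_mul_m4, m4_pair_swap (A.transpose i)]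
  simp only [h.dot_col_row]

/-- The double contraction `Φ^{bpqr} Φ_{asqr}`. -/
lemma sum_phiUp_mul_lower_two (h : IsMetricFrame φ A B) (b p a s : Fin 8) :
    ∑ q, ∑ r, phiUp φ b p q r * comp φ ![a, s, q, r] =
      6 * (delta b a * delta p s - delta b s * delta p a) - 4 * phi22 φ a s b p := by
  simp only [h.phiUp_eq, h.lower]
  rw [h.sum_m4_mul_m4, h.phi22_eq, m4_pair_swap (A.transpose a) (A.transpose s)]
  simp only [h.dot_row_col]

/-- The contraction `G^{bd} Φ_{ab}^{pq} Φ_{cd}^{rs}`. -/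
lemma sum_invMetric_phi22_phi22 (h : IsMetricFrame φ A B) (a p q c r s : Fin 8) :
    ∑ b, ∑ d, invMetric φ b d * phi22 φ a b p q * phi22 φ c d r s =
      contractVec (A.transpose a) (B p) (B q) (A.transpose c) (B r) (B s) := by
  have e0 : ∀ u v w z : Space, m4 u z v w = m4 u v w z := fun u v w z => by
    rw [m4_swap12 u v z w, m4_swap23 u v w z, neg_neg]
  simp only [h.phi22_eq, e0 _ (B _) (B _)]
  have e1 : ∀ b, ∑ d, invMetric φ b d * m4 (A.transpose a) (B p) (B q) (A.transpose b) *
      m4 (A.transpose c) (B r) (B s) (A.transpose d) =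
      m4 (A.transpose c) (B r) (B s) (B b) * m4 (A.transpose a) (B p) (B q) (A.transpose b) := by
    intro b
    rw [← h.raise (m4_lin3 _ _ _) b, Finset.sum_mul]
    exact Finset.sum_congr rfl fun d _ => by ring
  simp only [e1]
  rw [h.sum_dual (m4_lin3 _ _ _) (m4_lin3 _ _ _), ← m4_contract]
  exact Finset.sum_congr rfl fun d _ => by ring

lemma phiUp_swap01 (h : IsMetricFrame φ A B) (a b c d : Fin 8) :
    phiUp φ b a c d = - phiUp φ a b c d := by
  simp only [h.phiUp_eq]; exact m4_swap01 _ _ _ _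

lemma phiUp_swap12 (h : IsMetricFrame φ A B) (a b c d : Fin 8) :
    phiUp φ a c b d = - phiUp φ a b c d := by
  simp only [h.phiUp_eq]; exact m4_swap12 _ _ _ _

lemma phiUp_swap23 (h : IsMetricFrame φ A B) (a b c d : Fin 8) :
    phiUp φ a b d c = - phiUp φ a b c d := by
  simp only [h.phiUp_eq]; exact m4_swap23 _ _ _ _

lemma phi22_swap01 (h : IsMetricFrame φ A B) (a b c d : Fin 8) :
    phi22 φ b a c d = - phi22 φ a b c d := by
  simp only [h.phi22_eq]; exact m4_swap01 _ _ _ _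

lemma phi22_swap23 (h : IsMetricFrame φ A B) (a b c d : Fin 8) :
    phi22 φ a b d c = - phi22 φ a b c d := by
  simp only [h.phi22_eq]; exact m4_swap23 _ _ _ _

lemma phiUp_eq_sum (h : IsMetricFrame φ A B) (I : Fin 4 → Fin 8) :
    phiUp φ (I 0) (I 1) (I 2) (I 3) = pull B.transpose (comp modelCayley) I := by
  rw [h.phiUp_eq, m4, apply_eq_sum_comp]
  simp only [pull, Fin.prod_univ_four]
  rfl

/-- The wedge product with a Cayley form is the contraction with its dual. -/
lemma topWedge_eq_sum (h : IsMetricFrame φ A B) {β : Tensor 4} (hβ : IsAlt β) :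
    topWedge (comp φ) β = A.det * ((1 / 24) *
      ∑ i, ∑ j, ∑ k, ∑ l, phiUp φ i j k l * β ![i, j, k, l]) := by
  rw [h.topWedge_eq hβ]
  congr 2
  trans ∑ I, phiUp φ (I 0) (I 1) (I 2) (I 3) * β I
  · simp only [h.phiUp_eq_sum]
  · rw [sum_fin4]
    rfl

/-- `Φ_{ij}^{pj} = 0`. -/
lemma sum_phi22_trace (h : IsMetricFrame φ A B) (i p : Fin 8) : ∑ j, phi22 φ i j p j = 0 := by
  simp only [h.phi22_eq]
  rw [sum_dual_bilin (F := fun u v => m4 (A.transpose i) v (B p) u) (fun v => m4_lin3 _ _ _)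
    (fun u => m4_lin1 _ _ _) h.mul_eq_one]
  simp only [m4_self13, Finset.sum_const_zero]

end IsMetricFrame


/-! ### Contraction of 4-forms with a Cayley form -/

/-- The contraction `σ_{ipqr} Φ^{bpqr}`. -/
def contract (φ : Form 4) (σ : Tensor 4) : Matrix (Fin 8) (Fin 8) ℝ := Matrix.of fun i b =>
  ∑ p, ∑ q, ∑ r, σ ![i, p, q, r] * phiUp φ b p q r

/-- The tensor `Φ_{ij}^{pq} σ_{klpq}`. -/
def pairTensor (φ : Form 4) (σ : Tensor 4) : Tensor 4 := fun I =>
  ∑ p, ∑ q, phi22 φ (I 0) (I 1) p q * σ ![I 2, I 3, p, q]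

/-- The tensor `M_i^b Φ_{bjkl}`. -/
def insertTensor (φ : Form 4) (M : Matrix (Fin 8) (Fin 8) ℝ) : Tensor 4 := fun I =>
  ∑ b, M (I 0) b * comp φ ![b, I 1, I 2, I 3]

lemma J4_eq (φ : Form 4) (σ : Tensor 4) : J4 φ σ = (3 : ℝ) • alt (pairTensor φ σ) := rfl

lemma alt_even_perm {k : ℕ} (t : Tensor k) (τ : Equiv.Perm (Fin k))
    (hτ : Equiv.Perm.sign τ = 1) : alt (fun I => t (fun j => I (τ j))) = alt t := by
  rw [alt_comp_perm, hτ]; simp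

lemma alt_pair_swap (t : Tensor 4) : alt (fun I => t ![I 2, I 3, I 0, I 1]) = alt t := by
  rw [← alt_even_perm t ⟨![2, 3, 0, 1], ![2, 3, 0, 1], by decide, by decide⟩ (by decide)]
  congr 1; ext I; congr 1; ext j; fin_cases j <;> rfl

lemma alt_cycle_three (t : Tensor 4) : alt (fun I => t ![I 3, I 1, I 0, I 2]) = alt t := by
  rw [← alt_even_perm t ⟨![3, 1, 0, 2], ![2, 1, 3, 0], by decide, by decide⟩ (by decide)]
  congr 1; ext I; congr 1; ext j; fin_cases j <;> rfl

lemma alt_cycle_three' (t : Tensor 4) : alt (fun I => t ![I 1, I 2, I 0, I 3]) = alt t := by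
  rw [← alt_even_perm t ⟨![1, 2, 0, 3], ![2, 0, 1, 3], by decide, by decide⟩ (by decide)]
  congr 1; ext I; congr 1; ext j; fin_cases j <;> rfl

/-- Antisymmetrisation is a projection adjoint to itself, so against an alternating tensor it can be
dropped. -/
lemma sum_mul_alt {k : ℕ} {s : Tensor k} (hs : IsAlt s) (t : Tensor k) :
    ∑ I, s I * alt t I = ∑ I, s I * t I := by
  have h : ∀ σ : Equiv.Perm (Fin k), ∑ I : Fin k → Fin 8, s I *
      (((Equiv.Perm.sign σ : ℤ) : ℝ) * t (fun j => I (σ j))) = ∑ I, s I * t I := by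
    intro σ
    refine Fintype.sum_bijective (fun I : Fin k → Fin 8 => fun j => I (σ j))
      (Equiv.arrowCongr σ.symm (Equiv.refl (Fin 8))).bijective _ _ fun I => ?_
    rw [hs σ I]; ring
  simp only [alt, Finset.mul_sum]
  rw [Finset.sum_comm]
  simp only [mul_left_comm _ (1 / (k.factorial : ℝ)), ← Finset.mul_sum, h]
  simp only [Finset.sum_const, Finset.card_univ, Fintype.card_perm, Fintype.card_fin,
    nsmul_eq_mul]
  rw [← mul_assoc, one_div_mul_cancel (by positivity), one_mul]

lemma sum_three_delta (s : Fin 8 → Fin 8 → Fin 8 → ℝ) (a b c : Fin 8) :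
    ∑ p, ∑ q, ∑ r, delta p a * (delta q b * (delta r c * s p q r)) = s a b c := by
  simp only [← Finset.mul_sum, sum_delta_mul']

lemma sum_delta_first (s : Fin 8 → Fin 8 → Fin 8 → ℝ) (F : Fin 8 → Fin 8 → ℝ) (a : Fin 8) :
    ∑ p, ∑ q, ∑ r, delta p a * (s p q r * F q r) = ∑ q, ∑ r, F q r * s a q r := by
  simp only [← Finset.mul_sum, sum_delta_mul']
  exact Finset.sum_congr rfl fun q _ => Finset.sum_congr rfl fun r _ => mul_comm _ _

lemma sum_rotate (f : Fin 8 → Fin 8 → Fin 8 → ℝ) :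
    ∑ p, ∑ q, ∑ r, f p q r = ∑ p, ∑ q, ∑ r, f r p q := by
  rw [Finset.sum_comm]
  refine Finset.sum_congr rfl fun q _ => ?_
  rw [Finset.sum_comm]

lemma sum_comm_three (f : Fin 8 → Fin 8 → Fin 8 → Fin 8 → ℝ) :
    ∑ j, ∑ k, ∑ l, ∑ a, f j k l a = ∑ a, ∑ j, ∑ k, ∑ l, f j k l a := by
  have e : ∀ j, ∑ k, ∑ l, ∑ a, f j k l a = ∑ a, ∑ k, ∑ l, f j k l a := fun j => by
    rw [Finset.sum_congr rfl fun k _ => Finset.sum_comm, Finset.sum_comm]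
  rw [Finset.sum_congr rfl fun j _ => e j, Finset.sum_comm]

namespace IsAlt

variable {σ : Tensor 4}

lemma pair_swap (h : IsAlt σ) (a b c d : Fin 8) : σ ![c, d, a, b] = σ ![a, b, c, d] := by
  rw [h.swap12 c a d b, h.swap01 a c d b, h.swap23 a c b d, h.swap12 a b c d]; ring

lemma rotate_last (h : IsAlt σ) (a b c d : Fin 8) : σ ![a, c, d, b] = σ ![a, b, c, d] := by
  rw [h.swap23 a c b d, h.swap12 a b c d, neg_neg]

end IsAlt

namespace IsMetricFrame

variable {φ : Form 4} {A B : Matrix (Fin 8) (Fin 8) ℝ} {σ : Tensor 4}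

/-- Contract the single contraction identity with σ_{ipqr}. The six products of three deltas each
return σ_{ijkl}. The nine terms δΦ form three groups of three equal terms, because σ is cyclic in
its last three indices. -/
lemma insert_contract (h : IsMetricFrame φ A B) (hσ : IsAlt σ) (i j k l : Fin 8) :
    ∑ b, contract φ σ i b * comp φ ![b, j, k, l] = 6 * σ ![i, j, k, l] -
      3 * (pairTensor φ σ ![k, l, i, j] + pairTensor φ σ ![l, j, i, k]
        + pairTensor φ σ ![j, k, i, l]) := by
  have hφ := isAlt_comp φ
  have e1 : ∀ b, comp φ ![b, j, k, l] = - comp φ ![j, k, l, b] := fun b => by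
    rw [hφ.swap01 j b k l, hφ.swap12 j k b l, hφ.swap23 j k l b]; ring
  have e2 : ∀ b p q r, phiUp φ b p q r = - phiUp φ p q r b := fun b p q r => by
    rw [h.phiUp_swap01 p b q r, h.phiUp_swap12 p q b r, h.phiUp_swap23 p q r b]; ring
  have e3 : ∑ b, contract φ σ i b * comp φ ![b, j, k, l] = ∑ p, ∑ q, ∑ r, σ ![i, p, q, r] *
      ∑ b, phiUp φ p q r b * comp φ ![j, k, l, b] := by
    simp only [contract, Matrix.of_apply, Finset.sum_mul, Finset.mul_sum]
    rw [Finset.sum_comm]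
    refine Finset.sum_congr rfl fun p _ => ?_
    rw [Finset.sum_comm]
    refine Finset.sum_congr rfl fun q _ => ?_
    rw [Finset.sum_comm]
    refine Finset.sum_congr rfl fun r _ => Finset.sum_congr rfl fun b _ => ?_
    rw [e1, e2 b]; ring
  set s : Fin 8 → Fin 8 → Fin 8 → ℝ := fun p q r => σ ![i, p, q, r] with hs
  have hc : ∀ p q r, s q r p = s p q r := fun p q r => hσ.rotate_last i p q r
  have d2 : ∀ a (F : Fin 8 → Fin 8 → ℝ), ∑ p, ∑ q, ∑ r, delta q a * (s p q r * F r p) =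
      ∑ q, ∑ r, F q r * s a q r := by
    intro a F
    rw [← sum_delta_first s F a, sum_rotate]
    refine Finset.sum_congr rfl fun p _ => Finset.sum_congr rfl fun q _ =>
      Finset.sum_congr rfl fun r _ => ?_
    rw [hc r p q]
  have d3 : ∀ a (F : Fin 8 → Fin 8 → ℝ), ∑ p, ∑ q, ∑ r, delta r a * (s p q r * F p q) =
      ∑ q, ∑ r, F q r * s a q r := by
    intro a F
    rw [← d2 a F, sum_rotate]
    refine Finset.sum_congr rfl fun p _ => Finset.sum_congr rfl fun q _ =>
      Finset.sum_congr rfl fun r _ => ?_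
    rw [hc r p q]
  have e4 : ∀ p q r, σ ![i, p, q, r] * ∑ b, phiUp φ p q r b * comp φ ![j, k, l, b] =
      delta p j * (delta q k * (delta r l * s p q r))
      - delta p j * (delta q l * (delta r k * s p q r))
      - delta p k * (delta q j * (delta r l * s p q r))
      + delta p k * (delta q l * (delta r j * s p q r))
      + delta p l * (delta q j * (delta r k * s p q r))
      - delta p l * (delta q k * (delta r j * s p q r))
      - delta p j * (s p q r * phi22 φ k l q r) - delta p k * (s p q r * phi22 φ l j q r)
      - delta p l * (s p q r * phi22 φ j k q r)
      - delta q j * (s p q r * phi22 φ k l r p) - delta q k * (s p q r * phi22 φ l j r p)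
      - delta q l * (s p q r * phi22 φ j k r p)
      - delta r j * (s p q r * phi22 φ k l p q) - delta r k * (s p q r * phi22 φ l j p q)
      - delta r l * (s p q r * phi22 φ j k p q) := by
    intro p q r
    rw [h.sum_phiUp_mul_lower]
    simp only [hs]
    ring
  rw [e3]
  simp only [e4, Finset.sum_sub_distrib, Finset.sum_add_distrib, sum_three_delta,
    sum_delta_first s (phi22 φ _ _), d2 _ (phi22 φ _ _), d3 _ (phi22 φ _ _)]
  have s1 : s j l k = - s j k l := hσ.swap23 i j k l
  have s2 : s k j l = - s j k l := hσ.swap12 i j k l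
  have s3 : s k l j = s j k l := hc j k l
  have s4 : s l j k = s j k l := by rw [← hc j k l, ← hc k l j]
  have s5 : s l k j = - s j k l := by
    rw [← s4]; exact hσ.swap23 i l j k
  have t1 : pairTensor φ σ ![k, l, i, j] = ∑ q, ∑ r, phi22 φ k l q r * s j q r := rfl
  have t2 : pairTensor φ σ ![l, j, i, k] = ∑ q, ∑ r, phi22 φ l j q r * s k q r := rfl
  have t3 : pairTensor φ σ ![j, k, i, l] = ∑ q, ∑ r, phi22 φ j k q r * s l q r := rfl
  rw [s1, s2, s3, s4, s5, t1, t2, t3]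
  simp only [hs]
  ring

/-- The three arrangements of indices in `insert_contract` are even permutations of one another, so
after antisymmetrisation they agree and contribute 9 alt(Φσ) = 3 J₄σ. -/
lemma alt_insert_contract (h : IsMetricFrame φ A B) (hσ : IsAlt σ) :
    alt (insertTensor φ (contract φ σ)) = (6 : ℝ) • σ - (3 : ℝ) • J4 φ σ := by
  have e : insertTensor φ (contract φ σ) = (6 : ℝ) • σ - (3 : ℝ) •
      ((fun I => pairTensor φ σ ![I 2, I 3, I 0, I 1]) +
      (fun I => pairTensor φ σ ![I 3, I 1, I 0, I 2]) +
      (fun I => pairTensor φ σ ![I 1, I 2, I 0, I 3])) := by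
    ext I
    have := h.insert_contract hσ (I 0) (I 1) (I 2) (I 3)
    rw [vec4_eta] at this
    exact this
  rw [e, alt_sub, alt_smul, alt_smul, alt_add, alt_add, alt_pair_swap, alt_cycle_three,
    alt_cycle_three', hσ.alt_eq, J4_eq]
  module

lemma J4_of_contract_eq_zero (h : IsMetricFrame φ A B) (hσ : IsAlt σ)
    (h0 : contract φ σ = 0) : J4 φ σ = (2 : ℝ) • σ := by
  have h1 := h.alt_insert_contract hσ
  have h2 : insertTensor φ (contract φ σ) = 0 := by
    ext I; simp [insertTensor, h0]
  have h3 : alt (0 : Tensor 4) = 0 := by ext I; simp [alt]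
  rw [h2, h3] at h1
  ext I
  have := congrFun h1 I
  simp only [Pi.zero_apply, Pi.sub_apply, Pi.smul_apply, smul_eq_mul] at this ⊢
  linarith

/-- By `alt_insert_contract` the contraction M, inserted into Φ, antisymmetrises to zero. Pairing
this with σ itself produces the squared norm of M, and the metric is positive definite. -/
lemma contract_eq_zero_of_J4 (h : IsMetricFrame φ A B) (hσ : IsAlt σ)
    (hJ : J4 φ σ = (2 : ℝ) • σ) : contract φ σ = 0 := by
  set M := contract φ σ with hM
  have h1 : alt (insertTensor φ M) = 0 := by
    rw [h.alt_insert_contract hσ, hJ]; module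
  have h2 := sum_mul_alt (hσ.pull (invMetric φ)) (insertTensor φ M)
  rw [h1] at h2
  simp only [Pi.zero_apply, mul_zero, Finset.sum_const_zero] at h2
  have h3 : ∀ i b, ∑ j, ∑ k, ∑ l, pull (invMetric φ) σ ![i, j, k, l] * comp φ ![b, j, k, l] =
      ∑ i', ∑ b', invMetric φ i' i * metric φ b b' * M i' b' := by
    intro i b
    have e1 : ∀ x y z, ∑ j, ∑ k, ∑ l, invMetric φ x j * (invMetric φ y k * (invMetric φ z l *
        comp φ ![b, j, k, l])) = ∑ b', metric φ b b' * phiUp φ b' x y z := by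
      intro x y z
      simp only [h.lower, h.phiUp_eq]
      rw [h.lowerIndex (m4_lin0 _ _ _), ← h.raise (m4_lin1 _ _ _) x]
      refine Finset.sum_congr rfl fun j _ => ?_
      rw [← h.raise (m4_lin2 _ _ _) y, Finset.mul_sum]
      refine Finset.sum_congr rfl fun k _ => ?_
      rw [← h.raise (m4_lin3 _ _ _) z, Finset.mul_sum, Finset.mul_sum]
    have e2 : ∀ j k l, pull (invMetric φ) σ ![i, j, k, l] * comp φ ![b, j, k, l] =
        ∑ w, ∑ x, ∑ y, ∑ z, invMetric φ w i * (σ ![w, x, y, z] * (invMetric φ x j *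
          (invMetric φ y k * (invMetric φ z l * comp φ ![b, j, k, l])))) := by
      intro j k l
      rw [pull, sum_fin4]
      simp only [Finset.sum_mul, Fin.prod_univ_four]
      refine Finset.sum_congr rfl fun w _ => Finset.sum_congr rfl fun x _ =>
        Finset.sum_congr rfl fun y _ => Finset.sum_congr rfl fun z _ => ?_
      simp only [Matrix.cons_val]
      ring
    simp only [e2]
    rw [sum_comm_three]
    refine Finset.sum_congr rfl fun w _ => ?_
    rw [sum_comm_three]
    trans ∑ x, ∑ y, ∑ z, invMetric φ w i * (σ ![w, x, y, z] *
      ∑ b', metric φ b b' * phiUp φ b' x y z)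
    · refine Finset.sum_congr rfl fun x _ => ?_
      rw [sum_comm_three]
      refine Finset.sum_congr rfl fun y _ => ?_
      rw [sum_comm_three]
      refine Finset.sum_congr rfl fun z _ => ?_
      rw [← e1 x y z]
      simp only [Finset.mul_sum]
    · simp only [hM, contract, Matrix.of_apply, Finset.mul_sum]
      rw [sum_comm_three]
      refine Finset.sum_congr rfl fun b' _ => Finset.sum_congr rfl fun x _ =>
        Finset.sum_congr rfl fun y _ => Finset.sum_congr rfl fun z _ => by ring
  have h4 : (M * metric φ * M.transpose * invMetric φ).trace = 0 := by
    rw [sum_fin4] at h2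
    rw [h2]
    simp only [Matrix.trace, Matrix.diag_apply, Matrix.mul_apply, Matrix.transpose_apply]
    refine Finset.sum_congr rfl fun i _ => ?_
    trans ∑ b, M i b * ∑ j, ∑ k, ∑ l, pull (invMetric φ) σ ![i, j, k, l] * comp φ ![b, j, k, l]
    · simp only [h3, Finset.sum_mul, Finset.mul_sum]
      rw [Finset.sum_congr rfl fun i' _ => Finset.sum_comm, Finset.sum_comm]
      refine Finset.sum_congr rfl fun b _ => Finset.sum_congr rfl fun i' _ =>
        Finset.sum_congr rfl fun b' _ => ?_
      ring
    · simp only [insertTensor, Finset.mul_sum]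
      rw [← sum_comm_three]
      refine Finset.sum_congr rfl fun j _ => Finset.sum_congr rfl fun k _ =>
        Finset.sum_congr rfl fun l _ => Finset.sum_congr rfl fun b _ => ?_
      simp only [Matrix.cons_val]
      ring
  -- With g = AᵀA and G = BBᵀ, the trace tr(M g Mᵀ G) is the squared Frobenius norm of Bᵀ M Aᵀ.
  have h5 : B.transpose * M * A.transpose = 0 := by
    rw [← Matrix.trace_mul_conjTranspose_self_eq_zero_iff]
    rw [h.metric_eq, h.invMetric_eq] at h4
    rw [← h4, Matrix.conjTranspose_eq_transpose_of_trivial]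
    simp only [Matrix.transpose_mul, Matrix.transpose_transpose]
    rw [← Matrix.mul_assoc _ B B.transpose, Matrix.trace_mul_comm _ B.transpose]
    simp only [Matrix.mul_assoc]
  have h6 : A.transpose * B.transpose = 1 := by
    rw [← Matrix.transpose_mul, h.mul_eq_one', Matrix.transpose_one]
  calc M = (A.transpose * B.transpose) * M * (A.transpose * B.transpose) := by
        rw [h6, Matrix.one_mul, Matrix.mul_one]
    _ = A.transpose * (B.transpose * M * A.transpose) * B.transpose := by
        simp only [Matrix.mul_assoc]
    _ = 0 := by rw [h5, Matrix.mul_zero, Matrix.zero_mul]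

/-- The space `Λ⁴₂₇` consists of the 4-forms whose contraction with `Φ` vanishes. -/
lemma inLambda27_iff (h : IsMetricFrame φ A B) (hσ : IsAlt σ) :
    InLambda27 φ σ ↔ contract φ σ = 0 :=
  ⟨fun h' => h.contract_eq_zero_of_J4 hσ h'.2,
    fun h' => ⟨hσ.alt_eq, h.J4_of_contract_eq_zero hσ h'⟩⟩

end IsMetricFrame


/-! ### Symmetric tracefree elements of `Λ²₇ ⊗ Λ²₇` -/

lemma m4_swap02 (u v w z : Space) : m4 w v u z = - m4 u v w z := by
  rw [m4_swap01, m4_swap12, m4_swap01, neg_neg]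

lemma sum_comm_two_two (f : Fin 8 → Fin 8 → Fin 8 → Fin 8 → ℝ) :
    ∑ p, ∑ q, ∑ r, ∑ s, f p q r s = ∑ r, ∑ s, ∑ p, ∑ q, f p q r s := by
  have h : ∀ f : Fin 8 → Fin 8 → Fin 8 → Fin 8 → ℝ, ∑ p, ∑ q, ∑ r, ∑ s, f p q r s =
      ∑ x : Fin 8 × Fin 8, ∑ y : Fin 8 × Fin 8, f x.1 x.2 y.1 y.2 := fun f => by
    simp only [Fintype.sum_prod_type]
  rw [h, Finset.sum_comm, h fun r s p q => f p q r s]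

lemma sum_eq_zero_of_antisymm {f : Fin 8 → Fin 8 → ℝ} (hf : ∀ a b, f b a = - f a b) :
    ∑ a, ∑ b, f a b = 0 := by
  have h : ∑ a, ∑ b, f a b = - ∑ a, ∑ b, f a b := by
    conv_lhs => rw [Finset.sum_comm]
    simp only [← Finset.sum_neg_distrib]
    exact Finset.sum_congr rfl fun a _ => Finset.sum_congr rfl fun b _ => hf a b
  linarith

/-- The octahedron argument for Riemann tensors: add the Bianchi identities started at the four
indices and cancel by antisymmetry. -/
lemma curvature_pair_symm {R : Fin 8 → Fin 8 → Fin 8 → Fin 8 → ℝ}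
    (h1 : ∀ i j k l, R j i k l = - R i j k l) (h2 : ∀ i j k l, R i j l k = - R i j k l)
    (h3 : ∀ i j k l, R i j k l + R i k l j + R i l j k = 0) (i j k l : Fin 8) :
    R k l i j = R i j k l := by
  linarith [h3 i j k l, h3 j k l i, h3 k l i j, h3 l i j k, h1 i j k l, h1 i j l k, h1 i k l j,
    h1 i l j k, h1 j k l i, h1 j l i k, h1 k l i j, h1 k l j i, h2 i j k l, h2 j k l i,
    h2 k l i j, h2 l i j k, h2 i k j l, h2 i l j k, h2 j l i k, h2 j i k l, h2 k i j l,
    h2 l j i k, h2 l k i j, h2 k j i l, h2 j k i l, h2 i k l j, h2 l k j i]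

namespace IsMetricFrame

variable {φ : Form 4} {A B : Matrix (Fin 8) (Fin 8) ℝ} {σ : Tensor 4}

/-- With zero contraction, `insert_contract` says that the cyclic sum of Φσ is 2σ. The cyclic sum of
σ is 3σ, so subtracting (2/3)σ leaves a tensor with the symmetries of a curvature tensor, whose pair
symmetry passes back to Φσ. -/
lemma pairTensor_symm (h : IsMetricFrame φ A B) (hσ : IsAlt σ) (h0 : contract φ σ = 0)
    (i j k l : Fin 8) : pairTensor φ σ ![k, l, i, j] = pairTensor φ σ ![i, j, k, l] := by
  have e1 : ∀ i j k l, pairTensor φ σ ![j, i, k, l] = - pairTensor φ σ ![i, j, k, l] := by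
    intro i j k l
    simp only [pairTensor, ← Finset.sum_neg_distrib]
    refine Finset.sum_congr rfl fun p _ => Finset.sum_congr rfl fun q _ => ?_
    simp only [Matrix.cons_val]
    rw [h.phi22_swap01 i j]; ring
  have e2 : ∀ i j k l, pairTensor φ σ ![i, j, l, k] = - pairTensor φ σ ![i, j, k, l] := by
    intro i j k l
    simp only [pairTensor, ← Finset.sum_neg_distrib]
    refine Finset.sum_congr rfl fun p _ => Finset.sum_congr rfl fun q _ => ?_
    simp only [Matrix.cons_val]
    rw [hσ.swap01 k l]; ring
  have e3 : ∀ i j k l, 2 * σ ![i, j, k, l] = pairTensor φ σ ![k, l, i, j]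
      + pairTensor φ σ ![l, j, i, k] + pairTensor φ σ ![j, k, i, l] := by
    intro i j k l
    have := h.insert_contract hσ i j k l
    simp only [h0, Matrix.zero_apply, zero_mul, Finset.sum_const_zero] at this
    linarith
  have := curvature_pair_symm
    (R := fun i j k l => pairTensor φ σ ![k, l, i, j] - (2 / 3) * σ ![i, j, k, l])
    (fun i j k l => by rw [e2 k l i j, hσ.swap01 i j k l]; ring)
    (fun i j k l => by rw [e1 k l i j, hσ.swap23 i j k l]; ring)
    (fun i j k l => by
      have a1 := hσ.rotate_last i j k l
      have a2 := hσ.rotate_last i k l j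
      linarith [e3 i j k l]) i j k l
  rw [hσ.pair_swap i j k l] at this
  linarith

/-- The double contraction identity gives J₂² = 3 - 2J₂ on 2-forms, so (1 - J₂)/4 is idempotent. -/
lemma proj7_proj7 (h : IsMetricFrame φ A B) {β : Fin 8 → Fin 8 → ℝ}
    (hβ : ∀ i j, β j i = - β i j) (i j : Fin 8) :
    proj7 φ (fun i j => proj7 φ β i j) i j = proj7 φ β i j := by
  have e1 : ∑ p, ∑ q, phi22 φ i j p q * ∑ r, ∑ s, phi22 φ p q r s * β r s =
      12 * β i j - 4 * ∑ r, ∑ s, phi22 φ i j r s * β r s := by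
    trans ∑ r, ∑ s, (∑ p, ∑ q, phi22 φ i j p q * phi22 φ p q r s) * β r s
    · simp only [Finset.mul_sum, Finset.sum_mul]
      rw [sum_comm_two_two]
      refine Finset.sum_congr rfl fun r _ => Finset.sum_congr rfl fun s _ =>
        Finset.sum_congr rfl fun p _ => Finset.sum_congr rfl fun q _ => ?_
      ring
    · simp only [h.sum_phi22_mul_phi22]
      have : ∀ r s, (6 * (delta i r * delta j s - delta i s * delta j r) - 4 * phi22 φ i j r s) *
        β r s = 6 * (delta i r * (delta j s * β r s)) - 6 * (delta i s * (delta j r * β r s))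
          - 4 * (phi22 φ i j r s * β r s) := fun r s => by ring
      simp only [this, Finset.sum_sub_distrib, ← Finset.mul_sum, sum_delta_mul]
      rw [hβ i j]; ring
  have e0 : ∀ i j, ∑ p, ∑ q, phi22 φ i j p q * proj7 φ β p q =
      (1 / 4) * (∑ p, ∑ q, phi22 φ i j p q * β p q) - (1 / 8) *
        ∑ p, ∑ q, phi22 φ i j p q * ∑ r, ∑ s, phi22 φ p q r s * β r s := by
    intro i j
    simp only [proj7, Finset.mul_sum (s := Finset.univ) (a := (1 / 4 : ℝ)),
      Finset.mul_sum (s := Finset.univ) (a := (1 / 8 : ℝ)), ← Finset.sum_sub_distrib]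
    refine Finset.sum_congr rfl fun p _ => Finset.sum_congr rfl fun q _ => ?_
    ring
  rw [proj7, e0, e1, proj7]
  ring

lemma proj7_antisymm (h : IsMetricFrame φ A B) {β : Fin 8 → Fin 8 → ℝ}
    (hβ : ∀ i j, β j i = - β i j) (i j : Fin 8) : proj7 φ β j i = - proj7 φ β i j := by
  simp only [proj7, h.phi22_swap01 i j, hβ i j, neg_mul, Finset.sum_neg_distrib]
  ring

/-- On Λ²₇ the operator J₂ is -3, so contracting a pair with Φ multiplies by -6. -/
lemma psiPhi_eq (h : IsMetricFrame φ A B) {Ψ : Tensor 4} (hΨ : IsSymTracefree7 φ Ψ) :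
    psiPhi φ Ψ = (-6 : ℝ) • alt Ψ := by
  rw [psiPhi, ← alt_smul]
  congr 1
  ext I
  have e1 : ∀ r s, ∑ p, ∑ q, Ψ ![I 0, I 1, r, s] * invMetric φ r p * invMetric φ s q *
      comp φ ![p, q, I 2, I 3] = phi22 φ (I 2) (I 3) r s * Ψ ![I 0, I 1, r, s] := by
    intro r s
    simp only [phi22, Finset.sum_mul]
    refine Finset.sum_congr rfl fun p _ => Finset.sum_congr rfl fun q _ => ?_
    rw [(isAlt_comp φ).pair_swap (I 2) (I 3) p q, h.invMetric_comm r p, h.invMetric_comm s q]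
    ring
  have e2 := hΨ.proj_right (I 0) (I 1) (I 2) (I 3)
  rw [proj7, vec4_eta] at e2
  trans ∑ r, ∑ s, phi22 φ (I 2) (I 3) r s * Ψ ![I 0, I 1, r, s]
  · simp only [← e1]
    exact sum_comm_two_two _
  · simp only [Pi.smul_apply, smul_eq_mul]
    linarith

/-- A 4-form in `Λ⁴₂₇` comes from an element of `Λ²₇ ⊗ Λ²₇`. -/
lemma exists_symTracefree7 (h : IsMetricFrame φ A B) (hσ : IsAlt σ) (h0 : contract φ σ = 0) :
    ∃ Ψ, IsSymTracefree7 φ Ψ ∧ psiPhi φ Ψ = σ := by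
  -- The normalisation is forced: alt(Φσ) = J₄σ/3 = 2σ/3, hence alt Ψ = -(1/4)(σ - σ/3) = -σ/6, and
  -- the factor -6 of `psiPhi_eq` restores σ.
  set Ψ : Tensor 4 := fun I => - proj7 φ (fun i j => σ ![i, j, I 2, I 3]) (I 0) (I 1) with hΨ
  have ev : ∀ a b c d, Ψ ![a, b, c, d] = - proj7 φ (fun i j => σ ![i, j, c, d]) a b :=
    fun _ _ _ _ => rfl
  have hP : Ψ = (- (1 / 4) : ℝ) • (σ - (1 / 2 : ℝ) • pairTensor φ σ) := by
    ext I
    simp only [hΨ, proj7, pairTensor, Pi.smul_apply, Pi.sub_apply, smul_eq_mul, vec4_eta,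
      hσ.pair_swap (I 2) (I 3)]
    ring
  have ev2 : ∀ a b c d, Ψ ![a, b, c, d] =
      - (1 / 4) * (σ ![a, b, c, d] - (1 / 2) * pairTensor φ σ ![a, b, c, d]) := fun a b c d => by
    rw [hP]; rfl
  have hsymm : ∀ a b c d, Ψ ![c, d, a, b] = Ψ ![a, b, c, d] := fun a b c d => by
    rw [ev2, ev2, h.pairTensor_symm hσ h0, hσ.pair_swap a b]
  have hleft : ∀ a b c d, Ψ ![b, a, c, d] = - Ψ ![a, b, c, d] := fun a b c d => by
    rw [ev, ev, h.proj7_antisymm fun i j => hσ.swap01 i j c d]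
  have hpl : ∀ a b c d, proj7 φ (fun i j => Ψ ![i, j, c, d]) a b = Ψ ![a, b, c, d] := by
    intro a b c d
    have := h.proj7_proj7 (fun i j => hσ.swap01 i j c d) a b
    simp only [ev]
    rw [← this]
    simp only [proj7, mul_neg, Finset.sum_neg_distrib]
    ring
  have hS : IsSymTracefree7 φ Ψ := by
    refine ⟨hleft, fun a b c d => ?_, hsymm, ?_, hpl, fun a b c d => ?_⟩
    · rw [← hsymm, hleft, hsymm]
    · have z1 : ∑ a, ∑ b, ∑ c, ∑ d, invMetric φ a c * invMetric φ b d * σ ![a, b, c, d] = 0 := by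
        rw [Finset.sum_congr rfl fun a _ => Finset.sum_comm]
        refine sum_eq_zero_of_antisymm fun a c => ?_
        simp only [← Finset.sum_neg_distrib]
        refine Finset.sum_congr rfl fun b _ => Finset.sum_congr rfl fun d _ => ?_
        rw [h.invMetric_comm c a, hσ.swap01 b c a d, hσ.swap12 b a c d, hσ.swap01 a b c d]
        ring
      -- The full trace of Φσ is the trace of the contraction matrix, which vanishes by assumption.
      have z2 : ∑ a, ∑ b, ∑ c, ∑ d, invMetric φ a c * invMetric φ b d *
          pairTensor φ σ ![a, b, c, d] = ∑ c, contract φ σ c c := by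
        rw [sum_comm_two_two]
        refine Finset.sum_congr rfl fun c _ => ?_
        simp only [contract, Matrix.of_apply, phiUp]
        refine Finset.sum_congr rfl fun d _ => ?_
        simp only [pairTensor, Finset.mul_sum]
        rw [sum_comm_two_two]
        refine Finset.sum_congr rfl fun p _ => Finset.sum_congr rfl fun q _ =>
          Finset.sum_congr rfl fun a _ => Finset.sum_congr rfl fun b _ => ?_
        rw [h.invMetric_comm c a, h.invMetric_comm d b]
        simp only [Matrix.cons_val]
        ring
      rw [h0] at z2
      simp only [Matrix.zero_apply, Finset.sum_const_zero] at z2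
      have e : ∀ a b c d, invMetric φ a c * invMetric φ b d * Ψ ![a, b, c, d] =
          (1 / 8) * (invMetric φ a c * invMetric φ b d * pairTensor φ σ ![a, b, c, d])
          - (1 / 4) * (invMetric φ a c * invMetric φ b d * σ ![a, b, c, d]) := fun a b c d => by
        rw [ev2]; ring
      simp only [e, Finset.sum_sub_distrib, ← Finset.mul_sum, z1, z2]
      ring
    · simp only [fun i j => hsymm i j a b]
      rw [hpl, hsymm]
  refine ⟨Ψ, hS, ?_⟩
  have hJ := h.J4_of_contract_eq_zero hσ h0
  rw [J4_eq] at hJ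
  rw [h.psiPhi_eq hS, hP, alt_smul, alt_sub, alt_smul, hσ.alt_eq]
  ext I
  have := congrFun hJ I
  simp only [Pi.smul_apply, Pi.sub_apply, smul_eq_mul] at this ⊢
  linarith

end IsMetricFrame

/-! ### Elements of Λ²₇ ⊗ Λ²₇ give 4-forms without contraction -/

namespace IsSymTracefree7

variable {φ : Form 4} {Ψ : Tensor 4}

/-- The pair symmetries of Ψ group the 24 permutations into three classes of eight equal terms. -/
lemma alt_eq (h : IsSymTracefree7 φ Ψ) (a b c d : Fin 8) : alt Ψ ![a, b, c, d] =
    (1 / 3) * (Ψ ![a, b, c, d] + Ψ ![a, c, d, b] + Ψ ![a, d, b, c]) := by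
  have L := h.antisymm_left
  have R := h.antisymm_right
  have S := h.symm
  have LR : ∀ a b c d, Ψ ![b, a, d, c] = Ψ ![a, b, c, d] := fun a b c d => by
    rw [L a b, R a b, neg_neg]
  have SL : ∀ a b c d, Ψ ![d, c, a, b] = - Ψ ![a, b, c, d] := fun a b c d => by
    rw [S a b d c, R a b]
  have SR : ∀ a b c d, Ψ ![c, d, b, a] = - Ψ ![a, b, c, d] := fun a b c d => by
    rw [S b a c d, L a b]
  have SLR : ∀ a b c d, Ψ ![d, c, b, a] = Ψ ![a, b, c, d] := fun a b c d => by
    rw [S b a d c, LR]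
  rw [alt_four]
  rw [R a b c d, R a c d b, R a d b c, L a b c d, LR a b c d, S a d b c, SR a d b c, SL a c d b,
    SLR a c d b, LR a c d b, L a c d b, SL a d b c, SLR a d b c, S a b c d, SR a b c d, L a d
    b c, LR a d b c, S a c d b, SR a c d b, SL a b c d, SLR a b c d]
  ring

/-- The contraction `G^{bd} Ψ_{abcd}`. -/
def ricci (φ : Form 4) (Ψ : Tensor 4) (a c : Fin 8) : ℝ :=
  ∑ b, ∑ d, invMetric φ b d * Ψ ![a, b, c, d]

variable {A B : Matrix (Fin 8) (Fin 8) ℝ}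

lemma sum_phi22_left (h : IsSymTracefree7 φ Ψ) (a b c d : Fin 8) :
    ∑ p, ∑ q, phi22 φ a b p q * Ψ ![p, q, c, d] = -6 * Ψ ![a, b, c, d] := by
  have := h.proj_left a b c d
  rw [proj7] at this
  linarith

lemma sum_phi22_right (h : IsSymTracefree7 φ Ψ) (a b c d : Fin 8) :
    ∑ r, ∑ s, phi22 φ c d r s * Ψ ![a, b, r, s] = -6 * Ψ ![a, b, c, d] := by
  have := h.proj_right a b c d
  rw [proj7] at this
  linarith

lemma ricci_comm (hA : IsMetricFrame φ A B) (h : IsSymTracefree7 φ Ψ) (a c : Fin 8) :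
    ricci φ Ψ a c = ricci φ Ψ c a := by
  rw [ricci, ricci, Finset.sum_comm]
  refine Finset.sum_congr rfl fun b _ => Finset.sum_congr rfl fun d _ => ?_
  rw [hA.invMetric_comm, ← h.symm]

/-- The full contraction of `Ψ` with an array. -/
def pair (Ψ : Tensor 4) (F : Fin 8 → Fin 8 → Fin 8 → Fin 8 → ℝ) : ℝ :=
  ∑ p, ∑ q, ∑ r, ∑ s, F p q r s * Ψ ![p, q, r, s]

lemma pair_swap_left (h : IsSymTracefree7 φ Ψ) (F : Fin 8 → Fin 8 → Fin 8 → Fin 8 → ℝ) :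
    pair Ψ (fun p q r s => F q p r s) = - pair Ψ F := by
  simp only [pair, ← Finset.sum_neg_distrib]
  rw [Finset.sum_comm]
  refine Finset.sum_congr rfl fun p _ => Finset.sum_congr rfl fun q _ =>
    Finset.sum_congr rfl fun r _ => Finset.sum_congr rfl fun s _ => ?_
  rw [h.antisymm_left p q]; ring

lemma pair_swap_right (h : IsSymTracefree7 φ Ψ) (F : Fin 8 → Fin 8 → Fin 8 → Fin 8 → ℝ) :
    pair Ψ (fun p q r s => F p q s r) = - pair Ψ F := by
  simp only [pair, ← Finset.sum_neg_distrib]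
  refine Finset.sum_congr rfl fun p _ => Finset.sum_congr rfl fun q _ => ?_
  rw [Finset.sum_comm]
  refine Finset.sum_congr rfl fun r _ => Finset.sum_congr rfl fun s _ => ?_
  rw [h.antisymm_right p q r s]; ring

/-- Bookkeeping for `ricci_eq_zero`: exchanging indices within a pair of Ψ only changes a sign, so
each family of terms of the contraction identity collapses to one representative with its
multiplicity. -/
lemma pair_eq (h : IsSymTracefree7 φ Ψ) (g : ℝ)
    (F1 F2 F3 F4 F5 F6 : Fin 8 → Fin 8 → Fin 8 → Fin 8 → ℝ) :
    pair Ψ (fun p q r s => g * (F1 p q r s - F1 p q s r) - F2 p q r s + F2 q p r s + F2 p q s r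
      - F2 q p s r - g * F3 p q r s - F4 p q r s + F4 p q s r - F5 p q r s + F5 q p r s
      - F6 p q r s + F6 p q s r + F6 q p r s - F6 q p s r) =
    2 * g * pair Ψ F1 - 4 * pair Ψ F2 - g * pair Ψ F3 - 2 * pair Ψ F4 - 2 * pair Ψ F5
      - 4 * pair Ψ F6 := by
  have LR : ∀ F, pair Ψ (fun p q r s => F q p s r) = pair Ψ F := fun F => by
    rw [h.pair_swap_left fun p q r s => F p q s r, h.pair_swap_right, neg_neg]
  have : ∀ F G : Fin 8 → Fin 8 → Fin 8 → Fin 8 → ℝ,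
      pair Ψ (fun p q r s => F p q r s + G p q r s) = pair Ψ F + pair Ψ G := fun F G => by
    simp only [pair, add_mul, Finset.sum_add_distrib]
  have sub : ∀ F G : Fin 8 → Fin 8 → Fin 8 → Fin 8 → ℝ,
      pair Ψ (fun p q r s => F p q r s - G p q r s) = pair Ψ F - pair Ψ G := fun F G => by
    simp only [pair, sub_mul, Finset.sum_sub_distrib]
  have smul : ∀ F : Fin 8 → Fin 8 → Fin 8 → Fin 8 → ℝ,
      pair Ψ (fun p q r s => g * F p q r s) = g * pair Ψ F := fun F => by
    simp only [pair, Finset.mul_sum, mul_assoc]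
  simp only [this, sub, smul]
  linear_combination -LR F2 - LR F6 - g * h.pair_swap_right F1 + h.pair_swap_left F2 + h.pair_swap_right F2
    + h.pair_swap_right F4 + h.pair_swap_left F5 + h.pair_swap_right F6 + h.pair_swap_left F6

/-- Each pair of Ψ may be replaced by -1/6 of its contraction with Φ. Doing this to both pairs turns
the Ricci trace into a single contraction of two copies of Φ, paired with Ψ. The contraction
identity expresses the result through the full trace, which is zero, and the Ricci trace itself with
a different coefficient. -/
lemma ricci_eq_zero (hA : IsMetricFrame φ A B) (h : IsSymTracefree7 φ Ψ) (a c : Fin 8) :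
    ricci φ Ψ a c = 0 := by
  have e1 : 36 * ricci φ Ψ a c = pair Ψ fun p q r s =>
      contractVec (A.transpose a) (B p) (B q) (A.transpose c) (B r) (B s) := by
    have e2 : ∀ b d, 36 * Ψ ![a, b, c, d] = ∑ p, ∑ q, ∑ r, ∑ s,
        phi22 φ a b p q * (phi22 φ c d r s * Ψ ![p, q, r, s]) := by
      intro b d
      simp only [← Finset.mul_sum, h.sum_phi22_right, mul_left_comm _ (-6 : ℝ),
        h.sum_phi22_left]
      ring
    have e3 : 36 * ricci φ Ψ a c = ∑ x : Fin 8 × Fin 8, ∑ y : Fin 8 × Fin 8 × Fin 8 × Fin 8,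
        invMetric φ x.1 x.2 * (phi22 φ a x.1 y.1 y.2.1 * (phi22 φ c x.2 y.2.2.1 y.2.2.2 *
          Ψ ![y.1, y.2.1, y.2.2.1, y.2.2.2])) := by
      simp only [Fintype.sum_prod_type, ← Finset.mul_sum]
      simp only [ricci, Finset.mul_sum (a := (36 : ℝ)), mul_left_comm (36 : ℝ), e2,
        ← Finset.mul_sum]
    rw [e3, Finset.sum_comm]
    simp only [Fintype.sum_prod_type, pair, ← hA.sum_invMetric_phi22_phi22, Finset.sum_mul,
      mul_assoc]
  set g := metric φ a c with hg
  have e2 := h.pair_eq g (fun p q r s => invMetric φ p r * invMetric φ q s)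
    (fun p q r s => delta a r * delta p c * invMetric φ q s)
    (fun p q r s => phiUp φ p q r s)
    (fun p q r s => delta a r * m4 (B p) (B q) (B s) (A.transpose c))
    (fun p q r s => delta p c * m4 (B q) (A.transpose a) (B r) (B s))
    (fun p q r s => invMetric φ p r * m4 (B q) (A.transpose a) (B s) (A.transpose c))
  have f1 : pair Ψ (fun p q r s => invMetric φ p r * invMetric φ q s) = 0 := h.tracefree
  have f2 : pair Ψ (fun p q r s => delta a r * delta p c * invMetric φ q s) =
      ricci φ Ψ c a := by
    simp only [pair, mul_assoc, ← Finset.mul_sum, mul_left_comm _ (delta _ c), sum_delta_mul,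
      sum_delta_mul', ricci]
  -- Contracting Ψ with the fully raised Φ gives -6 times its full trace.
  have f3 : pair Ψ (fun p q r s => phiUp φ p q r s) = 0 := by
    have : ∀ p q, ∑ r, ∑ s, phiUp φ p q r s * Ψ ![p, q, r, s] =
        -6 * ∑ i, ∑ j, invMetric φ p i * invMetric φ q j * Ψ ![p, q, i, j] := by
      intro p q
      simp only [phiUp, Finset.sum_mul, Finset.mul_sum]
      rw [sum_comm_two_two]
      refine Finset.sum_congr rfl fun i _ => Finset.sum_congr rfl fun j _ => ?_
      simp only [mul_assoc, ← Finset.mul_sum, h.sum_phi22_right]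
      ring
    simp only [pair, this, ← Finset.mul_sum, h.tracefree, mul_zero]
  have f4 : pair Ψ (fun p q r s => delta a r * m4 (B p) (B q) (B s) (A.transpose c)) =
      6 * ricci φ Ψ c a := by
    have k1 : ∀ p q s, m4 (B p) (B q) (B s) (A.transpose c) =
        ∑ t, invMetric φ s t * phi22 φ t c p q := fun p q s => by
      rw [← hA.raise (m4_lin2 (B p) (B q) (A.transpose c)) s]
      refine Finset.sum_congr rfl fun t _ => ?_
      rw [hA.phi22_eq, ← m4_pair_swap]
    simp only [pair, mul_assoc, ← Finset.mul_sum, sum_delta_mul, k1, Finset.sum_mul]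
    rw [sum_comm_two_two]
    simp only [← Finset.mul_sum, h.sum_phi22_left, ricci]
    simp only [Finset.mul_sum]
    rw [Finset.sum_comm]
    refine Finset.sum_congr rfl fun s _ => Finset.sum_congr rfl fun t _ => ?_
    rw [h.antisymm_left, hA.invMetric_comm]; ring
  have f5 : pair Ψ (fun p q r s => delta p c * m4 (B q) (A.transpose a) (B r) (B s)) =
      6 * ricci φ Ψ c a := by
    have k1 : ∀ q r s, m4 (B q) (A.transpose a) (B r) (B s) =
        ∑ t, invMetric φ q t * phi22 φ t a r s := fun q r s => by
      rw [← hA.raise (m4_lin0 (A.transpose a) (B r) (B s)) q]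
      refine Finset.sum_congr rfl fun t _ => ?_
      rw [hA.phi22_eq]
    simp only [pair, mul_assoc, ← Finset.mul_sum, sum_delta_mul', k1, Finset.sum_mul]
    have k2 : ∀ q, ∑ r, ∑ s, ∑ t, invMetric φ q t * (phi22 φ t a r s * Ψ ![c, q, r, s]) =
        ∑ t, ∑ r, ∑ s, invMetric φ q t * (phi22 φ t a r s * Ψ ![c, q, r, s]) := fun q => by
      rw [sum_rotate, sum_rotate]
    simp only [k2, ← Finset.mul_sum, h.sum_phi22_right, ricci]
    simp only [Finset.mul_sum]
    refine Finset.sum_congr rfl fun s _ => Finset.sum_congr rfl fun t _ => ?_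
    rw [h.antisymm_right]; ring
  -- The coefficient is antisymmetric in q and s, while the Ricci trace is symmetric.
  have f6 : pair Ψ (fun p q r s => invMetric φ p r *
      m4 (B q) (A.transpose a) (B s) (A.transpose c)) = 0 := by
    have k1 : pair Ψ (fun p q r s => invMetric φ p r *
        m4 (B q) (A.transpose a) (B s) (A.transpose c)) = ∑ q, ∑ s,
          m4 (B q) (A.transpose a) (B s) (A.transpose c) * ricci φ Ψ q s := by
      simp only [pair, ricci, Finset.mul_sum]
      rw [Finset.sum_comm]
      refine Finset.sum_congr rfl fun q _ => ?_
      rw [sum_rotate, sum_rotate]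
      refine Finset.sum_congr rfl fun s _ => Finset.sum_congr rfl fun p _ =>
        Finset.sum_congr rfl fun r _ => ?_
      rw [h.antisymm_left q p, h.antisymm_right q p s r]; ring
    rw [k1]
    refine sum_eq_zero_of_antisymm fun q s => ?_
    rw [ricci_comm hA h s q, m4_swap02]; ring
  -- What survives is (-4 - 2·6 - 2·6) Ric = -28 Ric, against 36 Ric on the left.
  rw [f1, f2, f3, f4, f5, f6, ricci_comm hA h c a] at e2
  have e4 : (fun p q r s =>
      contractVec (A.transpose a) (B p) (B q) (A.transpose c) (B r) (B s)) = _ :=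
    funext fun p => funext fun q => funext fun r => funext fun s => by
      rw [contractVec, m4_swap23 (B p) (B q) (B r), m4_swap23 (B q) _ (B r),
        m4_swap01 (B p) (A.transpose a), m4_swap01 (B p) (A.transpose a),
        m4_swap01 (B p) (A.transpose a), m4_swap23 (B p) (A.transpose a) (B r),
        hA.dot_col_col, hA.dot_col_row, hA.dot_col_row, hA.dot_row_col, hA.dot_row_col,
        hA.dot_row_row, hA.dot_row_row, hA.dot_row_row, hA.dot_row_row, ← hA.phiUp_eq]
  have e5 : ∀ F G : Fin 8 → Fin 8 → Fin 8 → Fin 8 → ℝ, (∀ p q r s, F p q r s = G p q r s) →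
      pair Ψ F = pair Ψ G := fun F G hFG =>
    congrArg (pair Ψ) (funext fun p => funext fun q => funext fun r => funext fun s => hFG p q r s)
  have e6 : 36 * ricci φ Ψ a c = _ := e1.trans (((congrArg (pair Ψ) e4).trans
    (e5 _ _ fun p q r s => by ring)).trans e2)
  linarith

/-- Up to a factor, ΨΦ is the cyclic sum of Ψ. As Φ^{bpqr} is cyclic in p, q, r, the three terms
contract to the same quantity, and that is a multiple of the raised Ricci trace. -/
lemma contract_psiPhi (h : IsSymTracefree7 φ Ψ) (hA : IsMetricFrame φ A B) :
    contract φ (psiPhi φ Ψ) = 0 := by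
  ext i b
  have e0 : ∀ p q r, psiPhi φ Ψ ![i, p, q, r] =
      -2 * (Ψ ![i, p, q, r] + Ψ ![i, q, r, p] + Ψ ![i, r, p, q]) := fun p q r => by
    rw [hA.psiPhi_eq h, Pi.smul_apply, h.alt_eq, smul_eq_mul]; ring
  have e1 : ∑ p, ∑ q, ∑ r, Ψ ![i, p, q, r] * phiUp φ b p q r = 0 := by
    have k1 : ∀ p q r, phiUp φ b p q r = ∑ s, ∑ t, invMetric φ b t * invMetric φ p s *
        phi22 φ t s q r := fun p q r => by rw [phiUp, Finset.sum_comm]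
    have k2 : ∀ p, ∑ q, ∑ r, Ψ ![i, p, q, r] * phiUp φ b p q r =
        -6 * ∑ s, ∑ t, invMetric φ b t * invMetric φ p s * Ψ ![i, p, t, s] := by
      intro p
      simp only [k1, Finset.mul_sum]
      rw [sum_comm_two_two]
      refine Finset.sum_congr rfl fun s _ => Finset.sum_congr rfl fun t _ => ?_
      simp only [mul_left_comm (Ψ _), ← Finset.mul_sum, mul_comm (Ψ _), mul_assoc,
        h.sum_phi22_right]
      ring
    have k3 : ∑ p, ∑ s, ∑ t, invMetric φ b t * invMetric φ p s * Ψ ![i, p, t, s] =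
        ∑ t, invMetric φ b t * ricci φ Ψ i t := by
      simp only [ricci, Finset.mul_sum]
      rw [sum_rotate, sum_rotate]
      refine Finset.sum_congr rfl fun t _ => Finset.sum_congr rfl fun p _ =>
        Finset.sum_congr rfl fun s _ => ?_
      ring
    simp only [k2, ← Finset.mul_sum, k3, h.ricci_eq_zero hA, mul_zero, Finset.sum_const_zero]
  have e2 : ∑ p, ∑ q, ∑ r, Ψ ![i, q, r, p] * phiUp φ b p q r = 0 := by
    rw [sum_rotate, ← e1]
    refine Finset.sum_congr rfl fun t _ => Finset.sum_congr rfl fun p _ =>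
        Finset.sum_congr rfl fun s _ => ?_
    rw [hA.phiUp_swap12, hA.phiUp_swap23, neg_neg]
  have e3 : ∑ p, ∑ q, ∑ r, Ψ ![i, r, p, q] * phiUp φ b p q r = 0 := by
    rw [sum_rotate, sum_rotate, ← e1]
    refine Finset.sum_congr rfl fun t _ => Finset.sum_congr rfl fun p _ =>
        Finset.sum_congr rfl fun s _ => ?_
    rw [hA.phiUp_swap23, hA.phiUp_swap12, neg_neg]
  simp only [contract, Matrix.of_apply, e0, mul_assoc, add_mul, Finset.sum_add_distrib,
    ← Finset.mul_sum, e1, e2, e3, Matrix.zero_apply]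
  ring

end IsSymTracefree7


/-! ### The first variation of the Lagrangian -/

/-- The tensor is already antisymmetric in its last three indices, so the 24 terms depend, up to
sign, only on which index is inserted. Four groups of six give the factor 1/4. -/
lemma alt_insert {t : Tensor 4} (ht : IsAlt t) (M : Matrix (Fin 8) (Fin 8) ℝ) :
    alt (fun I => ∑ b, M (I 0) b * t ![b, I 1, I 2, I 3]) = (1 / 4 : ℝ) • act M.transpose t := by
  set u : Tensor 4 := fun I => ∑ b, M (I 0) b * t ![b, I 1, I 2, I 3] with hu
  have e : ∀ a b c d, alt (u) ![a, b, c, d] =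
      ((1 / 4 : ℝ) • act M.transpose t) ![a, b, c, d] := by
    intro a b c d
    have i1 : ∀ a b c d, u ![a, b, c, d] =
        ∑ p, M a p * t ![p, b, c, d] := fun _ _ _ _ => rfl
    have s1 : ∀ a b c d, u ![a, c, b, d] = - u ![a, b, c, d] := by
      intro a b c d
      simp only [i1, ← Finset.sum_neg_distrib]
      exact Finset.sum_congr rfl fun p _ => by rw [ht.swap12]; ring
    have s2 : ∀ a b c d, u ![a, b, d, c] = - u ![a, b, c, d] := by
      intro a b c d
      simp only [i1, ← Finset.sum_neg_distrib]
      exact Finset.sum_congr rfl fun p _ => by rw [ht.swap23]; ring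
    have j1 : ∑ p, M.transpose p b * t ![a, p, c, d] = - u ![b, a, c, d] := by
      simp only [i1, ← Finset.sum_neg_distrib]
      exact Finset.sum_congr rfl fun p _ => by
        rw [ht.swap01 p a, Matrix.transpose_apply]; ring
    have j2 : ∑ p, M.transpose p c * t ![a, b, p, d] = u ![c, a, b, d] := by
      simp only [i1]
      exact Finset.sum_congr rfl fun p _ => by
        rw [ht.swap12 a p b, ht.swap01 p a, Matrix.transpose_apply]; ring
    have j3 : ∑ p, M.transpose p d * t ![a, b, c, p] = - u ![d, a, b, c] := by
      simp only [i1, ← Finset.sum_neg_distrib]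
      exact Finset.sum_congr rfl fun p _ => by
        rw [ht.swap23 a b p c, ht.swap12 a p b, ht.swap01 p a, Matrix.transpose_apply]; ring
    have j0 : ∑ p, M.transpose p a * t ![p, b, c, d] = u ![a, b, c, d] := rfl
    rw [alt_four, Pi.smul_apply, act_four, j0, j1, j2, j3, smul_eq_mul]
    linarith [s1 a b c d, s2 a b c d, s1 a b d c, s2 a c b d, s2 a d b c, s1 a c d b,
      s1 b a c d, s2 b a c d, s1 b a d c, s2 b c a d, s2 b d a c, s1 b c d a,
      s1 c a b d, s2 c a b d, s1 c a d b, s2 c b a d, s2 c d a b, s1 c b d a,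
      s1 d a b c, s2 d a b c, s1 d a c b, s2 d b a c, s2 d c a b, s1 d b c a]
  ext I
  rw [← vec4_eta I]
  exact e _ _ _ _

lemma alt_insertTensor (φ : Form 4) (M : Matrix (Fin 8) (Fin 8) ℝ) :
    alt (insertTensor φ M) = (1 / 4 : ℝ) • act M.transpose (comp φ) :=
  alt_insert (isAlt_comp φ) M

/-- K(M) is the tangent vector to the orbit of Φ in the direction (MG)ᵀ, so its contraction is a
case of `contract_act`. -/
lemma K_eq (φ : Form 4) (M : Matrix (Fin 8) (Fin 8) ℝ) :
    K φ M = act (M * invMetric φ).transpose (comp φ) := by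
  have : (fun I : Fin 4 → Fin 8 => ∑ p, M (I 0) p * phi13 φ p (I 1) (I 2) (I 3)) =
      insertTensor φ (M * invMetric φ) := by
    ext I
    simp only [insertTensor, Matrix.mul_apply, phi13, Finset.mul_sum, Finset.sum_mul]
    rw [Finset.sum_comm]
    exact Finset.sum_congr rfl fun _ _ => Finset.sum_congr rfl fun _ _ => by ring
  rw [K, this, alt_insertTensor, smul_smul]
  norm_num

/-- `Q_{pq} = Φ^{ijkl} γ_{ijp} γ_{klq}`. -/
def quad (φ : Form 4) (γ : Form 3) : Matrix (Fin 8) (Fin 8) ℝ := Matrix.of fun p q =>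
  ∑ i, ∑ j, ∑ k, ∑ l, phiUp φ i j k l * comp γ ![i, j, p] * comp γ ![k, l, q]

/-- The form `γ_{[ab}^p γ_{cd]p}` for an index raised with a given matrix. -/
def wedgeWith (G : Matrix (Fin 8) (Fin 8) ℝ) (γ : Form 3) : Tensor 4 :=
  alt (fun I => ∑ p, ∑ q, G p q * comp γ ![I 0, I 1, p] * comp γ ![I 2, I 3, q])

lemma contract_add (φ : Form 4) (σ τ : Tensor 4) :
    contract φ (σ + τ) = contract φ σ + contract φ τ := by
  ext i b
  simp [contract, add_mul, Finset.sum_add_distrib]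

lemma contract_smul (φ : Form 4) (c : ℝ) (σ : Tensor 4) :
    contract φ (c • σ) = c • contract φ σ := by
  ext i b
  simp [contract, Finset.mul_sum, mul_assoc]

lemma contract_sub (φ : Form 4) (σ τ : Tensor 4) :
    contract φ (σ - τ) = contract φ σ - contract φ τ := by
  ext i b
  simp [contract, sub_mul, Finset.sum_sub_distrib]

/-- The derivative of `topWedge Φ (dC - 6 C ∧_Φ C) + (lam/84) topWedge Φ Φ` along the velocity `η`
of `Φ` and the velocity `H` of the inverse metric; `σ` stands for `dC - 6 C ∧_Φ C`. -/
def firstVariation (lam : ℝ) (φ : Form 4) (γ : Form 3) (σ η : Tensor 4)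
    (H : Matrix (Fin 8) (Fin 8) ℝ) : ℝ :=
  topWedge η σ - 6 * topWedge (comp φ) (wedgeWith H γ)
    + lam / 84 * (topWedge η (comp φ) + topWedge (comp φ) η)

/-- The matrix paired with `X` in the first variation along `X`. -/
def gradient (lam : ℝ) (φ : Form 4) (γ : Form 3) (σ : Tensor 4) : Matrix (Fin 8) (Fin 8) ℝ :=
  ((contract φ σ).trace + 4 * lam) • (1 : Matrix (Fin 8) (Fin 8) ℝ) - (4 : ℝ) • contract φ σ
    + (12 : ℝ) • (quad φ γ * invMetric φ)

/-- `σ - (1/8) K(TT) + (lam/42) Φ`. -/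
def fieldExpr (lam : ℝ) (φ : Form 4) (γ : Form 3) (σ : Tensor 4) : Tensor 4 :=
  σ - (1 / 8 : ℝ) • K φ (quadMatrix φ γ) + (lam / 42) • comp φ

namespace IsMetricFrame

variable {φ : Form 4} {A B : Matrix (Fin 8) (Fin 8) ℝ} {σ : Tensor 4}

/-- 42 = 6 · (8 - 1): the double contraction identity is traced once more, and its term in Φ has no
trace. -/
lemma contract_comp (h : IsMetricFrame φ A B) :
    contract φ (comp φ) = (42 : ℝ) • (1 : Matrix (Fin 8) (Fin 8) ℝ) := by
  ext i b
  have e : ∀ p, ∑ q, ∑ r, comp φ ![i, p, q, r] * phiUp φ b p q r =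
      6 * (delta b i * delta p p - delta b p * delta p i) - 4 * phi22 φ i p b p := fun p => by
    rw [← h.sum_phiUp_mul_lower_two]
    exact Finset.sum_congr rfl fun _ _ => Finset.sum_congr rfl fun _ _ => mul_comm _ _
  simp only [contract, Matrix.of_apply, e, Finset.sum_sub_distrib, ← Finset.mul_sum,
    h.sum_phi22_trace, sum_delta_mul]
  simp only [delta, if_true, Finset.sum_const, Finset.card_univ, Fintype.card_fin,
    Matrix.smul_apply, Matrix.one_apply, smul_eq_mul, eq_comm (a := b)]
  split_ifs <;> norm_num

/-- When X acts on the free index i, `contract_comp` gives 42 X. The other three slots contribute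
equally by antisymmetry, each the value S given by the double contraction identity. -/
lemma contract_act (h : IsMetricFrame φ A B) (X : Matrix (Fin 8) (Fin 8) ℝ) (i b : Fin 8) :
    contract φ (act X (comp φ)) i b = 24 * X b i + 18 * X.trace * delta b i
      - 12 * ∑ j, ∑ a, X a j * phi22 φ i a b j := by
  have hφ := isAlt_comp φ
  set S : ℝ := ∑ j, ∑ k, ∑ l, (∑ a, X a j * comp φ ![i, a, k, l]) * phiUp φ b j k l with hS
  have e0 : ∑ j, ∑ k, ∑ l, (∑ a, X a i * comp φ ![a, j, k, l]) * phiUp φ b j k l =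
      42 * X b i := by
    have : ∀ a, contract φ (comp φ) a b = 42 * delta a b := fun a => by
      rw [h.contract_comp, Matrix.smul_apply, Matrix.one_apply, smul_eq_mul, delta]
    simp only [Finset.sum_mul]
    rw [sum_comm_three]
    simp only [mul_assoc, ← Finset.mul_sum]
    simp only [contract, Matrix.of_apply] at this
    simp only [this, mul_left_comm _ (42 : ℝ), ← Finset.mul_sum, mul_comm (X _ i),
      sum_delta_mul']
  have e2 : ∑ j, ∑ k, ∑ l, (∑ a, X a k * comp φ ![i, j, a, l]) * phiUp φ b j k l = S := by
    rw [hS]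
    refine Finset.sum_comm.trans (Finset.sum_congr rfl fun k _ => Finset.sum_congr rfl fun j _ =>
      Finset.sum_congr rfl fun l _ => ?_)
    simp only [fun a => hφ.swap12 i a j l, h.phiUp_swap12 b k j l, mul_neg,
      Finset.sum_neg_distrib, neg_mul, neg_neg]
  have e3 : ∑ j, ∑ k, ∑ l, (∑ a, X a l * comp φ ![i, j, k, a]) * phiUp φ b j k l = S := by
    rw [hS, sum_rotate, sum_rotate]
    refine Finset.sum_congr rfl fun k _ => Finset.sum_congr rfl fun j _ =>
      Finset.sum_congr rfl fun l _ => ?_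
    simp only [fun a => hφ.swap23 i j a l, fun a => hφ.swap12 i a j l, h.phiUp_swap23 b j k l,
      h.phiUp_swap12 b k j l, neg_neg]
  have e1 : S = 6 * X.trace * delta b i - 6 * X b i - 4 * ∑ j, ∑ a, X a j * phi22 φ i a b j := by
    have k1 : ∀ j, ∑ k, ∑ l, (∑ a, X a j * comp φ ![i, a, k, l]) * phiUp φ b j k l =
        ∑ a, X a j * (6 * (delta b i * delta j a - delta b a * delta j i)
          - 4 * phi22 φ i a b j) := by
      intro j
      simp only [← h.sum_phiUp_mul_lower_two, Finset.sum_mul, Finset.mul_sum]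
      rw [sum_rotate, sum_rotate]
      exact Finset.sum_congr rfl fun a _ => Finset.sum_congr rfl fun k _ =>
        Finset.sum_congr rfl fun l _ => by ring
    have k2 : ∀ j a, X a j * (6 * (delta b i * delta j a - delta b a * delta j i)
          - 4 * phi22 φ i a b j) = 6 * delta b i * (delta j a * X a j)
          - 6 * (delta j i * (delta b a * X a j)) - 4 * (X a j * phi22 φ i a b j) :=
      fun j a => by ring
    simp only [hS, k1, k2, Finset.sum_sub_distrib, ← Finset.mul_sum, sum_delta_mul,
      sum_delta_mul', Matrix.trace, Matrix.diag_apply]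
    ring
  simp only [contract, Matrix.of_apply, act_four, add_mul, Finset.sum_add_distrib, e0, e2, e3]
  rw [← hS, e1]
  ring

/-- For symmetric M the last term of `contract_act` pairs M with an antisymmetric tensor and drops
out. -/
lemma contract_K (h : IsMetricFrame φ A B) {M : Matrix (Fin 8) (Fin 8) ℝ}
    (hM : ∀ i j, M i j = M j i) : contract φ (K φ M) =
      (24 : ℝ) • (M * invMetric φ) +
        (18 * (M * invMetric φ).trace) • (1 : Matrix (Fin 8) (Fin 8) ℝ) := by
  ext i b
  have e : ∑ j, ∑ a, (M * invMetric φ).transpose a j * phi22 φ i a b j = 0 := by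
    have k1 : ∀ j, ∑ a, (M * invMetric φ).transpose a j * phi22 φ i a b j =
        ∑ p, M j p * m4 (A.transpose i) (B p) (B b) (B j) := by
      intro j
      simp only [Matrix.transpose_apply, Matrix.mul_apply, Finset.sum_mul]
      rw [Finset.sum_comm]
      refine Finset.sum_congr rfl fun p _ => ?_
      rw [← h.raise (m4_lin1 (A.transpose i) (B b) (B j)) p, Finset.mul_sum]
      exact Finset.sum_congr rfl fun a _ => by rw [h.phi22_eq]; ring
    simp only [k1]
    refine sum_eq_zero_of_antisymm fun j p => ?_
    rw [hM p j, m4_swap12, m4_swap23, m4_swap12]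
    ring
  rw [K_eq, h.contract_act, e, Matrix.trace_transpose]
  simp only [Matrix.transpose_apply, Matrix.add_apply, Matrix.smul_apply, Matrix.one_apply,
    smul_eq_mul, delta, eq_comm (a := b)]
  ring

lemma quad_symm (h : IsMetricFrame φ A B) (γ : Form 3) (p q : Fin 8) :
    quad φ γ p q = quad φ γ q p := by
  simp only [quad, Matrix.of_apply]
  rw [sum_comm_two_two]
  refine Finset.sum_congr rfl fun k _ => Finset.sum_congr rfl fun l _ =>
    Finset.sum_congr rfl fun i _ => Finset.sum_congr rfl fun j _ => ?_
  rw [h.phiUp_eq, h.phiUp_eq, m4_pair_swap]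
  ring

lemma quadMatrix_eq (h : IsMetricFrame φ A B) (γ : Form 3) :
    quadMatrix φ γ = quad φ γ - ((1 / 7) * (quad φ γ * invMetric φ).trace) • metric φ := by
  have e : (quad φ γ * invMetric φ).trace = ∑ i, ∑ j, ∑ k, ∑ l, ∑ p, ∑ q,
      phiUp φ i j k l * invMetric φ p q * comp γ ![i, j, p] * comp γ ![k, l, q] := by
    have : ∀ f : Fin 8 → Fin 8 → Fin 8 → Fin 8 → Fin 8 → Fin 8 → ℝ,
        ∑ p, ∑ q, ∑ i, ∑ j, ∑ k, ∑ l, f i j k l p q =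
          ∑ i, ∑ j, ∑ k, ∑ l, ∑ p, ∑ q, f i j k l p q := by
      intro f
      have := Finset.sum_comm (s := Finset.univ) (t := Finset.univ)
        (f := fun (x : Fin 8 × Fin 8) (y : Fin 8 × Fin 8 × Fin 8 × Fin 8) =>
          f y.1 y.2.1 y.2.2.1 y.2.2.2 x.1 x.2)
      simpa only [Fintype.sum_prod_type] using this
    rw [← this]
    simp only [Matrix.trace, Matrix.diag_apply, Matrix.mul_apply, quad, Matrix.of_apply,
      Finset.sum_mul]
    refine Finset.sum_congr rfl fun p _ => Finset.sum_congr rfl fun q _ =>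
      Finset.sum_congr rfl fun k _ => Finset.sum_congr rfl fun l _ =>
      Finset.sum_congr rfl fun i _ => Finset.sum_congr rfl fun j _ => ?_
    rw [h.invMetric_comm q p]
    ring
  ext a b
  simp only [quadMatrix, Matrix.of_apply, ← e, Matrix.sub_apply, Matrix.smul_apply, smul_eq_mul]
  rw [quad, Matrix.of_apply]
  ring

/-- Here the constants of the field equation are fixed. With Q the raised quadratic matrix, the
coefficients 1/8 and 1/7 make K(TT)/8 contract to 3Q - (3/4) tr(Q)·1, and lam/42 times Φ contracts
to lam. Then tr(N)·1 - 4N has no tr(Q), and lam appears with coefficient 8 - 4 = 4. -/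
lemma gradient_eq (h : IsMetricFrame φ A B) (lam : ℝ) (γ : Form 3) (σ : Tensor 4) :
    gradient lam φ γ σ = (contract φ (fieldExpr lam φ γ σ)).trace • 1
      - (4 : ℝ) • contract φ (fieldExpr lam φ γ σ) := by
  have hs : ∀ i j, quadMatrix φ γ i j = quadMatrix φ γ j i := fun i j => by
    rw [h.quadMatrix_eq, Matrix.sub_apply, Matrix.sub_apply, Matrix.smul_apply, Matrix.smul_apply,
      h.quad_symm, h.metric_comm]
  have hq : quadMatrix φ γ * invMetric φ = quad φ γ * invMetric φ -
      ((1 / 7) * (quad φ γ * invMetric φ).trace) • 1 := by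
    rw [h.quadMatrix_eq, Matrix.sub_mul, Matrix.smul_mul, h.metric_mul_inv]
  have hc : contract φ (fieldExpr lam φ γ σ) = contract φ σ
      - (3 : ℝ) • (quad φ γ * invMetric φ)
      + ((3 / 4) * (quad φ γ * invMetric φ).trace + lam) • 1 := by
    rw [fieldExpr, contract_add, contract_sub, contract_smul, contract_smul, h.contract_K hs,
      h.contract_comp, hq]
    simp only [Matrix.trace_sub, Matrix.trace_smul, Matrix.trace_one, Fintype.card_fin,
      smul_eq_mul, smul_add, smul_sub, smul_smul]
    module
  rw [hc]
  simp only [Matrix.trace_add, Matrix.trace_sub, Matrix.trace_smul, Matrix.trace_one,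
    Fintype.card_fin, smul_eq_mul, gradient]
  module

/-- The map N ↦ tr(N)·1 - 4N multiplies traces by 8 - 4 = 4, so its kernel is trivial. -/
lemma gradient_eq_zero_iff (h : IsMetricFrame φ A B) (lam : ℝ) (γ : Form 3) (σ : Tensor 4) :
    gradient lam φ γ σ = 0 ↔ contract φ (fieldExpr lam φ γ σ) = 0 := by
  rw [h.gradient_eq]
  constructor
  · intro h0
    have ht := congrArg Matrix.trace h0
    simp only [Matrix.trace_sub, Matrix.trace_smul, Matrix.trace_one, Fintype.card_fin,
      smul_eq_mul, Matrix.trace_zero] at ht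
    have ht' : (contract φ (fieldExpr lam φ γ σ)).trace = 0 := by push_cast at ht; linarith
    rw [ht', zero_smul, zero_sub, neg_eq_zero] at h0
    exact (smul_eq_zero.1 h0).resolve_left (by norm_num)
  · intro h0
    simp [h0]

lemma topWedge_alt (h : IsMetricFrame φ A B) (t : Tensor 4) : topWedge (comp φ) (alt t) =
    A.det * ((1 / 24) * ∑ i, ∑ j, ∑ k, ∑ l, phiUp φ i j k l * t ![i, j, k, l]) := by
  rw [h.topWedge_eq (isAlt_alt t), sum_mul_alt ((isAlt_comp modelCayley).pull _)]
  simp only [← h.phiUp_eq_sum, sum_fin4]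
  rfl

lemma topWedge_act_right (h : IsMetricFrame φ A B) (hσ : IsAlt σ)
    (X : Matrix (Fin 8) (Fin 8) ℝ) : topWedge (comp φ) (act X σ) =
      A.det / 6 * ∑ p, ∑ a, X p a * contract φ σ p a := by
  have e : act X σ = (4 : ℝ) • alt (fun I => ∑ b, X.transpose (I 0) b *
      σ ![b, I 1, I 2, I 3]) := by
    rw [alt_insert hσ, smul_smul, Matrix.transpose_transpose]
    norm_num
  have e1 : ∑ i, ∑ j, ∑ k, ∑ l, phiUp φ i j k l * ∑ b, X b i * σ ![b, j, k, l] =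
      ∑ p, ∑ a, X p a * contract φ σ p a := by
    simp only [Finset.mul_sum, contract, Matrix.of_apply]
    refine (Finset.sum_congr rfl fun i _ => sum_comm_three _).trans ?_
    rw [Finset.sum_comm]
    exact Finset.sum_congr rfl fun p _ => Finset.sum_congr rfl fun a _ =>
      Finset.sum_congr rfl fun i _ => Finset.sum_congr rfl fun j _ =>
      Finset.sum_congr rfl fun k _ => by ring
  rw [e, topWedge_smul_right, h.topWedge_alt]
  simp only [Matrix.transpose_apply, Matrix.cons_val, e1]
  ring

lemma topWedge_wedgeWith (h : IsMetricFrame φ A B) (H : Matrix (Fin 8) (Fin 8) ℝ) (γ : Form 3) :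
    topWedge (comp φ) (wedgeWith H γ) = A.det / 24 * ∑ p, ∑ q, H p q * quad φ γ p q := by
  have e : ∑ i, ∑ j, ∑ k, ∑ l, phiUp φ i j k l *
      ∑ p, ∑ q, H p q * comp γ ![i, j, p] * comp γ ![k, l, q] =
      ∑ p, ∑ q, H p q * quad φ γ p q := by
    simp only [quad, Matrix.of_apply, Finset.mul_sum]
    have := Finset.sum_comm (s := Finset.univ) (t := Finset.univ)
        (f := fun (y : Fin 8 × Fin 8 × Fin 8 × Fin 8) (x : Fin 8 × Fin 8) =>
          phiUp φ y.1 y.2.1 y.2.2.1 y.2.2.2 * (H x.1 x.2 * comp γ ![y.1, y.2.1, x.1] *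
            comp γ ![y.2.2.1, y.2.2.2, x.2]))
    simp only [Fintype.sum_prod_type] at this
    rw [this]
    refine Finset.sum_congr rfl fun p _ => Finset.sum_congr rfl fun q _ =>
      Finset.sum_congr rfl fun k _ => Finset.sum_congr rfl fun l _ =>
      Finset.sum_congr rfl fun i _ => Finset.sum_congr rfl fun j _ => by ring
  rw [wedgeWith, h.topWedge_alt]
  simp only [Matrix.cons_val, e]
  ring

lemma topWedge_eq_trace (h : IsMetricFrame φ A B) (hσ : IsAlt σ) :
    topWedge (comp φ) σ = A.det / 24 * (contract φ σ).trace := by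
  rw [h.topWedge_eq_sum hσ]
  simp only [Matrix.trace, Matrix.diag_apply, contract, Matrix.of_apply, mul_comm (phiUp _ _ _ _ _)]
  ring

/-- By `topWedge_act` the term with X acting on Φ becomes a trace minus the term with X acting on σ,
which is a contraction. The metric velocity pairs with Q twice, by symmetry, and the volume term
contributes lam/6 · tr X = 4 lam/24 · tr X. -/
lemma firstVariation_act (h : IsMetricFrame φ A B) (hσ : IsAlt σ) (lam : ℝ) (γ : Form 3)
    (X : Matrix (Fin 8) (Fin 8) ℝ) :
    firstVariation lam φ γ σ (act X (comp φ))
      (-(X * invMetric φ + invMetric φ * X.transpose)) =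
      A.det / 24 * ∑ p, ∑ r, X p r * gradient lam φ γ σ p r := by
  have e1 := topWedge_act X (comp φ) σ
  have e2 := topWedge_act X (comp φ) (comp φ)
  have e3 : topWedge (comp φ) (comp φ) = 14 * A.det := by
    rw [h.topWedge_eq_trace (isAlt_comp φ), h.contract_comp, Matrix.trace_smul, Matrix.trace_one,
      Fintype.card_fin, smul_eq_mul]
    push_cast; ring
  have e4 : ∑ p, ∑ q, (-(X * invMetric φ + invMetric φ * X.transpose)) p q * quad φ γ p q =
      -2 * ∑ p, ∑ r, X p r * (quad φ γ * invMetric φ) p r := by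
    have k1 : ∑ p, ∑ q, (invMetric φ * X.transpose) p q * quad φ γ p q =
        ∑ p, ∑ q, (X * invMetric φ) p q * quad φ γ p q := by
      rw [Finset.sum_comm]
      refine Finset.sum_congr rfl fun p _ => Finset.sum_congr rfl fun q _ => ?_
      rw [h.quad_symm γ q p]
      simp only [Matrix.mul_apply, Matrix.transpose_apply]
      congr 1
      exact Finset.sum_congr rfl fun r _ => by rw [h.invMetric_comm q r, mul_comm]
    have k2 : ∑ p, ∑ q, (X * invMetric φ) p q * quad φ γ p q =
        ∑ p, ∑ r, X p r * (quad φ γ * invMetric φ) p r := by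
      refine Finset.sum_congr rfl fun p _ => ?_
      simp only [Matrix.mul_apply, Finset.sum_mul, Finset.mul_sum]
      rw [Finset.sum_comm]
      refine Finset.sum_congr rfl fun r _ => Finset.sum_congr rfl fun q _ => ?_
      rw [h.invMetric_comm r q]; ring
    simp only [Matrix.neg_apply, Matrix.add_apply, neg_mul, add_mul, Finset.sum_neg_distrib,
      Finset.sum_add_distrib, k1, k2]
    ring
  have e5 : ∑ p, ∑ r, X p r * gradient lam φ γ σ p r =
      X.trace * ((contract φ σ).trace + 4 * lam) - 4 * ∑ p, ∑ r, X p r * contract φ σ p r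
        + 12 * ∑ p, ∑ r, X p r * (quad φ γ * invMetric φ) p r := by
    have : ∀ p r, X p r * gradient lam φ γ σ p r =
        ((contract φ σ).trace + 4 * lam) * (delta p r * X p r)
        - 4 * (X p r * contract φ σ p r) + 12 * (X p r * (quad φ γ * invMetric φ) p r) := by
      intro p r
      simp only [gradient, Matrix.add_apply, Matrix.sub_apply, Matrix.smul_apply,
        Matrix.one_apply, smul_eq_mul, delta]
      ring
    simp only [this, Finset.sum_add_distrib, Finset.sum_sub_distrib, ← Finset.mul_sum,
      sum_delta_mul, Matrix.trace, Matrix.diag_apply]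
    ring
  rw [h.topWedge_act_right hσ, h.topWedge_eq_trace hσ] at e1
  rw [e3] at e2
  rw [firstVariation, h.topWedge_wedgeWith, e4, e2, e5]
  linear_combination e1

end IsMetricFrame


/-! ### Frames determine the metric; curves of Cayley forms -/

lemma exists_ne_ne (x y : Fin 8) : ∃ z, x ≠ z ∧ y ≠ z := by
  revert x y; decide

namespace IsFrame

variable {φ : Form 4} {A B A' B' : Matrix (Fin 8) (Fin 8) ℝ}

lemma isCayley (h : IsFrame φ A B) : IsCayley φ := by
  refine ⟨(Matrix.toLin'OfInv h.mul_eq_one' h.mul_eq_one).toContinuousLinearEquiv, ?_⟩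
  apply comp_injective
  rw [comp_compContinuousLinearMap, h.comp_eq]
  congr 1
  ext a i
  simp [basisVec, Matrix.toLin'OfInv]

/-- The formulas of `sqrt_detMinors` involve only φ, so two frames have the same Gram matrix. -/
lemma gram_eq (h : IsFrame φ A B) (h' : IsFrame φ A' B') (x y : Fin 8) :
    B x ⬝ᵥ B y = B' x ⬝ᵥ B' y := by
  by_cases hxy : x = y
  · subst hxy
    obtain ⟨y, hy, -⟩ := exists_ne_ne x x
    obtain ⟨z, hz, hz'⟩ := exists_ne_ne x y
    rw [← (h.sqrt_detMinors hy hz hz').2.1, (h'.sqrt_detMinors hy hz hz').2.1]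
  · obtain ⟨z, hz, hz'⟩ := exists_ne_ne x y
    rw [← (h.sqrt_detMinors hxy hz hz').2.2, (h'.sqrt_detMinors hxy hz hz').2.2]

/-- Any two frames of a Cayley form define the same metric. -/
lemma isMetricFrame (h : IsFrame φ A B) : IsMetricFrame φ A B where
  toIsFrame := h
  metric_eq := by
    obtain ⟨A', B', h'⟩ := h.isCayley.exists_metricFrame
    have e : B * B.transpose = B' * B'.transpose := by
      ext x y
      exact h.gram_eq h'.toIsFrame x y
    have e1 : (A.transpose * A) * (B * B.transpose) = 1 := by
      rw [Matrix.mul_assoc, ← Matrix.mul_assoc A, h.mul_eq_one, Matrix.one_mul,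
        ← Matrix.transpose_mul, h.mul_eq_one', Matrix.transpose_one]
    have e2 : (B * B.transpose) * (A'.transpose * A') = 1 := by
      rw [e, Matrix.mul_assoc, ← Matrix.mul_assoc B'.transpose, ← Matrix.transpose_mul,
        h'.mul_eq_one, Matrix.transpose_one, Matrix.one_mul, h'.mul_eq_one']
    rw [h'.metric_eq]
    exact (left_inv_eq_right_inv e1 e2).symm

end IsFrame

/-! ### Curves in the orbit and their velocities -/

/-- The curve is exp(uX), invertible for every u with inverse at -u, so pullback along it stays in
the orbit for all times. The statement is entrywise, and the norm on matrices remains internal to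
the proof. -/
lemma exists_exp_curve (X : Matrix (Fin 8) (Fin 8) ℝ) : ∃ E : ℝ → Matrix (Fin 8) (Fin 8) ℝ,
    (∀ i j, ContDiff ℝ ∞ fun u => E u i j) ∧ (∀ u, E u * E (-u) = 1) ∧ E 0 = 1 ∧
      (∀ i j, HasDerivAt (fun u => E u i j) (X i j) 0) ∧
      ∀ i j, HasDerivAt (fun u => E (-u) i j) ((-X) i j) 0 := by
  suffices h : ∃ E : ℝ → Matrix (Fin 8) (Fin 8) ℝ,
      (∀ i j, ContDiff ℝ ∞ fun u => E u i j) ∧ (∀ u, E u * E (-u) = 1) ∧ E 0 = 1 ∧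
        ∀ i j, HasDerivAt (fun u => E u i j) (X i j) 0 by
    obtain ⟨E, h1, h2, h3, h4⟩ := h
    refine ⟨E, h1, h2, h3, h4, fun i j => ?_⟩
    have h5 : HasDerivAt (fun u => E u i j) (X i j) (-0) := by rw [neg_zero]; exact h4 i j
    have h6 := h5.scomp (0 : ℝ) (hasDerivAt_neg (0 : ℝ))
    rw [neg_smul, one_smul] at h6
    exact h6
  let _ : NormedRing (Matrix (Fin 8) (Fin 8) ℝ) := Matrix.linftyOpNormedRing
  let _ : NormedAlgebra ℝ (Matrix (Fin 8) (Fin 8) ℝ) := Matrix.linftyOpNormedAlgebra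
  let entry : ∀ i j, Matrix (Fin 8) (Fin 8) ℝ →L[ℝ] ℝ := fun i j =>
    LinearMap.toContinuousLinearMap (Matrix.entryLinearMap ℝ ℝ i j)
  have hd : ContDiff ℝ ∞ (fun u : ℝ => NormedSpace.exp (u • X)) := by
    have : ContDiff ℝ ∞ (NormedSpace.exp : Matrix (Fin 8) (Fin 8) ℝ → _) := by
      exact contDiff_iff_contDiffAt.2 fun x => (NormedSpace.exp_analytic (𝕂 := ℝ) x).contDiffAt
    exact this.comp (contDiff_id.smul contDiff_const)
  refine ⟨fun u => NormedSpace.exp (u • X), fun i j => (entry i j).contDiff.comp hd,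
    fun u => ?_, by simp, fun i j => ?_⟩
  · change NormedSpace.exp (u • X) * NormedSpace.exp (-u • X) = 1
    rw [neg_smul, ← Matrix.exp_add_of_commute _ _ (Commute.neg_right (Commute.refl (u • X))),
      add_neg_cancel, NormedSpace.exp_zero]
  · have := (hasDerivAt_exp_smul_const (𝕂 := ℝ) X (0 : ℝ))
    have h2 := (entry i j).hasFDerivAt.comp_hasDerivAt 0 this
    rw [zero_smul, NormedSpace.exp_zero, one_mul] at h2
    exact h2

/-- The pullback of a form by a matrix. -/
def pullForm (E : Matrix (Fin 8) (Fin 8) ℝ) (φ : Form 4) : Form 4 := formOf (pull E (comp φ))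

lemma comp_pullForm (E : Matrix (Fin 8) (Fin 8) ℝ) (φ : Form 4) :
    comp (pullForm E φ) = pull E (comp φ) := by
  rw [pullForm, comp_formOf, ((isAlt_comp φ).pull E).alt_eq]

lemma pullForm_one (φ : Form 4) : pullForm 1 φ = φ := by
  apply comp_injective
  rw [comp_pullForm, pull_one]

lemma IsMetricFrame.pullForm {φ : Form 4} {A B E F : Matrix (Fin 8) (Fin 8) ℝ}
    (h : IsMetricFrame φ A B) (hEF : E * F = 1) :
    IsMetricFrame (pullForm E φ) (A * E) (F * B) :=
  IsFrame.isMetricFrame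
    { mul_eq_one := by
        rw [Matrix.mul_assoc, ← Matrix.mul_assoc E, hEF, Matrix.one_mul, h.mul_eq_one]
      comp_eq := by rw [comp_pullForm, h.comp_eq, pull_pull] }

lemma IsMetricFrame.invMetric_pullForm {φ : Form 4} {A B E F : Matrix (Fin 8) (Fin 8) ℝ}
    (h : IsMetricFrame φ A B) (hEF : E * F = 1) :
    invMetric (Spin7.pullForm E φ) = F * invMetric φ * F.transpose := by
  rw [(h.pullForm hEF).invMetric_eq, h.invMetric_eq, Matrix.transpose_mul]
  simp only [Matrix.mul_assoc]

lemma hasDerivAt_congruence {F : ℝ → Matrix (Fin 8) (Fin 8) ℝ} {Y : Matrix (Fin 8) (Fin 8) ℝ}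
    (hF : ∀ i j, HasDerivAt (fun u => F u i j) (Y i j) 0) (h0 : F 0 = 1)
    (G : Matrix (Fin 8) (Fin 8) ℝ) (i j : Fin 8) :
    HasDerivAt (fun u => (F u * G * (F u).transpose) i j) ((Y * G + G * Y.transpose) i j) 0 := by
  have h : HasDerivAt (fun u => ∑ k, (∑ l, F u i l * G l k) * F u j k)
      (∑ k, ((∑ l, Y i l * G l k) * F 0 j k + (∑ l, F 0 i l * G l k) * Y j k)) 0 :=
    HasDerivAt.fun_sum fun k _ => (HasDerivAt.fun_sum fun l _ => (hF i l).mul_const _).mul (hF j k)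
  simp only [h0, Matrix.one_apply] at h
  refine h.congr_deriv ?_
  simp [Matrix.mul_apply, Finset.sum_add_distrib]

/-- The last two indices raised. -/
def raiseTwo (φ : Form 4) (t : Tensor 4) (i j p q : Fin 8) : ℝ :=
  ∑ r, ∑ s, t ![i, j, r, s] * invMetric φ r p * invMetric φ s q

/-- The velocity of `Φ_{ij}^{pq}` for a velocity `η` of `Φ` and `H` of the inverse metric. -/
def phi22Velocity (φ : Form 4) (η : Tensor 4) (H : Matrix (Fin 8) (Fin 8) ℝ)
    (i j p q : Fin 8) : ℝ :=
  raiseTwo φ η i j p q + ∑ r, ∑ s, comp φ ![i, j, r, s] *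
    (H r p * invMetric φ s q + invMetric φ r p * H s q)

section

variable {V : ℝ → Form 4} {η : Tensor 4} {H : Matrix (Fin 8) (Fin 8) ℝ}

lemma hasDerivAt_phi22 (hη : ∀ I, HasDerivAt (fun s => comp (V s) I) (η I) 0)
    (hH : ∀ i j, HasDerivAt (fun s => invMetric (V s) i j) (H i j) 0) (i j p q : Fin 8) :
    HasDerivAt (fun s => phi22 (V s) i j p q) (phi22Velocity (V 0) η H i j p q) 0 := by
  have h : HasDerivAt (fun s => phi22 (V s) i j p q) _ 0 :=
    HasDerivAt.fun_sum fun r _ => HasDerivAt.fun_sum fun s _ =>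
      ((hη ![i, j, r, s]).fun_mul (hH r p)).fun_mul (hH s q)
  refine h.congr_deriv ?_
  simp only [phi22Velocity, raiseTwo, ← Finset.sum_add_distrib]
  exact Finset.sum_congr rfl fun _ _ => Finset.sum_congr rfl fun _ _ => by ring

/-- Differentiate the double contraction identity. With two indices up and two down, its right side
contains only constant deltas besides Φ, and no metric. -/
lemma phi22Velocity_constraint (hV : ∀ s, IsCayley (V s))
    (hη : ∀ I, HasDerivAt (fun s => comp (V s) I) (η I) 0)
    (hH : ∀ i j, HasDerivAt (fun s => invMetric (V s) i j) (H i j) 0) (i j a b : Fin 8) :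
    ∑ p, ∑ q, (phi22Velocity (V 0) η H i j p q * phi22 (V 0) p q a b +
      phi22 (V 0) i j p q * phi22Velocity (V 0) η H p q a b) =
        -4 * phi22Velocity (V 0) η H i j a b := by
  have hP := hasDerivAt_phi22 hη hH
  have h1 : HasDerivAt (fun s => ∑ p, ∑ q, phi22 (V s) i j p q * phi22 (V s) p q a b) _ 0 :=
    HasDerivAt.fun_sum fun p _ => HasDerivAt.fun_sum fun q _ => (hP i j p q).mul (hP p q a b)
  have h2 : HasDerivAt (fun s => 6 * (delta i a * delta j b - delta i b * delta j a)
      - 4 * phi22 (V s) i j a b) (-(4 * phi22Velocity (V 0) η H i j a b)) 0 :=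
    ((hP i j a b).const_mul 4).const_sub _
  have e : (fun s => ∑ p, ∑ q, phi22 (V s) i j p q * phi22 (V s) p q a b) = fun s =>
      6 * (delta i a * delta j b - delta i b * delta j a) - 4 * phi22 (V s) i j a b := by
    funext s
    obtain ⟨A, B, hAB⟩ := (hV s).exists_metricFrame
    exact hAB.sum_phi22_mul_phi22 i j a b
  rw [e] at h1
  rw [h1.unique h2]
  ring

end

namespace IsMetricFrame

variable {φ : Form 4} {A B : Matrix (Fin 8) (Fin 8) ℝ} {D : Tensor 4}

lemma raiseTwo_injective (h : IsMetricFrame φ A B) {t : Tensor 4}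
    (ht : ∀ i j p q, raiseTwo φ t i j p q = 0) : t = 0 := by
  have e : ∀ i j : Fin 8, Matrix.of (fun r s => t ![i, j, r, s]) = 0 := by
    intro i j
    have e1 : invMetric φ * Matrix.of (fun r s => t ![i, j, r, s]) * invMetric φ = 0 := by
      ext p q
      rw [Matrix.zero_apply, ← ht i j p q]
      simp only [raiseTwo, Matrix.mul_apply, Matrix.of_apply, Finset.sum_mul]
      rw [Finset.sum_comm]
      exact Finset.sum_congr rfl fun r _ => Finset.sum_congr rfl fun s _ => by
        rw [h.invMetric_comm p r]; ring
    have e2 : metric φ * (invMetric φ * Matrix.of (fun r s => t ![i, j, r, s]) * invMetric φ) *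
        metric φ = Matrix.of (fun r s => t ![i, j, r, s]) := by
      rw [Matrix.mul_assoc (invMetric φ), ← Matrix.mul_assoc, h.metric_mul_inv, Matrix.one_mul,
        Matrix.mul_assoc, h.inv_mul_metric, Matrix.mul_one]
    rw [← e2, e1, Matrix.mul_zero, Matrix.zero_mul]
  ext I
  rw [← vec4_eta I]
  exact congrFun (congrFun (e (I 0) (I 1)) (I 2)) (I 3)

/-- With the raised pair lowered again, the constraint reads P + P' + 4D = 0, where P = ΦD and P' is
P with its pairs exchanged. Antisymmetrising gives 2 alt P = -4D, and J₄ = 3 alt P. -/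
lemma J4_of_constraint (h : IsMetricFrame φ A B) (hD : IsAlt D)
    (hc : ∀ i j a b, ∑ p, ∑ q, (raiseTwo φ D i j p q * phi22 φ p q a b +
      phi22 φ i j p q * raiseTwo φ D p q a b) = -4 * raiseTwo φ D i j a b) :
    J4 φ D = (-6 : ℝ) • D := by
  have e1 : ∀ i j a b, ∑ p, ∑ q, phi22 φ i j p q * raiseTwo φ D p q a b =
      raiseTwo φ (pairTensor φ D) i j a b := by
    intro i j a b
    simp only [raiseTwo, pairTensor, Finset.mul_sum, Finset.sum_mul]
    rw [sum_comm_two_two]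
    refine Finset.sum_congr rfl fun r _ => Finset.sum_congr rfl fun s _ =>
      Finset.sum_congr rfl fun p _ => Finset.sum_congr rfl fun q _ => ?_
    simp only [Matrix.cons_val]
    rw [hD.pair_swap p q r s]
    ring
  have e2 : ∀ i j a b, ∑ p, ∑ q, raiseTwo φ D i j p q * phi22 φ p q a b =
      raiseTwo φ (fun I => pairTensor φ D ![I 2, I 3, I 0, I 1]) i j a b := by
    intro i j a b
    have k1 : ∀ r s, ∑ p, ∑ q, invMetric φ r p * invMetric φ s q * phi22 φ p q a b =
        phiUp φ r s a b := fun r s => rfl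
    have k2 : ∀ r s, phiUp φ r s a b = ∑ u, ∑ v,
        phi22 φ u v r s * invMetric φ u a * invMetric φ v b := fun r s => by
      rw [h.phiUp_eq, ← m4_pair_swap, ← h.phiUp_eq, phiUp]
      exact Finset.sum_congr rfl fun u _ => Finset.sum_congr rfl fun v _ => by
        rw [h.invMetric_comm a u, h.invMetric_comm b v]; ring
    trans ∑ r, ∑ s, D ![i, j, r, s] * phiUp φ r s a b
    · simp only [raiseTwo, ← k1, Finset.mul_sum, Finset.sum_mul]
      rw [sum_comm_two_two]
      exact Finset.sum_congr rfl fun r _ => Finset.sum_congr rfl fun s _ =>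
        Finset.sum_congr rfl fun p _ => Finset.sum_congr rfl fun q _ => by ring
    · simp only [k2, raiseTwo, pairTensor, Matrix.cons_val, Finset.mul_sum, Finset.sum_mul]
      rw [sum_comm_two_two]
      exact Finset.sum_congr rfl fun r _ => Finset.sum_congr rfl fun s _ =>
        Finset.sum_congr rfl fun p _ => Finset.sum_congr rfl fun q _ => by ring
  have e3 : pairTensor φ D + (fun I => pairTensor φ D ![I 2, I 3, I 0, I 1]) + (4 : ℝ) • D
      = 0 := by
    refine h.raiseTwo_injective fun i j a b => ?_
    have k := hc i j a b
    simp only [Finset.sum_add_distrib, e1, e2] at k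
    have k2 : raiseTwo φ (pairTensor φ D + (fun I => pairTensor φ D ![I 2, I 3, I 0, I 1])
        + (4 : ℝ) • D) i j a b = raiseTwo φ (pairTensor φ D) i j a b +
          raiseTwo φ (fun I => pairTensor φ D ![I 2, I 3, I 0, I 1]) i j a b
            + 4 * raiseTwo φ D i j a b := by
      simp only [raiseTwo, Pi.add_apply, Pi.smul_apply, smul_eq_mul, add_mul, mul_assoc,
        Finset.sum_add_distrib, ← Finset.mul_sum]
    rw [k2]
    linarith
  have e4 := congrArg alt e3
  rw [alt_add, alt_add, alt_pair_swap, alt_smul, hD.alt_eq] at e4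
  rw [J4_eq]
  ext I
  have := congrFun e4 I
  have z : alt (0 : Tensor 4) I = 0 := by simp [alt]
  simp only [Pi.add_apply, Pi.smul_apply, smul_eq_mul, z] at this ⊢
  linarith

/-- Solutions of the linearised constraint at fixed metric are infinitesimal rotations of `φ`. -/
lemma eq_act_of_J4 (h : IsMetricFrame φ A B) (hD : IsAlt D) (hJ : J4 φ D = (-6 : ℝ) • D) :
    ∃ X, D = act X (comp φ) ∧ X * invMetric φ + invMetric φ * X.transpose = 0 := by
  set M := contract φ D with hM
  -- Inserting M into Φ gives 6D + 18D = 24D, which also equals a quarter of the action of Mᵀ; hence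
  -- 1/96.
  set X := (1 / 96 : ℝ) • M.transpose with hX
  have e1 : D = act X (comp φ) := by
    have := h.alt_insert_contract hD
    rw [hJ, alt_insertTensor, ← hM] at this
    have k : act X (comp φ) = (1 / 96 : ℝ) • act M.transpose (comp φ) := by
      ext I
      simp [act, hX, Finset.mul_sum, mul_assoc]
    ext I
    have := congrFun this I
    simp only [k, Pi.smul_apply, Pi.sub_apply, smul_eq_mul] at this ⊢
    linarith
  -- Contracting D = `act X Φ` once more gives an eigenvalue equation for M, from which its
  -- tracelessness and antisymmetry are read off.
  have e2 : ∀ i b, 72 * M i b = 18 * M.trace * delta b i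
      - 12 * ∑ j, ∑ a, M j a * phi22 φ i a b j := by
    intro i b
    have k1 : ∀ a j, X a j = (1 / 96) * M j a := fun a j => by
      rw [hX, Matrix.smul_apply, Matrix.transpose_apply, smul_eq_mul]
    have k2 : X.trace = (1 / 96) * M.trace := by
      rw [hX, Matrix.trace_smul, Matrix.trace_transpose, smul_eq_mul]
    have k3 : ∑ j, ∑ a, X a j * phi22 φ i a b j =
        (1 / 96) * ∑ j, ∑ a, M j a * phi22 φ i a b j := by
      simp only [k1, mul_assoc, Finset.mul_sum]
    have k4 : M i b = 24 * X b i + 18 * X.trace * delta b i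
        - 12 * ∑ j, ∑ a, X a j * phi22 φ i a b j := by
      rw [← h.contract_act X i b, ← e1]
    rw [k3, k2, k1] at k4
    linear_combination 96 * k4
  -- The trace of the equation is 72 t = 18 · 8 · t, as the term in Φ is traceless.
  have e3 : M.trace = 0 := by
    have k1 : ∑ i, ∑ j, ∑ a, M j a * phi22 φ i a i j = 0 := by
      rw [sum_rotate]
      refine Finset.sum_eq_zero fun j _ => Finset.sum_eq_zero fun a _ => ?_
      have : ∑ i, phi22 φ i a i j = ∑ i, phi22 φ a i j i := Finset.sum_congr rfl fun i _ => by
        rw [h.phi22_swap01 a i, h.phi22_swap23 a i j i, neg_neg]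
      rw [← Finset.mul_sum, this, h.sum_phi22_trace, mul_zero]
    have k2 : ∑ i, 72 * M i i = ∑ i, (18 * M.trace * delta i i
      - 12 * ∑ j, ∑ a, M j a * phi22 φ i a i j) := Finset.sum_congr rfl fun i _ => e2 i i
    rw [Finset.sum_sub_distrib, ← Finset.mul_sum, ← Finset.mul_sum, ← Finset.mul_sum, k1] at k2
    have k3 : ∑ i : Fin 8, M i i = M.trace := rfl
    rw [k3] at k2
    simp only [delta, if_true, Finset.sum_const, Finset.card_univ, Fintype.card_fin,
      nsmul_eq_mul] at k2
    push_cast at k2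
    linarith
  refine ⟨X, e1, ?_⟩
  -- Once i is raised, the right side is antisymmetric in c and b. So GM is antisymmetric, and X
  -- leaves the metric unchanged.
  have e4 : ∀ c b, 72 * (invMetric φ * M) c b = - 12 * ∑ j, ∑ a, M j a *
      m4 (B c) (A.transpose a) (B b) (B j) := by
    intro c b
    have k : ∀ i, 72 * (invMetric φ c i * M i b) =
        -12 * ∑ j, ∑ a, invMetric φ c i * (M j a * phi22 φ i a b j) := fun i => by
      have := e2 i b
      rw [e3] at this
      simp only [← Finset.mul_sum]
      linear_combination invMetric φ c i * this
    rw [Matrix.mul_apply, Finset.mul_sum]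
    simp only [k, ← Finset.mul_sum (a := (-12 : ℝ))]
    congr 1
    rw [sum_rotate]
    refine Finset.sum_congr rfl fun j _ => Finset.sum_congr rfl fun a _ => ?_
    rw [← h.raise (m4_lin0 (A.transpose a) (B b) (B j)) c, Finset.mul_sum]
    exact Finset.sum_congr rfl fun i _ => by rw [h.phi22_eq]; ring
  ext c b
  have e5 : (invMetric φ * M) b c = - (invMetric φ * M) c b := by
    have k : 72 * (invMetric φ * M) b c = - (72 * (invMetric φ * M) c b) := by
      rw [e4, e4, ← mul_neg]
      simp only [← Finset.sum_neg_distrib]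
      congr 1
      exact Finset.sum_congr rfl fun j _ => Finset.sum_congr rfl fun a _ => by
        rw [m4_swap02]; ring
    linarith
  have e6 : (X * invMetric φ) c b = (1 / 96) * (invMetric φ * M) b c := by
    rw [hX, Matrix.smul_mul, Matrix.smul_apply, smul_eq_mul, Matrix.mul_apply, Matrix.mul_apply]
    congr 1
    exact Finset.sum_congr rfl fun i _ => by
      rw [h.invMetric_comm b i, Matrix.transpose_apply]; ring
  have e7 : (invMetric φ * X.transpose) c b = (1 / 96) * (invMetric φ * M) c b := by
    rw [hX, Matrix.transpose_smul, Matrix.transpose_transpose, Matrix.mul_smul,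
      Matrix.smul_apply, smul_eq_mul]
  rw [Matrix.add_apply, e6, e7, e5, Matrix.zero_apply]
  ring

end IsMetricFrame

/-- The velocities of a curve of pullbacks of a Cayley form. -/
lemma IsMetricFrame.hasDerivAt_pullForm {φ : Form 4} {A B X : Matrix (Fin 8) (Fin 8) ℝ}
    (h : IsMetricFrame φ A B) {E F : ℝ → Matrix (Fin 8) (Fin 8) ℝ} (hEF : ∀ s, E s * F s = 1)
    (h0 : E 0 = 1) (hE : ∀ i j, HasDerivAt (fun s => E s i j) (X i j) 0)
    (hF : ∀ i j, HasDerivAt (fun s => F s i j) ((-X) i j) 0) :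
    (∀ I, HasDerivAt (fun s => comp (Spin7.pullForm (E s) φ) I) (act X (comp φ) I) 0) ∧
    ∀ i j, HasDerivAt (fun s => invMetric (Spin7.pullForm (E s) φ) i j)
      ((-(X * invMetric φ + invMetric φ * X.transpose)) i j) 0 := by
  refine ⟨fun I => ?_, fun i j => ?_⟩
  · simp only [comp_pullForm]
    exact hasDerivAt_pull hE h0 _ I
  · simp only [fun s => h.invMetric_pullForm (hEF s)]
    have hF0 : F 0 = 1 := by
      have := hEF 0
      rwa [h0, Matrix.one_mul] at this
    have := hasDerivAt_congruence hF hF0 (invMetric φ) i j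
    rwa [Matrix.transpose_neg, Matrix.neg_mul, Matrix.mul_neg, ← neg_add] at this

lemma act_add_left {k : ℕ} (X Y : Matrix (Fin 8) (Fin 8) ℝ) (t : Tensor k) :
    act (X + Y) t = act X t + act Y t := by
  ext I
  simp [act, add_mul, Finset.sum_add_distrib]

/-- The velocity of a curve of Cayley forms is an infinitesimal pullback. -/
lemma exists_velocity {V : ℝ → Form 4} {η : Tensor 4} {H : Matrix (Fin 8) (Fin 8) ℝ}
    (hV : ∀ s, IsCayley (V s))
    (hη : ∀ I, HasDerivAt (fun s => comp (V s) I) (η I) 0)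
    (hH : ∀ i j, HasDerivAt (fun s => invMetric (V s) i j) (H i j) 0) :
    ∃ X, η = act X (comp (V 0)) ∧
      H = -(X * invMetric (V 0) + invMetric (V 0) * X.transpose) := by
  obtain ⟨A, B, h⟩ := (hV 0).exists_metricFrame
  have hηalt : IsAlt η := fun σ I => (hη _).unique <| by
    simp only [fun s => isAlt_comp (V s) σ I]
    exact (hη I).const_mul _
  have hHs : H.transpose = H := by
    ext i j
    refine (hH j i).unique ?_
    have : (fun s => invMetric (V s) j i) = fun s => invMetric (V s) i j := by
      funext s
      obtain ⟨A, B, h⟩ := (hV s).exists_metricFrame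
      exact h.invMetric_comm j i
    rw [this]
    exact hH i j
  have hgs : (metric (V 0)).transpose = metric (V 0) := by
    ext i j
    exact h.metric_comm j i
  -- This X₁ produces exactly the metric velocity H: the two terms XG and GXᵀ contribute one half
  -- each.
  set X₁ := (-(1 / 2) : ℝ) • (H * metric (V 0)) with hX₁
  have hX₁H : -(X₁ * invMetric (V 0) + invMetric (V 0) * X₁.transpose) = H := by
    rw [hX₁, Matrix.transpose_smul, Matrix.transpose_mul, hHs, hgs, Matrix.smul_mul,
      Matrix.mul_smul, Matrix.mul_assoc, h.metric_mul_inv, ← Matrix.mul_assoc,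
      h.inv_mul_metric, Matrix.one_mul, Matrix.mul_one, ← add_smul]
    norm_num
  obtain ⟨E, -, hinv, h0, hE, hE'⟩ := exists_exp_curve X₁
  obtain ⟨hη₁, hH₁⟩ := h.hasDerivAt_pullForm hinv h0 hE hE'
  have c1 := phi22Velocity_constraint (fun s => (h.pullForm (hinv s)).toIsFrame.isCayley) hη₁ hH₁
  have c2 := phi22Velocity_constraint hV hη hH
  simp only [h0, pullForm_one, hX₁H] at c1
  have hsub : ∀ i j a b, raiseTwo (V 0) (η - act X₁ (comp (V 0))) i j a b =
      phi22Velocity (V 0) η H i j a b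
        - phi22Velocity (V 0) (act X₁ (comp (V 0))) H i j a b := fun i j a b => by
    simp only [phi22Velocity, raiseTwo, Pi.sub_apply, sub_mul, Finset.sum_sub_distrib]
    ring
  have hD := hηalt.sub ((isAlt_comp (V 0)).act X₁)
  -- The given curve and the curve generated by X₁ have the same metric velocity. In the difference
  -- of their linearised constraints H cancels, leaving the constraint at fixed metric.
  obtain ⟨X₂, e1, e2⟩ := h.eq_act_of_J4 hD (h.J4_of_constraint hD fun i j a b => by
    simp only [hsub]
    have d1 := c1 i j a b
    have d2 := c2 i j a b
    rw [mul_sub, ← d1, ← d2, ← Finset.sum_sub_distrib]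
    refine Finset.sum_congr rfl fun p _ => ?_
    rw [← Finset.sum_sub_distrib]
    exact Finset.sum_congr rfl fun q _ => by ring)
  refine ⟨X₁ + X₂, ?_, ?_⟩
  · rw [act_add_left, ← e1, add_sub_cancel]
  · rw [Matrix.transpose_add, Matrix.add_mul, Matrix.mul_add]
    nth_rewrite 1 [← hX₁H]
    rw [add_add_add_comm, e2, add_zero]


/-! ### Smoothness -/

section

variable {Z : Type*} [NormedAddCommGroup Z] [NormedSpace ℝ Z] {S : Set Z}

/-- The components of a family of tensors are smooth on `S`. -/
def SmoothTensor {k : ℕ} (t : Z → Tensor k) (S : Set Z) : Prop :=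
  ∀ I, ContDiffOn ℝ ∞ (fun z => t z I) S

/-- The entries of a family of matrices are smooth on `S`. -/
def SmoothMatrix (G : Z → Matrix (Fin 8) (Fin 8) ℝ) (S : Set Z) : Prop :=
  ∀ i j, ContDiffOn ℝ ∞ (fun z => G z i j) S

lemma _root_.ContDiffOn.smoothTensor_comp {k : ℕ} {ψ : Z → Form k} (h : ContDiffOn ℝ ∞ ψ S) :
    SmoothTensor (fun z => comp (ψ z)) S := fun I =>
  (ContinuousAlternatingMap.apply ℝ Space ℝ fun j => basisVec (I j)).contDiff.comp_contDiffOn h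

namespace SmoothTensor

variable {k : ℕ}

lemma alt {t : Z → Tensor k} (h : SmoothTensor t S) : SmoothTensor (fun z => alt (t z)) S :=
  fun _ => contDiffOn_const.mul <| ContDiffOn.sum fun _ _ => contDiffOn_const.mul (h _)

lemma add {s t : Z → Tensor k} (hs : SmoothTensor s S) (ht : SmoothTensor t S) :
    SmoothTensor (fun z => s z + t z) S := fun I => (hs I).add (ht I)

lemma sub {s t : Z → Tensor k} (hs : SmoothTensor s S) (ht : SmoothTensor t S) :
    SmoothTensor (fun z => s z - t z) S := fun I => (hs I).sub (ht I)

lemma smul {t : Z → Tensor k} (ht : SmoothTensor t S) (c : ℝ) :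
    SmoothTensor (fun z => c • t z) S := fun I => contDiffOn_const.mul (ht I)

lemma formOf {t : Z → Tensor k} (h : SmoothTensor t S) :
    ContDiffOn ℝ ∞ (fun z => formOf (t z)) S :=
  contDiffOn_const.fun_smul <| ContDiffOn.sum fun I _ => (h I).fun_smul contDiffOn_const

lemma pull {t : Z → Tensor k} {E : Z → Matrix (Fin 8) (Fin 8) ℝ} (hE : SmoothMatrix E S)
    (ht : SmoothTensor t S) : SmoothTensor (fun z => pull (E z) (t z)) S := fun I =>
  ContDiffOn.sum fun J _ => (contDiffOn_prod fun j _ => hE (J j) (I j)).mul (ht J)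

lemma topWedge {s t : Z → Tensor 4} (hs : SmoothTensor s S) (ht : SmoothTensor t S) :
    ContDiffOn ℝ ∞ (fun z => topWedge (s z) (t z)) S :=
  contDiffOn_const.mul <| ContDiffOn.sum fun _ _ => (contDiffOn_const.mul (hs _)).mul (ht _)

end SmoothTensor

variable {ψ : Z → Form 4}

lemma smooth_vol (hψ : SmoothTensor (fun z => comp (ψ z)) S) :
    ContDiffOn ℝ ∞ (fun z => vol (ψ z)) S :=
  contDiffOn_const.mul (hψ.topWedge hψ)

lemma IsCayley.vol_ne_zero {φ : Form 4} (h : IsCayley φ) : vol φ ≠ 0 := by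
  obtain ⟨A, B, h⟩ := h.exists_metricFrame
  exact h.toIsFrame.vol_ne_zero

lemma smooth_dualTensor (hψ : SmoothTensor (fun z => comp (ψ z)) S)
    (hc : ∀ z ∈ S, IsCayley (ψ z)) : SmoothTensor (fun z => dualTensor (ψ z)) S := fun I =>
  ContDiffOn.fun_div (hψ.topWedge (t := fun _ => comp (dx I)) fun _ => contDiffOn_const)
    (smooth_vol hψ) fun z hz => (hc z hz).vol_ne_zero

lemma smooth_minorInv (hψ : SmoothTensor (fun z => comp (ψ z)) S)
    (hc : ∀ z ∈ S, IsCayley (ψ z)) (i a j b : Fin 8) :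
    ContDiffOn ℝ ∞ (fun z => minorInv (ψ z) i a j b) S := by
  have hd := smooth_dualTensor hψ hc
  exact contDiffOn_const.mul <| (contDiffOn_const.mul (hd _)).sub <|
    ContDiffOn.sum fun _ _ => ContDiffOn.sum fun _ _ => ContDiffOn.sum fun _ _ =>
      ContDiffOn.sum fun _ _ => ((hd _).mul (hd _)).mul (hψ _)

/-- The metric is defined by choice, but on Cayley forms its inverse agrees with the explicit
expressions `invDiag` and `invOffDiag`, whose radicands are positive. -/
lemma smooth_invMetric (hψ : SmoothTensor (fun z => comp (ψ z)) S)
    (hc : ∀ z ∈ S, IsCayley (ψ z)) : SmoothMatrix (fun z => invMetric (ψ z)) S := by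
  have hm := smooth_minorInv hψ hc
  have hdet : ∀ {x y z : Fin 8}, x ≠ y → x ≠ z → y ≠ z →
      ContDiffOn ℝ ∞ (fun w => √(detMinors (ψ w) x y z)) S ∧
        ∀ w ∈ S, √(detMinors (ψ w) x y z) ≠ 0 := by
    intro x y z hxy hxz hyz
    have hpos : ∀ w ∈ S, 0 < detMinors (ψ w) x y z := fun w hw => by
      obtain ⟨A, B, h⟩ := (hc w hw).exists_metricFrame
      exact (h.toIsFrame.sqrt_detMinors hxy hxz hyz).1
    refine ⟨ContDiffOn.sqrt ?_ fun w hw => (hpos w hw).ne', fun w hw =>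
      (Real.sqrt_pos.2 (hpos w hw)).ne'⟩
    unfold detMinors
    fun_prop
  intro x y
  by_cases hxy : x = y
  · subst hxy
    obtain ⟨y, hy, -⟩ := exists_ne_ne x x
    obtain ⟨z, hz, hz'⟩ := exists_ne_ne x y
    obtain ⟨h1, h2⟩ := hdet hy hz hz'
    refine ContDiffOn.congr (f := fun w => invDiag (ψ w) x y z) ?_ fun w hw => ?_
    · unfold invDiag
      refine ContDiffOn.fun_div ?_ h1 h2
      fun_prop
    · obtain ⟨A, B, h⟩ := (hc w hw).exists_metricFrame
      rw [(h.toIsFrame.sqrt_detMinors hy hz hz').2.1, h.dot_row_row]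
  · obtain ⟨z, hz, hz'⟩ := exists_ne_ne x y
    obtain ⟨h1, h2⟩ := hdet hxy hz hz'
    refine ContDiffOn.congr (f := fun w => invOffDiag (ψ w) x y z) ?_ fun w hw => ?_
    · unfold invOffDiag
      refine ContDiffOn.fun_div ?_ h1 h2
      fun_prop
    · obtain ⟨A, B, h⟩ := (hc w hw).exists_metricFrame
      rw [(h.toIsFrame.sqrt_detMinors hxy hz hz').2.2, h.dot_row_row]

lemma smooth_phi22 (hψ : SmoothTensor (fun z => comp (ψ z)) S)
    (hc : ∀ z ∈ S, IsCayley (ψ z)) (i j p q : Fin 8) :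
    ContDiffOn ℝ ∞ (fun z => phi22 (ψ z) i j p q) S := by
  have hG := smooth_invMetric hψ hc
  exact ContDiffOn.sum fun _ _ => ContDiffOn.sum fun _ _ => ((hψ _).mul (hG _ _)).mul (hG _ _)

lemma smooth_phiUp (hψ : SmoothTensor (fun z => comp (ψ z)) S)
    (hc : ∀ z ∈ S, IsCayley (ψ z)) (i j p q : Fin 8) :
    ContDiffOn ℝ ∞ (fun z => phiUp (ψ z) i j p q) S := by
  have hG := smooth_invMetric hψ hc
  exact ContDiffOn.sum fun _ _ => ContDiffOn.sum fun _ _ =>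
    ((hG _ _).mul (hG _ _)).mul (smooth_phi22 hψ hc _ _ _ _)

lemma smooth_wedgePhi (hψ : SmoothTensor (fun z => comp (ψ z)) S)
    (hc : ∀ z ∈ S, IsCayley (ψ z)) {C : Z → Form 3}
    (hC : SmoothTensor (fun z => comp (C z)) S) :
    SmoothTensor (fun z => wedgePhi (ψ z) (C z)) S := by
  have hG := smooth_invMetric hψ hc
  exact SmoothTensor.alt fun I => ContDiffOn.sum fun _ _ => ContDiffOn.sum fun _ _ =>
    ((hG _ _).mul (hC _)).mul (hC _)

lemma smooth_contract (hψ : SmoothTensor (fun z => comp (ψ z)) S)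
    (hc : ∀ z ∈ S, IsCayley (ψ z)) {σ : Z → Tensor 4} (hσ : SmoothTensor σ S) :
    SmoothMatrix (fun z => contract (ψ z) (σ z)) S := fun i b => by
  simp only [contract, Matrix.of_apply]
  exact ContDiffOn.sum fun _ _ => ContDiffOn.sum fun _ _ => ContDiffOn.sum fun _ _ =>
    (hσ _).mul (smooth_phiUp hψ hc _ _ _ _)

lemma smooth_gradient (lam : ℝ) (hψ : SmoothTensor (fun z => comp (ψ z)) S)
    (hc : ∀ z ∈ S, IsCayley (ψ z)) {C : Z → Form 3}
    (hC : SmoothTensor (fun z => comp (C z)) S) {σ : Z → Tensor 4} (hσ : SmoothTensor σ S) :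
    SmoothMatrix (fun z => gradient lam (ψ z) (C z) (σ z)) S := fun p r => by
  have hN := smooth_contract hψ hc hσ
  have hG := smooth_invMetric hψ hc
  have hP := smooth_phiUp hψ hc
  refine (((ContDiffOn.add (ContDiffOn.sum fun i _ => hN i i) contDiffOn_const).mul
    contDiffOn_const).sub (contDiffOn_const.mul (hN p r))).add (contDiffOn_const.mul ?_)
  simp only [Matrix.mul_apply, quad, Matrix.of_apply]
  exact ContDiffOn.sum fun q _ => ContDiffOn.mul (ContDiffOn.sum fun _ _ =>
    ContDiffOn.sum fun _ _ => ContDiffOn.sum fun _ _ => ContDiffOn.sum fun _ _ =>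
      ((hP _ _ _ _).mul (hC _)).mul (hC _)) (hG _ _)

end

/-! ### Smoothness of the torsion and of the exterior derivative -/

variable {U : Set Space} {Φ : Space → Form 4}

lemma smooth_partialDeriv {k : ℕ} {α : Space → Form k} (hU : IsOpen U)
    (hα : ContDiffOn ℝ ∞ α U) : SmoothTensor (partialDeriv α) U := fun I =>
  ((hα.smoothTensor_comp (Fin.tail I)).fderiv_of_isOpen hU (m := ∞) le_rfl).clm_apply
    contDiffOn_const

lemma smooth_torsion (hU : IsOpen U) (hΦ : ContDiffOn ℝ ∞ Φ U)
    (hc : ∀ x ∈ U, IsCayley (Φ x)) : ContDiffOn ℝ ∞ (torsion Φ) U := by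
  have hψ := hΦ.smoothTensor_comp
  have hG := smooth_invMetric hψ hc
  have hS : SmoothTensor (starD Φ) U := fun I =>
    contDiffOn_const.mul <| ContDiffOn.sum fun L _ => ContDiffOn.sum fun M _ =>
      (((smooth_vol hψ).mul contDiffOn_const).mul (contDiffOn_prod fun j _ => hG _ _)).mul
        (smooth_partialDeriv hU hΦ M)
  have hJ : SmoothTensor (fun x => J3 (Φ x) (starD Φ x)) U :=
    SmoothTensor.smul (SmoothTensor.alt fun I => ContDiffOn.sum fun _ _ =>
      ContDiffOn.sum fun _ _ => (smooth_phi22 hψ hc _ _ _ _).mul (hS _)) _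
  exact SmoothTensor.formOf (((hJ.add (hS.smul 5)).smul (1 / 6)).smul (5 / 2))

lemma comp_extDeriv {k : ℕ} {C : Space → Form k} {x : Space} (hC : DifferentiableAt ℝ C x)
    (I : Fin (k + 1) → Fin 8) : comp (extDeriv C x) I = ∑ i : Fin (k + 1), (-1) ^ i.val *
      fderiv ℝ (fun y => comp (C y) (i.removeNth I)) x (basisVec (I i)) := by
  rw [comp, extDeriv_apply hC]
  refine Finset.sum_congr rfl fun i _ => ?_
  rw [zsmul_eq_mul]
  push_cast
  rfl

lemma smooth_extDeriv {k : ℕ} {C : Space → Form k} (hU : IsOpen U) (hC : ContDiffOn ℝ ∞ C U) :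
    SmoothTensor (fun x => comp (extDeriv C x)) U := fun I => by
  refine ContDiffOn.congr (f := fun x => ∑ i : Fin (k + 1), (-1) ^ i.val *
      fderiv ℝ (fun y => comp (C y) (i.removeNth I)) x (basisVec (I i))) ?_ fun x hx =>
    comp_extDeriv ((hC.contDiffAt (hU.mem_nhds hx)).differentiableAt (by simp)) I
  exact ContDiffOn.sum fun i _ => contDiffOn_const.mul <|
    ((hC.smoothTensor_comp _).fderiv_of_isOpen hU (m := ∞) le_rfl).clm_apply contDiffOn_const

/-- The array of partial derivatives is already antisymmetric in its last three indices, so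
weight-one antisymmetrisation averages the four terms that `extDeriv` sums. -/
lemma alt_partialDeriv {C : Space → Form 3} {x : Space} (hC : DifferentiableAt ℝ C x) :
    alt (partialDeriv C x) = (1 / 4 : ℝ) • comp (extDeriv C x) := by
  have e : ∀ a b c d, alt (partialDeriv C x) ![a, b, c, d] =
      ((1 / 4 : ℝ) • comp (extDeriv C x)) ![a, b, c, d] := by
    intro a b c d
    set t : Fin 8 → Fin 8 → Fin 8 → Fin 8 → ℝ := fun a b c d =>
      partialDeriv C x ![a, b, c, d] with ht
    have s1 : ∀ a b c d, t a c b d = - t a b c d := fun a b c d => by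
      have : (fun y => comp (C y) ![c, b, d]) = fun y => - comp (C y) ![b, c, d] := by
        funext y
        have := isAlt_comp (C y) (Equiv.swap 0 1) ![b, c, d]
        rw [Equiv.Perm.sign_swap (by decide)] at this
        simpa using (congrArg (comp (C y)) (funext fun j => by fin_cases j <;> rfl)).trans this
      exact (congrArg (fun f => fderiv ℝ f x (basisVec a)) this).trans (by rw [fderiv_fun_neg]; rfl)
    have s2 : ∀ a b c d, t a b d c = - t a b c d := fun a b c d => by
      have : (fun y => comp (C y) ![b, d, c]) = fun y => - comp (C y) ![b, c, d] := by
        funext y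
        have := isAlt_comp (C y) (Equiv.swap 1 2) ![b, c, d]
        rw [Equiv.Perm.sign_swap (by decide)] at this
        simpa using (congrArg (comp (C y)) (funext fun j => by fin_cases j <;> rfl)).trans this
      exact (congrArg (fun f => fderiv ℝ f x (basisVec a)) this).trans (by rw [fderiv_fun_neg]; rfl)
    have k : comp (extDeriv C x) ![a, b, c, d] = t a b c d - t b a c d + t c a b d
        - t d a b c := by
      have r0 : (0 : Fin 4).removeNth ![a, b, c, d] = ![b, c, d] := by ext j; fin_cases j <;> rfl
      have r1 : (1 : Fin 4).removeNth ![a, b, c, d] = ![a, c, d] := by ext j; fin_cases j <;> rfl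
      have r2 : (2 : Fin 4).removeNth ![a, b, c, d] = ![a, b, d] := by ext j; fin_cases j <;> rfl
      have r3 : (3 : Fin 4).removeNth ![a, b, c, d] = ![a, b, c] := by ext j; fin_cases j <;> rfl
      have ht' : ∀ a b c d, t a b c d =
        fderiv ℝ (fun y => comp (C y) ![b, c, d]) x (basisVec a) := fun _ _ _ _ => rfl
      rw [comp_extDeriv hC, Fin.sum_univ_four, r0, r1, r2, r3]
      simp only [ht']
      simp
      ring
    rw [alt_four, Pi.smul_apply, smul_eq_mul, k]
    simp only [ht] at s1 s2 ⊢
    linarith [s1 a b c d, s2 a b c d, s1 a b d c, s2 a c b d, s2 a d b c, s1 a c d b,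
      s1 b a c d, s2 b a c d, s1 b a d c, s2 b c a d, s2 b d a c, s1 b c d a,
      s1 c a b d, s2 c a b d, s1 c a d b, s2 c b a d, s2 c d a b, s1 c b d a,
      s1 d a b c, s2 d a b c, s1 d a c b, s2 d b a c, s2 d c a b, s1 d b c a]
  ext I
  rw [← vec4_eta I]
  exact e _ _ _ _

/-- The component form of the field equation is a quarter of its differential form version. -/
lemma indexExpr_eq (lam : ℝ) {T : Space → Form 3} {x : Space} (hT : DifferentiableAt ℝ T x) :
    indexExpr lam Φ T x = (1 / 4 : ℝ) • formExpr lam Φ T x := by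
  rw [indexExpr, formExpr, alt_partialDeriv hT, K]
  module


open MeasureTheory

/-! ### The Euler–Lagrange equations -/

section

variable {U R : Set Space}

lemma hasDerivAt_slice {f : ℝ × Space → ℝ} (hU : IsOpen U)
    (hf : ContDiffOn ℝ ∞ f (Set.univ ×ˢ U)) {x : Space} (hx : x ∈ U) (s : ℝ) :
    HasDerivAt (fun s => f (s, x)) (fderiv ℝ f (s, x) (1, 0)) s := by
  have h1 : DifferentiableAt ℝ f (s, x) :=
    (hf.contDiffAt ((isOpen_univ.prod hU).mem_nhds ⟨trivial, hx⟩)).differentiableAt (by simp)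
  exact h1.hasFDerivAt.comp_hasDerivAt s ((hasDerivAt_id s).prodMk (hasDerivAt_const s x))

/-- Differentiation under the integral; the derivative in s is bounded on the compact set [-1, 1] ×
R, which supplies the dominating constant. -/
lemma hasDerivAt_setIntegral {f : ℝ × Space → ℝ} (hU : IsOpen U) (hR : IsCompact R)
    (hRU : R ⊆ U) (hf : ContDiffOn ℝ ∞ f (Set.univ ×ˢ U)) :
    HasDerivAt (fun s => ∫ x in R, f (s, x)) (∫ x in R, fderiv ℝ f (0, x) (1, 0)) 0 := by
  have hf' : ContinuousOn (fun z => fderiv ℝ f z (1, 0)) (Set.univ ×ˢ U) :=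
    (hf.continuousOn_fderiv_of_isOpen (isOpen_univ.prod hU) (by simp)).clm_apply
      continuousOn_const
  have hslice : ∀ s : ℝ, ∀ g : ℝ × Space → ℝ, ContinuousOn g (Set.univ ×ˢ U) →
      ContinuousOn (fun x => g (s, x)) R := fun s g hg =>
    hg.comp (by fun_prop) fun x hx => ⟨trivial, hRU hx⟩
  have hcpt : IsCompact (Set.Icc (-1 : ℝ) 1 ×ˢ R) := isCompact_Icc.prod hR
  obtain ⟨M, hM⟩ := hcpt.exists_bound_of_continuousOn
    (hf'.mono (Set.prod_mono (Set.subset_univ _) hRU))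
  refine (hasDerivAt_integral_of_dominated_loc_of_deriv_le (bound := fun _ => M)
    (F := fun s x => f (s, x)) (F' := fun s x => fderiv ℝ f (s, x) (1, 0))
    (Icc_mem_nhds (by norm_num : (-1 : ℝ) < 0) (by norm_num : (0 : ℝ) < 1)) ?_ ?_ ?_ ?_ ?_ ?_).2
  · exact Filter.Eventually.of_forall fun s =>
      (hslice s f hf.continuousOn).aestronglyMeasurable hR.measurableSet
  · exact (hslice 0 f hf.continuousOn).integrableOn_compact hR
  · exact (hslice 0 _ hf').aestronglyMeasurable hR.measurableSet
  · exact (ae_restrict_iff' hR.measurableSet).2 <| Filter.Eventually.of_forall fun x hx s hs =>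
      hM (s, x) ⟨hs, hx⟩
  · exact integrableOn_const hR.measure_lt_top.ne
  · exact (ae_restrict_iff' hR.measurableSet).2 <| Filter.Eventually.of_forall fun x hx s _ =>
      hasDerivAt_slice hU hf (hRU hx) s

end

lemma hasDerivAt_topWedge {a b : ℝ → Tensor 4} {a' b' : Tensor 4}
    (ha : ∀ I, HasDerivAt (fun s => a s I) (a' I) 0)
    (hb : ∀ I, HasDerivAt (fun s => b s I) (b' I) 0) :
    HasDerivAt (fun s => topWedge (a s) (b s)) (topWedge a' (b 0) + topWedge (a 0) b') 0 := by
  have h := (HasDerivAt.fun_sum (u := Finset.univ) fun (σ : Equiv.Perm (Fin 8)) _ =>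
    (((ha (fun j => σ (Fin.castAdd 4 j))).const_mul ((Equiv.Perm.sign σ : ℤ) : ℝ)).fun_mul
      (hb (fun j => σ (Fin.natAdd 4 j))))).const_mul
        (1 / ((Nat.factorial 4 : ℝ) * (Nat.factorial 4 : ℝ)))
  refine h.congr_deriv ?_
  rw [topWedge, topWedge, ← mul_add, ← Finset.sum_add_distrib]

lemma hasDerivAt_wedgePhi {V : ℝ → Form 4} {H : Matrix (Fin 8) (Fin 8) ℝ} (γ : Form 3)
    (hH : ∀ i j, HasDerivAt (fun s => invMetric (V s) i j) (H i j) 0) (I : Fin 4 → Fin 8) :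
    HasDerivAt (fun s => wedgePhi (V s) γ I) (wedgeWith H γ I) 0 :=
  HasDerivAt.const_mul _ <| HasDerivAt.fun_sum fun _ _ => HasDerivAt.const_mul _ <|
    HasDerivAt.fun_sum fun p _ => HasDerivAt.fun_sum fun q _ =>
      ((hH p q).mul_const _).mul_const _

lemma hasDerivAt_lagrangian (lam : ℝ) {V : ℝ → Space → Form 4} {C : Space → Form 3} {x : Space}
    {η : Tensor 4} {H : Matrix (Fin 8) (Fin 8) ℝ}
    (hη : ∀ I, HasDerivAt (fun s => comp (V s x) I) (η I) 0)
    (hH : ∀ i j, HasDerivAt (fun s => invMetric (V s x) i j) (H i j) 0) :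
    HasDerivAt (fun s => lagrangian lam (V s) C x) (firstVariation lam (V 0 x) (C x)
      (comp (extDeriv C x) - (6 : ℝ) • wedgePhi (V 0 x) (C x)) η H) 0 := by
  have h1 := hasDerivAt_topWedge hη (b := fun s => comp (extDeriv C x) -
    (6 : ℝ) • wedgePhi (V s x) (C x)) (b' := -((6 : ℝ) • wedgeWith H (C x)))
    fun I => ((hasDerivAt_wedgePhi (C x) hH I).const_mul 6).const_sub _
  have h2 := ((hasDerivAt_topWedge hη hη).const_mul (1 / 14)).const_mul (lam / 6)
  refine (h1.add h2).congr_deriv ?_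
  rw [firstVariation, ← neg_smul, topWedge_smul_right]
  ring

/-! ### Stationarity and the pointwise equation -/

section

variable {lam : ℝ} {U R : Set Space} {Φ : Space → Form 4} {C : Space → Form 3}

/-- The first variation along the infinitesimal pullback by `X`. -/
def variationDensity (lam : ℝ) (Φ : Space → Form 4) (C : Space → Form 3)
    (X : Matrix (Fin 8) (Fin 8) ℝ) (x : Space) : ℝ :=
  vol (Φ x) / 24 * ∑ p, ∑ r, X p r * gradient lam (Φ x) (C x)
    (comp (extDeriv C x) - (6 : ℝ) • wedgePhi (Φ x) (C x)) p r

lemma hasDerivAt_lagrangian_act {V : ℝ → Space → Form 4} {x : Space}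
    (hc : IsCayley (V 0 x)) {X : Matrix (Fin 8) (Fin 8) ℝ}
    (hη : ∀ I, HasDerivAt (fun s => comp (V s x) I) (act X (comp (V 0 x)) I) 0)
    (hH : ∀ i j, HasDerivAt (fun s => invMetric (V s x) i j)
      ((-(X * invMetric (V 0 x) + invMetric (V 0 x) * X.transpose)) i j) 0) :
    HasDerivAt (fun s => lagrangian lam (V s) C x) (variationDensity lam (V 0) C X x) 0 := by
  obtain ⟨A, B, h⟩ := hc.exists_metricFrame
  have hσ : IsAlt (comp (extDeriv C x) - (6 : ℝ) • wedgePhi (V 0 x) (C x)) :=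
    (isAlt_comp _).sub ((isAlt_alt _).smul 6)
  have := hasDerivAt_lagrangian lam (C := C) hη hH
  rw [h.firstVariation_act hσ, ← h.toIsFrame.vol_eq] at this
  exact this

lemma IsVariation.smooth_lagrangian {V : ℝ → Space → Form 4} (hU : IsOpen U)
    (hV : IsVariation U R Φ V) (hC : ContDiffOn ℝ ∞ C U) :
    ContDiffOn ℝ ∞ (fun z : ℝ × Space => lagrangian lam (V z.1) C z.2) (Set.univ ×ˢ U) := by
  have hψ := hV.smooth.smoothTensor_comp
  have hc : ∀ z ∈ Set.univ ×ˢ U, IsCayley (V (z : ℝ × Space).1 z.2) := fun z hz =>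
    hV.cayley _ _ hz.2
  have hsnd : ∀ {k : ℕ} {t : Space → Tensor k}, SmoothTensor t U →
      SmoothTensor (fun z : ℝ × Space => t z.2) (Set.univ ×ˢ U) := fun ht I =>
    (ht I).comp contDiff_snd.contDiffOn fun z hz => hz.2
  have hγ := hsnd hC.smoothTensor_comp
  exact (hψ.topWedge ((hsnd (smooth_extDeriv hU hC)).sub
    ((smooth_wedgePhi hψ hc (C := fun z : ℝ × Space => C z.2) hγ).smul 6))).add
      (contDiffOn_const.mul (smooth_vol hψ))

lemma smooth_variationDensity (hU : IsOpen U) (hΦ : ContDiffOn ℝ ∞ Φ U)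
    (hc : ∀ x ∈ U, IsCayley (Φ x)) (hC : ContDiffOn ℝ ∞ C U) (X : Matrix (Fin 8) (Fin 8) ℝ) :
    ContDiffOn ℝ ∞ (variationDensity lam Φ C X) U := by
  have hψ := hΦ.smoothTensor_comp
  have hγ := hC.smoothTensor_comp
  have hg := smooth_gradient lam hψ hc hγ
    ((smooth_extDeriv hU hC).sub ((smooth_wedgePhi hψ hc hγ).smul 6))
  exact ((smooth_vol hψ).div_const _).mul <| ContDiffOn.sum fun p _ => ContDiffOn.sum fun r _ =>
    contDiffOn_const.mul (hg p r)

/-- If the gradient vanishes, the action is stationary. -/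
lemma eulerLagrangePhi_of_gradient (hU : IsOpen U) (hC : ContDiffOn ℝ ∞ C U)
    (hg : ∀ x ∈ U, gradient lam (Φ x) (C x)
      (comp (extDeriv C x) - (6 : ℝ) • wedgePhi (Φ x) (C x)) = 0) :
    EulerLagrangePhi lam U Φ C := by
  intro R hR hRU V hV
  have hL := hV.smooth_lagrangian (lam := lam) hU hC
  have h := hasDerivAt_setIntegral hU hR hRU hL
  refine h.congr_deriv (setIntegral_eq_zero_of_forall_eq_zero fun x hx => ?_)
  have hx' := hRU hx
  have hψ := hV.smooth.smoothTensor_comp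
  have hc : ∀ z ∈ Set.univ ×ˢ U, IsCayley (V (z : ℝ × Space).1 z.2) := fun z hz =>
    hV.cayley _ _ hz.2
  have hη := fun I => hasDerivAt_slice hU (hψ I) hx' 0
  have hH := fun i j => hasDerivAt_slice hU (smooth_invMetric hψ hc i j) hx' 0
  -- X is found separately at each x. No dependence on x is needed, since it only shows that the
  -- integrand vanishes at that point.
  obtain ⟨X, e1, e2⟩ := exists_velocity (V := fun s => V s x)
    (H := Matrix.of fun i j => fderiv ℝ (fun z : ℝ × Space => invMetric (V z.1 z.2) i j)
      (0, x) (1, 0)) (fun s => hV.cayley s x hx') hη hH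
  have h1 := hasDerivAt_lagrangian_act (lam := lam) (C := C) (hV.cayley 0 x hx') (X := X)
    (fun I => by rw [← e1]; exact hη I) (fun i j => by rw [← e2]; exact hH i j)
  rw [(hasDerivAt_slice hU hL hx' 0).unique h1, variationDensity, hV.initial x hx', hg x hx']
  simp

/-- The test variation pulls Φ(x) back by exp(s f(x) X). It stays in the orbit and is supported
where f is, and since the Lagrangian has no derivative of Φ, its velocity at x involves f only
through the factor f(x). -/
lemma integral_mul_variationDensity (hU : IsOpen U) (hΦ : ContDiffOn ℝ ∞ Φ U)
    (hc : ∀ x ∈ U, IsCayley (Φ x)) (hC : ContDiffOn ℝ ∞ C U)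
    (hEL : EulerLagrangePhi lam U Φ C) (X : Matrix (Fin 8) (Fin 8) ℝ) {f : Space → ℝ}
    (hf : ContDiff ℝ ∞ f) (hfc : HasCompactSupport f) (hfU : tsupport f ⊆ U) :
    ∫ x, f x * variationDensity lam Φ C X x = 0 := by
  obtain ⟨E, hEs, hinv, h0, hE, hE'⟩ := exists_exp_curve X
  set V : ℝ → Space → Form 4 := fun s x => pullForm (E (s * f x)) (Φ x) with hVdef
  have hf0 : ∀ x, x ∉ tsupport f → f x = 0 := fun x hx => image_eq_zero_of_notMem_tsupport hx
  have hV : IsVariation U (tsupport f) Φ V :=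
    { smooth := by
        have h1 : SmoothMatrix (fun z : ℝ × Space => E (z.1 * f z.2)) (Set.univ ×ˢ U) :=
          fun i j => ((hEs i j).comp (contDiff_fst.mul (hf.comp contDiff_snd))).contDiffOn
        have h2 : SmoothTensor (fun z : ℝ × Space => comp (Φ z.2)) (Set.univ ×ˢ U) := fun I =>
          (hΦ.smoothTensor_comp I).comp contDiff_snd.contDiffOn fun z hz => hz.2
        exact (SmoothTensor.pull h1 h2).formOf
      cayley := fun s x hx => by
        obtain ⟨A, B, h⟩ := (hc x hx).exists_metricFrame
        exact (h.pullForm (hinv _)).toIsFrame.isCayley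
      initial := fun x _ => by simp only [hVdef, zero_mul, h0, pullForm_one]
      support := fun s x hx => by
        simp only [hVdef, hf0 x hx.2, mul_zero, h0, pullForm_one] }
  have h1 := hasDerivAt_setIntegral hU hfc.isCompact hfU (hV.smooth_lagrangian (lam := lam) hU hC)
  have h2 := h1.unique (hEL _ hfc.isCompact hfU V hV)
  rw [← setIntegral_eq_integral_of_forall_compl_eq_zero (s := tsupport f)
    fun x hx => by rw [hf0 x hx, zero_mul], ← h2]
  refine setIntegral_congr_fun (hfc.isCompact.measurableSet) fun x hx => ?_
  have hx' := hfU hx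
  have hscale : ∀ {Y : Matrix (Fin 8) (Fin 8) ℝ} {F : ℝ → Matrix (Fin 8) (Fin 8) ℝ},
      (∀ i j, HasDerivAt (fun u => F u i j) (Y i j) 0) → ∀ i j,
        HasDerivAt (fun s => F (s * f x) i j) ((f x • Y) i j) 0 := by
    intro Y F hF i j
    have k1 : HasDerivAt (fun u => F u i j) (Y i j) (0 * f x) := by rw [zero_mul]; exact hF i j
    have k2 := k1.scomp (0 : ℝ) ((hasDerivAt_id (0 : ℝ)).mul_const (f x))
    rw [one_mul] at k2
    exact k2
  obtain ⟨A, B, h⟩ := (hc x hx').exists_metricFrame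
  have hV0 : V 0 x = Φ x := hV.initial x hx'
  obtain ⟨hη, hH⟩ := h.hasDerivAt_pullForm (X := f x • X) (E := fun s => E (s * f x))
    (F := fun s => E (-(s * f x))) (fun s => hinv _) (by simp only [zero_mul, h0]) (hscale hE)
    (by rw [← smul_neg]; exact hscale hE')
  have h3 := hasDerivAt_lagrangian_act (lam := lam) (C := C) (V := V) (x := x)
    (X := f x • X) (by rw [hV0]; exact hc x hx') (by rw [hV0]; exact hη) (by rw [hV0]; exact hH)
  have h4 := (hasDerivAt_slice hU (hV.smooth_lagrangian (lam := lam) hU hC) hx' 0).unique h3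
  simp only [h4, variationDensity, hV0, Matrix.smul_apply, smul_eq_mul, mul_assoc,
    ← Finset.mul_sum]
  ring

/-- The fundamental lemma of the calculus of variations gives vanishing almost everywhere, and
continuity gives it everywhere. Taking X to be an elementary matrix isolates one entry, and the
volume factor is nonzero. -/
lemma gradient_of_eulerLagrangePhi (hU : IsOpen U) (hΦ : ContDiffOn ℝ ∞ Φ U)
    (hc : ∀ x ∈ U, IsCayley (Φ x)) (hC : ContDiffOn ℝ ∞ C U)
    (hEL : EulerLagrangePhi lam U Φ C) {x : Space} (hx : x ∈ U) :
    gradient lam (Φ x) (C x) (comp (extDeriv C x) - (6 : ℝ) • wedgePhi (Φ x) (C x)) = 0 := by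
  ext p r
  have hs := (smooth_variationDensity (lam := lam) hU hΦ hc hC
    (Matrix.single p r 1)).continuousOn
  have hae : ∀ᵐ y, y ∈ U → variationDensity lam Φ C (Matrix.single p r 1) y = 0 :=
    hU.ae_eq_zero_of_integral_contDiff_smul_eq_zero (hs.locallyIntegrableOn hU.measurableSet)
      fun f hf hfc hfU => integral_mul_variationDensity hU hΦ hc hC hEL _ hf hfc hfU
  have h0 : variationDensity lam Φ C (Matrix.single p r 1) x = 0 :=
    Measure.eqOn_open_of_ae_eq (μ := volume) (g := fun _ => (0 : ℝ))
      ((ae_restrict_iff' hU.measurableSet).2 hae) hU hs continuousOn_const hx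
  rw [variationDensity] at h0
  have h1 := (mul_eq_zero.1 h0).resolve_left (div_ne_zero (hc x hx).vol_ne_zero (by norm_num))
  simpa [Matrix.single_apply, ite_and] using h1

lemma eulerLagrangePhi_iff (hU : IsOpen U) (hΦ : ContDiffOn ℝ ∞ Φ U)
    (hc : ∀ x ∈ U, IsCayley (Φ x)) (hC : ContDiffOn ℝ ∞ C U) :
    EulerLagrangePhi lam U Φ C ↔ ∀ x ∈ U, contract (Φ x) (formExpr lam Φ C x) = 0 := by
  have h : ∀ x ∈ U, (gradient lam (Φ x) (C x)
      (comp (extDeriv C x) - (6 : ℝ) • wedgePhi (Φ x) (C x)) = 0 ↔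
        contract (Φ x) (formExpr lam Φ C x) = 0) := fun x hx => by
    obtain ⟨A, B, h⟩ := (hc x hx).exists_metricFrame
    exact h.gradient_eq_zero_iff lam (C x) _
  refine ⟨fun hEL x hx => (h x hx).1 (gradient_of_eulerLagrangePhi hU hΦ hc hC hEL hx),
    fun h0 => eulerLagrangePhi_of_gradient hU hC fun x hx => (h x hx).2 (h0 x hx)⟩

lemma isAlt_formExpr (lam : ℝ) (Φ : Space → Form 4) (C : Space → Form 3) (x : Space) :
    IsAlt (formExpr lam Φ C x) :=
  (((isAlt_comp _).sub ((isAlt_alt _).smul 6)).sub (((isAlt_alt _).smul 4).smul _)).add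
    ((isAlt_comp _).smul _)

end

end Spin7

end

/-! ### The equivalences for the torsion -/

theorem mainTheorem1 (lam : ℝ) (U : Set Spin7.Space) (hU : IsOpen U)
    (Φ : Spin7.Space → Spin7.Form 4) (hΦ : ContDiffOn ℝ ∞ Φ U)
    (hCayley : ∀ x ∈ U, Spin7.IsCayley (Φ x)) :
    (Spin7.EulerLagrangePhi lam U Φ (Spin7.torsion Φ) ↔
      ∀ x ∈ U, ∃ Ψ : Spin7.Tensor 4, Spin7.IsSymTracefree7 (Φ x) Ψ ∧
        Spin7.indexExpr lam Φ (Spin7.torsion Φ) x = Spin7.psiPhi (Φ x) Ψ) ∧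
    (Spin7.EulerLagrangePhi lam U Φ (Spin7.torsion Φ) ↔
      ∀ x ∈ U, Spin7.InLambda27 (Φ x) (Spin7.formExpr lam Φ (Spin7.torsion Φ) x)) := by
  have hT := Spin7.smooth_torsion hU hΦ hCayley
  rw [Spin7.eulerLagrangePhi_iff hU hΦ hCayley hT]
  refine ⟨forall₂_congr fun x hx => ?_, forall₂_congr fun x hx => ?_⟩ <;>
    obtain ⟨A, B, h⟩ := (hCayley x hx).exists_metricFrame
  · have hTx : DifferentiableAt ℝ (Spin7.torsion Φ) x :=
      (hT.contDiffAt (hU.mem_nhds hx)).differentiableAt (by simp)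
    -- The index form is a quarter of the 4-form, so both have zero contraction at the same time.
    rw [Spin7.indexExpr_eq lam hTx]
    constructor
    · intro h0
      obtain ⟨Ψ, hΨ, e⟩ := h.exists_symTracefree7
        ((Spin7.isAlt_formExpr lam Φ (Spin7.torsion Φ) x).smul (1 / 4))
        (by rw [Spin7.contract_smul, h0, smul_zero])
      exact ⟨Ψ, hΨ, e.symm⟩
    · rintro ⟨Ψ, hΨ, e⟩
      have h1 := hΨ.contract_psiPhi h
      rw [← e, Spin7.contract_smul] at h1
      exact (smul_eq_zero.1 h1).resolve_left (by norm_num)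
  · exact (h.inLambda27_iff (Spin7.isAlt_formExpr lam Φ (Spin7.torsion Φ) x)).symm
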